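/- Let $F_0=0$, $F_1=1$, $F_{k+2}=F_{k+1}+F_k$ be the Fibonacci numbers, and for a nonnegative integer $n$ let $n=\sum_{j\ge 2}\delta_j(n)F_j$ be its Zeckendorf expansion, where $\delta_j(n)\in\{0,1\}$ and $\delta_{j+1}(n)=1$ implies $\delta_j(n)=0$. For real $x\ge 2$ let $\pi(x)$ be the number of primes $p\le x$, and let $L=L(x)$ be the maximal length of a Zeckendorf expansion of an integer $n\le x$, that is, the largest $j$ such that $\delta_j(n)=1$ for some nonnegative integer $n\le x$. Let $\gamma=\frac{1+\sqrt5}{2}$ and let $(Z_j)_{j\ge 0}$ be the stationary Markov chain on $\{0,1\}$ with initial distribution $\mathbb P[Z_0=0]=\frac{\gamma^2}{\gamma^2+1}$, $\mathbb P[Z_0=1]=\frac{1}{\gamma^2+1}$ and transition matrix $$\begin{pmatrix} \frac1\gamma & \frac1{\gamma^2}\\ 1 & 0\end{pmatrix}$$ (rows and columns indexed by $0,1$). Let $0<\kappa<\rho<\frac13\nu$ be real numbers. Then there is a constant $C$, depending only on $\kappa,\rho,\nu$, such that for every real $x\ge 2$, every integer $d$ with $1\le d\le L^{\kappa}$, all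 integers $j_1,\dots,j_d$ (in any order, repetitions allowed) with $L^{\nu}\le j_i\le L-L^{\nu}$ for all $i$, and all $\nu_1,\dots,\nu_d\in\{0,1\}$, $$\left|\frac1{\pi(x)}\#\bigl\{p\le x \text{ prime}:\ \delta_{j_1}(p)=\nu_1,\dots,\delta_{j_d}(p)=\nu_d\bigr\}-\mathbb P\bigl[Z_{j_1}=\nu_1,\dots,Z_{j_d}=\nu_d\bigr]\right|\le C\,e^{-L^{\rho}}.$$ -/

import Mathlib

/-- The digit `δ_j(n)` of the Zeckendorf expansion `n = ∑_{j ≥ 2} δ_j(n) F_j`: it is `1` if the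
Fibonacci number `F_j` occurs in the expansion of `n`, and `0` otherwise. -/
def zeckendorfDigit (j n : ℕ) : Fin 2 := if j ∈ Nat.zeckendorf n then 1 else 0

/-- The length of the Zeckendorf expansion of `n`: the largest index `j` with `δ_j(n) = 1`
(and `0` for `n = 0`). Mathlib lists the indices of the expansion in decreasing order. -/
def zeckendorfLength (n : ℕ) : ℕ := (Nat.zeckendorf n).headD 0

/-- The maximal length of the Zeckendorf expansion of a nonnegative integer `n ≤ x`. -/
noncomputable def maxZeckendorfLength (x : ℝ) : ℕ :=
  (Finset.range (⌊x⌋₊ + 1)).sup zeckendorfLength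

/-- `Z_0, Z_1, …` is a (time-homogeneous) Markov chain on the probability space `(Ω, P)` with values
in the finite set `S`, initial distribution `init` and transition matrix `T`. The Markov property
`P[Z_{n+1} = t | Z_0 = s_0, …, Z_n = s_n] = T (s_n, t)` is written without a quotient. -/
structure IsMarkovChain {Ω S : Type*} [MeasurableSpace Ω] [MeasurableSpace S] [Finite S]
    [DiscreteMeasurableSpace S]
    (P : MeasureTheory.Measure Ω) (Z : ℕ → Ω → S) (init : S → ℝ) (T : Matrix S S ℝ) : Prop where
  measurable : ∀ n, Measurable (Z n)
  initial : ∀ s, P.real {ω | Z 0 ω = s} = init s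
  transition : ∀ (n : ℕ) (s : ℕ → S) (t : S),
    P.real {ω | (∀ i ≤ n, Z i ω = s i) ∧ Z (n + 1) ω = t} =
      P.real {ω | ∀ i ≤ n, Z i ω = s i} * T (s n) t

/-- The transition matrix `[[1/γ, 1/γ²], [1, 0]]`, where `γ` is the golden ratio. -/
noncomputable def digitTransition : Matrix (Fin 2) (Fin 2) ℝ :=
  !![1 / Real.goldenRatio, 1 / Real.goldenRatio ^ 2; 1, 0]

/-- The stationary distribution `(γ²/(γ²+1), 1/(γ²+1))` of `digitTransition`. -/
noncomputable def digitStationary : Fin 2 → ℝ :=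
  ![Real.goldenRatio ^ 2 / (Real.goldenRatio ^ 2 + 1), 1 / (Real.goldenRatio ^ 2 + 1)]

/-- Such a chain exists. -/
theorem exists_digitChain :
    ∃ (P : MeasureTheory.Measure (ℕ → Fin 2)) (Z : ℕ → (ℕ → Fin 2) → Fin 2),
      MeasureTheory.IsProbabilityMeasure P ∧
        IsMarkovChain P Z digitStationary digitTransition := by
  have hg : 0 < Real.goldenRatio := Real.goldenRatio_pos
  have hsq : Real.goldenRatio ^ 2 = Real.goldenRatio + 1 := Real.goldenRatio_sq
  have hB : ∀ a b : ℝ, 0 ≤ a → 0 ≤ b → a + b = 1 → ∃ m : MeasureTheory.Measure (Fin 2),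
      MeasureTheory.IsProbabilityMeasure m ∧ ∀ t, m.real {t} = ![a, b] t := by
    intro a b ha hb hab
    refine ⟨ENNReal.ofReal a • MeasureTheory.Measure.dirac 0 +
      ENNReal.ofReal b • MeasureTheory.Measure.dirac 1, ⟨?_⟩, ?_⟩
    · simp [← ENNReal.ofReal_add ha hb, hab]
    · intro t
      fin_cases t <;> simp [MeasureTheory.measureReal_def, ha, hb]
  obtain ⟨m₀, hm₀, hv₀⟩ := hB (Real.goldenRatio ^ 2 / (Real.goldenRatio ^ 2 + 1))
    (1 / (Real.goldenRatio ^ 2 + 1)) (by positivity) (by positivity) (by field_simp)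
  obtain ⟨m₁, hm₁, hv₁⟩ := hB (1 / Real.goldenRatio) (1 / Real.goldenRatio ^ 2)
    (by positivity) (by positivity) (by
      generalize Real.goldenRatio = g at *
      field_simp
      linarith)
  let μ : ℕ → MeasureTheory.Measure (Fin 2) := fun n => if n = 0 then m₀ else m₁
  have hμ : ∀ n, MeasureTheory.IsProbabilityMeasure (μ n) := by
    intro n; by_cases h : n = 0 <;> simp only [μ, h, if_true, if_false] <;> assumption
  let P := MeasureTheory.Measure.infinitePi μ
  obtain ⟨Z, Z0, Zs⟩ : ∃ Z : ℕ → (ℕ → Fin 2) → Fin 2, (∀ ω, Z 0 ω = ω 0) ∧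
      ∀ n ω, Z (n + 1) ω = if Z n ω = 0 then ω (n + 1) else 0 :=
    ⟨fun n ω => Nat.rec (ω 0) (fun k z => if z = 0 then ω (k + 1) else 0) n,
      fun _ => rfl, fun _ _ => rfl⟩
  have hcoord : ∀ n t, P.real {ω | ω n = t} = (μ n).real {t} := by
    intro n t
    rw [← MeasureTheory.Measure.infinitePi_map_eval μ n, MeasureTheory.map_measureReal_apply
      (measurable_pi_apply n) (MeasurableSet.singleton t)]
    rfl
  have hloc : ∀ n (ω ω' : ℕ → Fin 2), (∀ k ≤ n, ω k = ω' k) → Z n ω = Z n ω' := by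
    intro n
    induction n with
    | zero => intro ω ω' h; rw [Z0, Z0]; exact h 0 le_rfl
    | succ n ih =>
      intro ω ω' h
      rw [Zs, Zs, ih ω ω' (fun k hk => h k (by omega)), h (n + 1) le_rfl]
  have hind : ∀ (n : ℕ) (s : ℕ → Fin 2) (t : Fin 2),
      P.real ({ω | ∀ i ≤ n, Z i ω = s i} ∩ {ω | ω (n + 1) = t}) =
        P.real {ω | ∀ i ≤ n, Z i ω = s i} * P.real {ω | ω (n + 1) = t} := by
    intro n s t
    have h1 := ProbabilityTheory.iIndepFun_infinitePi (P := μ) (X := fun _ (y : Fin 2) => y)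
      (fun _ => measurable_id)
    have h2 := h1.indepFun_finset (Finset.Iic n) {n + 1} (by simp) (fun i => measurable_pi_apply i)
    let e : ((i : Finset.Iic n) → Fin 2) → ℕ → Fin 2 := fun y k =>
      if h : k ∈ Finset.Iic n then y ⟨k, h⟩ else 0
    have h3 := h2.measure_inter_preimage_eq_mul {y | ∀ i ≤ n, Z i (e y) = s i}
      {y | y ⟨n + 1, by simp⟩ = t} (Set.toFinite _).measurableSet (Set.toFinite _).measurableSet
    have e1 : (fun (a : ℕ → Fin 2) (i : Finset.Iic n) => a i) ⁻¹' {y | ∀ i ≤ n, Z i (e y) = s i} =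
        {ω | ∀ i ≤ n, Z i ω = s i} := by
      ext ω
      simp only [Set.mem_preimage, Set.mem_ofPred_eq]
      refine forall₂_congr fun i hi => ?_
      rw [hloc i (e fun i => ω i) ω]
      intro k hk
      simp [e, hk.trans hi]
    rw [e1] at h3
    simp only [MeasureTheory.measureReal_def, ← ENNReal.toReal_mul]
    exact congrArg ENNReal.toReal h3
  refine ⟨P, Z, inferInstance, ?_, ?_, ?_⟩
  · intro n
    induction n with
    | zero => rw [show Z 0 = fun ω => ω 0 from funext Z0]; exact measurable_pi_apply 0
    | succ n ih =>
      rw [show Z (n + 1) = _ from funext (Zs n)]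
      exact Measurable.ite (ih (MeasurableSet.singleton 0)) (measurable_pi_apply (n + 1))
        measurable_const
  · intro s
    simp only [Z0]
    exact (hcoord 0 s).trans (hv₀ s)
  · intro n s t
    by_cases hs : s n = 0
    · have : {ω | (∀ i ≤ n, Z i ω = s i) ∧ Z (n + 1) ω = t} =
          {ω | ∀ i ≤ n, Z i ω = s i} ∩ {ω | ω (n + 1) = t} := by
        ext ω
        simp only [Set.mem_ofPred_eq, Set.mem_inter_iff]
        refine and_congr_right fun h => ?_
        rw [Zs, h n le_rfl, if_pos hs]
      rw [this, hind, hcoord, hs]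
      congr 1
      refine (hv₁ t).trans ?_
      fin_cases t <;> simp [digitTransition]
    · have hs1 : s n = 1 := by omega
      have hz : ∀ ω, (∀ i ≤ n, Z i ω = s i) → Z (n + 1) ω = 0 := fun ω h => by
        rw [Zs, h n le_rfl, if_neg hs]
      rw [hs1]
      by_cases ht : t = 0
      · subst ht
        have : {ω | (∀ i ≤ n, Z i ω = s i) ∧ Z (n + 1) ω = 0} =
            {ω | ∀ i ≤ n, Z i ω = s i} :=
          Set.ext fun ω => ⟨fun h => h.1, fun h => ⟨h, hz ω h⟩⟩
        rw [this]
        simp [digitTransition]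
      · have ht1 : t = 1 := by omega
        have : {ω | (∀ i ≤ n, Z i ω = s i) ∧ Z (n + 1) ω = t} = ∅ := by
          ext ω
          simp only [Set.mem_ofPred_eq, Set.mem_empty_iff_false, iff_false]
          rintro ⟨h, h'⟩
          exact ht (h'.symm.trans (hz ω h))
        rw [this]
        simp [digitTransition, ht1]

/-! Let ψ = -1/γ be the conjugate of γ. Cutting the expansion of n at the index j yields a pair
(`lowVal`, `highVal`): the lower digits evaluated in base γ and divided by γ^j, and the upper digits
evaluated in base ψ. Up to O(γ^(-j)), the point n·(γ^(-j), γ^(1-j)) modulo 1 is a linear image of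
this pair. The pairs with δ_j = 0 and those with δ_j = 1 lie in two rectangles whose union is a
fundamental domain of the corresponding lattice. A digit can therefore be read off a point of the
two-dimensional torus, except near the edges (`nearBoundary_of_dist_le`), and few integers lead
there (`exists_card_nearBoundary_le`).

Digit indicators are replaced by Lipschitz bumps, and these by Fejér means, which are trigonometric
polynomials with controlled coefficients. Pattern frequencies then become combinations of
exponential sums at θ = ∑ (u_i + w_i γ) γ^(-j_i), an element of ℤ[γ]. Primes are compared with all
integers below a huge Fibonacci number instead of with an integral (`abs_avg_digits_sub_le`): for θ
= 0 both normalized sums equal 1 and cancel, for θ ≠ 0 both are small.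

For integers the smallness is a geometric series. For primes it is Vinogradov's estimate, obtained
from Vaughan's identity, which needs a rational approximation a/q of θ with q neither small nor too
large. Smallness of q is excluded by the norm: qθ - a is a nonzero element of ℤ[γ], so |qθ - a|·|qθ'
- a| ≥ 1 for the conjugate θ', whose size is governed by γ^(max j_i)
(`norm_sum_primesLE_expi_div_le`). The lower bound for the j_i gives |θ| < 1 and a thin boundary;
the upper bound keeps |θ'| well below x.

For integers below F_K, suitably normalized counts obey the same linear recursion as the chain. Away
from the prescribed indices the difference contracts by the second eigenvalue -1/γ²
(`exists_avg_digits_sub_le`). In the final balance the coefficients cost exp(O(d L^ρ)), at most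
exp(O(L^(κ+ρ))), while the exponential sums save a power of exp(L^ν). -/

/-! ### Additive characters and geometric sums. -/

/-- The additive character `e(t) = exp (2πit)`. -/
noncomputable def expi (t : ℝ) : ℂ := Complex.exp (2 * Real.pi * t * Complex.I)

/-- The distance of a real number to the nearest integer. -/
noncomputable def nearDist (t : ℝ) : ℝ := |t - round t|

theorem expi_add (s t : ℝ) : expi (s + t) = expi s * expi t := by
  simp only [expi, ← Complex.exp_add]; congr 1; push_cast; ring

theorem expi_zero : expi 0 = 1 := by simp [expi]

theorem expi_int (n : ℤ) : expi n = 1 := by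
  rw [expi, Complex.exp_eq_one_iff]; exact ⟨n, by push_cast; ring⟩

theorem norm_expi (t : ℝ) : ‖expi t‖ = 1 := by
  rw [expi, show (2 * Real.pi * t * Complex.I : ℂ) = ((2 * Real.pi * t : ℝ) : ℂ) * Complex.I by
    push_cast; ring]
  exact Complex.norm_exp_ofReal_mul_I _

theorem expi_nat_mul (n : ℕ) (t : ℝ) : expi (n * t) = expi t ^ n := by
  rw [expi, expi, ← Complex.exp_nat_mul]; congr 1; push_cast; ring

theorem expi_add_int (t : ℝ) (n : ℤ) : expi (t + n) = expi t := by
  rw [expi_add, expi_int, mul_one]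

theorem conj_expi (t : ℝ) : (starRingEnd ℂ) (expi t) = expi (-t) := by
  simp only [expi, ← Complex.exp_conj]
  congr 1
  simp [Complex.conj_ofNat]

theorem expi_sum {ι : Type*} (s : Finset ι) (f : ι → ℝ) :
    expi (∑ i ∈ s, f i) = ∏ i ∈ s, expi (f i) := by
  simp only [expi, ← Complex.exp_sum]; congr 1; push_cast; rw [Finset.mul_sum, Finset.sum_mul]

theorem nearDist_nonneg (t : ℝ) : 0 ≤ nearDist t := abs_nonneg _

theorem nearDist_le_abs_sub_int (t : ℝ) (n : ℤ) : nearDist t ≤ |t - n| := round_le t n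

/-- |e(t) - 1| = 2|sin πt|, and Jordan's inequality |sin y| ≥ 2|y|/π applies after reducing t to
[-1/2, 1/2]. -/
theorem four_mul_nearDist_le (t : ℝ) : 4 * nearDist t ≤ ‖expi t - 1‖ := by
  have h1 : expi t = Complex.exp (Complex.I * ((2 * Real.pi * (t - round t) : ℝ) : ℂ)) := by
    have := expi_add_int (t - round t) (round t)
    rw [sub_add_cancel] at this
    rw [this, expi]; congr 1; push_cast; ring
  rw [h1, Complex.norm_exp_I_mul_ofReal_sub_one]
  have h2 : |t - round t| ≤ 1 / 2 := abs_sub_round t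
  have h3 : 2 * Real.pi * (t - round t) / 2 = Real.pi * (t - round t) := by ring
  rw [h3, norm_mul, Real.norm_eq_abs, Real.norm_eq_abs, abs_two]
  have h4 : |Real.pi * (t - round t)| ≤ Real.pi / 2 := by
    rw [abs_mul, abs_of_pos Real.pi_pos]; nlinarith [Real.pi_pos]
  have h5 := Real.mul_abs_le_abs_sin h4
  rw [abs_mul, abs_of_pos Real.pi_pos] at h5
  have h6 : 2 / Real.pi * (Real.pi * |t - round t|) = 2 * |t - round t| := by
    field_simp
  rw [nearDist]; linarith

/-- Geometric series. The product form of the bound needs no exception for integral `t`. -/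
theorem norm_sum_expi_mul_le (t : ℝ) (a b : ℕ) :
    ‖∑ n ∈ Finset.Ico a b, expi (n * t)‖ * (2 * nearDist t) ≤ 1 := by
  rcases le_total b a with h | h
  · simp [Finset.Ico_eq_empty_of_le h]
  have h1 : (∑ n ∈ Finset.Ico a b, expi (n * t)) * (expi t - 1) = expi t ^ b - expi t ^ a := by
    simp only [expi_nat_mul]; exact geom_sum_Ico_mul _ h
  have h2 : ‖∑ n ∈ Finset.Ico a b, expi (n * t)‖ * ‖expi t - 1‖ ≤ 2 := by
    rw [← norm_mul, h1]
    refine (norm_sub_le _ _).trans ?_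
    simp [norm_expi]; norm_num
  have h3 := four_mul_nearDist_le t
  have := mul_le_mul_of_nonneg_left h3 (norm_nonneg (∑ n ∈ Finset.Ico a b, expi (n * t)))
  linarith

theorem norm_sum_expi_le_card (t : ℝ) (s : Finset ℕ) : ‖∑ n ∈ s, expi (n * t)‖ ≤ s.card := by
  refine (norm_sum_le _ _).trans ?_
  simp [norm_expi]

/-! ### Multiples of a number with a good rational approximation. -/

/-- Multiples `kθ` with `2k ≤ q` stay away from the integers. -/
theorem inv_le_abs_mul_sub_of_approx {θ : ℝ} {a : ℤ} {q : ℕ} (hq : 0 < q)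
    (hc : IsCoprime a (q : ℤ)) (h : |θ - a / q| ≤ 1 / (q : ℝ) ^ 2) {k : ℕ} (hk : 0 < k)
    (hkq : 2 * k ≤ q) (b : ℤ) : 1 / (2 * q : ℝ) ≤ |k * θ - b| := by
  have hq' : (0 : ℝ) < q := by exact_mod_cast hq
  -- By coprimality q would divide k, but 0 < k < q. Hence ka/q is at least 1/q away from `b`, and
  -- replacing a/q by θ costs at most half of this.
  have hne : (k : ℤ) * a - b * q ≠ 0 := by
    intro h0
    have : (q : ℤ) ∣ k * a := ⟨b, by linarith⟩
    have h2 : (q : ℤ) ∣ k := hc.symm.dvd_of_dvd_mul_right this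
    have h3 : q ∣ k := by exact_mod_cast h2
    have := Nat.le_of_dvd hk h3
    omega
  have h1 : (1 : ℝ) ≤ |(k : ℝ) * a - b * q| := by
    have := Int.one_le_abs hne
    exact_mod_cast this
  have h2 : |(k : ℝ) * a / q - b| = |(k : ℝ) * a - b * q| / q := by
    rw [show (k : ℝ) * a / q - b = ((k : ℝ) * a - b * q) / q by field_simp, abs_div,
      abs_of_pos hq']
  have h3 : |(k : ℝ) * θ - k * a / q| ≤ 1 / (2 * q) := by
    rw [show (k : ℝ) * θ - k * a / q = k * (θ - a / q) by ring, abs_mul, Nat.abs_cast]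
    have hk2 : (2 : ℝ) * k ≤ q := by exact_mod_cast hkq
    calc (k : ℝ) * |θ - a / q| ≤ (q / 2) * (1 / (q : ℝ) ^ 2) := by gcongr; linarith
      _ = 1 / (2 * q) := by field_simp
  have h4 : (1 : ℝ) / q ≤ |(k : ℝ) * a / q - b| := by rw [h2]; gcongr
  have h5 : |(k : ℝ) * a / q - b| ≤ |(k : ℝ) * θ - b| + |(k : ℝ) * θ - k * a / q| := by
    have := abs_sub_le ((k : ℝ) * a / q) (k * θ) b
    rw [abs_sub_comm ((k : ℝ) * a / q) (k * θ)] at this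
    linarith
  have h6 : (1 : ℝ) / q = 1 / (2 * q) + 1 / (2 * q) := by field_simp; norm_num
  linarith

/-- The signed distances of hθ - c to the nearest integer lie in [-δ, δ] and are pairwise at least
1/(2q) apart. So h ↦ ⌊2q·distance⌋ is injective into at most 4qδ + 2 integers. -/
theorem card_nearDist_le_of_short {θ : ℝ} {a : ℤ} {q : ℕ} (hq : 0 < q)
    (hc : IsCoprime a (q : ℤ)) (h : |θ - a / q| ≤ 1 / (q : ℝ) ^ 2) (c δ : ℝ) (hδ : 0 ≤ δ)
    (s : Finset ℕ) (hs : ∀ h ∈ s, ∀ k ∈ s, h < k → 2 * (k - h) ≤ q)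
    (hn : ∀ h ∈ s, nearDist (h * θ - c) ≤ δ) : (s.card : ℝ) ≤ 4 * q * δ + 2 := by
  have hq' : (0 : ℝ) < q := by exact_mod_cast hq
  let y : ℕ → ℝ := fun h => h * θ - c - round (h * θ - c)
  let f : ℕ → ℤ := fun h => ⌊2 * q * y h⌋
  have hinj : Set.InjOn f s := by
    have key : ∀ h ∈ s, ∀ k ∈ s, h < k → f h ≠ f k := by
      intro h₁ hh k hk hlt heq
      have h1 := Int.abs_sub_lt_one_of_floor_eq_floor heq
      rw [← mul_sub, abs_mul, abs_of_pos (by positivity)] at h1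
      have h2 := inv_le_abs_mul_sub_of_approx hq hc h (k := k - h₁) (by omega) (hs h₁ hh k hk hlt)
        (round (k * θ - c) - round (h₁ * θ - c))
      have h3 : ((k - h₁ : ℕ) : ℝ) * θ - ((round (k * θ - c) - round (h₁ * θ - c) : ℤ) : ℝ)
          = -(y h₁ - y k) := by
        rw [Nat.cast_sub hlt.le]; push_cast; simp only [y]; ring
      rw [h3, abs_neg, div_le_iff₀ (by positivity)] at h2
      linarith
    intro h₁ hh k hk heq
    rcases lt_trichotomy h₁ k with hlt | hlt | hlt
    · exact absurd heq (key _ hh _ hk hlt)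
    · exact hlt
    · exact absurd heq.symm (key _ hk _ hh hlt)
  have hmap : Set.MapsTo f s (Finset.Icc ⌊-(2 * q * δ)⌋ ⌊2 * q * δ⌋ : Finset ℤ) := by
    intro k hk
    have h1 := abs_le.1 (hn k hk)
    rw [Finset.mem_coe, Finset.mem_Icc]
    have hqq : (0 : ℝ) < 2 * q := by positivity
    constructor
    · refine Int.floor_le_floor ?_
      simp only [y]; nlinarith [h1.1]
    · refine Int.floor_le_floor ?_
      simp only [y]; nlinarith [h1.2]
  have h1 := Finset.card_le_card_of_injOn f hmap hinj
  rw [Int.card_Icc] at h1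
  have h2 : ((⌊2 * q * δ⌋ + 1 - ⌊-(2 * q * δ)⌋).toNat : ℝ) ≤ 4 * q * δ + 2 := by
    have h3 : (0 : ℤ) ≤ ⌊2 * q * δ⌋ + 1 - ⌊-(2 * q * δ)⌋ := by
      have : ⌊-(2 * q * δ)⌋ ≤ ⌊2 * q * δ⌋ := Int.floor_le_floor (by nlinarith)
      omega
    have h4 : ((⌊2 * q * δ⌋ + 1 - ⌊-(2 * q * δ)⌋).toNat : ℝ) =
        ((⌊2 * q * δ⌋ + 1 - ⌊-(2 * q * δ)⌋ : ℤ) : ℝ) := by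
      rw [← Int.cast_natCast, Int.toNat_of_nonneg h3]
    rw [h4]; push_cast
    have := Int.floor_le (2 * q * δ)
    have := Int.lt_floor_add_one (-(2 * q * δ))
    linarith
  have h1' : (s.card : ℝ) ≤ ((⌊2 * q * δ⌋ + 1 - ⌊-(2 * q * δ)⌋).toNat : ℝ) := by exact_mod_cast h1
  linarith

/-- An interval of length `M` contains few `h` for which `hθ` is close to `c` modulo one. -/
theorem card_nearDist_le {θ : ℝ} {a : ℤ} {q : ℕ} (hq : 0 < q)
    (hc : IsCoprime a (q : ℤ)) (h : |θ - a / q| ≤ 1 / (q : ℝ) ^ 2) (c δ : ℝ) (hδ : 0 ≤ δ)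
    (m M : ℕ) :
    (((Finset.Ico m (m + M)).filter fun h : ℕ => nearDist (h * θ - c) ≤ δ).card : ℝ) ≤
      (3 * M / q + 1) * (4 * q * δ + 2) := by
  have hq' : (0 : ℝ) < q := by exact_mod_cast hq
  -- Two elements of one block of length `B` satisfy the spacing condition 2(k - h) ≤ q. The maximum
  -- covers q = 1; with the rounding of q / 2 one still has q ≤ 3B, the source of the factor 3.
  set B := max 1 (q / 2) with hB
  have hBpos : 0 < B := by omega
  have hB3 : q ≤ 3 * B := by omega
  set S := (Finset.Ico m (m + M)).filter fun h : ℕ => nearDist (h * θ - c) ≤ δ with hS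
  let g : ℕ → ℕ := fun h => (h - m) / B
  have h1 : S.card = ∑ b ∈ S.image g, (S.filter fun h => g h = b).card :=
    Finset.card_eq_sum_card_image g S
  have h2 : ∀ b ∈ S.image g, ((S.filter fun h => g h = b).card : ℝ) ≤ 4 * q * δ + 2 := by
    intro b _
    refine card_nearDist_le_of_short hq hc h c δ hδ _ ?_ ?_
    · intro h₁ hh k hk hlt
      simp only [hS, Finset.mem_filter, Finset.mem_Ico, g] at hh hk
      have e1 := Nat.div_add_mod (h₁ - m) B
      have e2 := Nat.div_add_mod (k - m) B
      have e3 := Nat.mod_lt (h₁ - m) hBpos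
      have e4 := Nat.mod_lt (k - m) hBpos
      rw [hh.2] at e1
      rw [hk.2] at e2
      omega
    · intro h₁ hh
      simp only [hS, Finset.mem_filter] at hh
      exact hh.1.2
  have h3 : ((S.image g).card : ℝ) ≤ 3 * M / q + 1 := by
    have h4 : S.image g ⊆ Finset.range (M / B + 1) := by
      intro b hb
      simp only [Finset.mem_image, hS, Finset.mem_filter, Finset.mem_Ico, g] at hb
      obtain ⟨k, ⟨⟨hk1, hk2⟩, _⟩, rfl⟩ := hb
      rw [Finset.mem_range]
      have : (k - m) / B ≤ M / B := Nat.div_le_div_right (by omega)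
      omega
    have h5 := Finset.card_le_card h4
    rw [Finset.card_range] at h5
    have h6 : ((M / B : ℕ) : ℝ) ≤ 3 * M / q := by
      refine Nat.cast_div_le.trans ?_
      have hBp : (0 : ℝ) < B := by exact_mod_cast hBpos
      rw [div_le_div_iff₀ hBp hq']
      have : (q : ℝ) ≤ 3 * B := by exact_mod_cast hB3
      nlinarith [(Nat.cast_nonneg M : (0 : ℝ) ≤ M)]
    have h7 : ((S.image g).card : ℝ) ≤ ((M / B + 1 : ℕ) : ℝ) := by exact_mod_cast h5
    push_cast at h7
    linarith
  rw [h1]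
  push_cast
  calc ∑ b ∈ S.image g, ((S.filter fun h => g h = b).card : ℝ)
      ≤ ∑ b ∈ S.image g, (4 * q * δ + 2) := Finset.sum_le_sum h2
    _ = (S.image g).card * (4 * q * δ + 2) := by rw [Finset.sum_const, nsmul_eq_mul]
    _ ≤ _ := by gcongr

/-! ### Partial summation. -/

/-- Abel summation: each step adds the increment of the weight times a partial sum, so the error is
`B` times the total variation. -/
theorem norm_sum_mul_sub_le (f : ℕ → ℂ) (w : ℕ → ℝ) (B : ℝ) (N : ℕ)
    (hB : ∀ k ≤ N + 1, ‖∑ n ∈ Finset.Icc 1 k, f n‖ ≤ B) :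
    ‖∑ n ∈ Finset.Icc 1 (N + 1), w n * f n - w (N + 1) * ∑ n ∈ Finset.Icc 1 (N + 1), f n‖ ≤
      B * ∑ n ∈ Finset.Icc 1 N, |w (n + 1) - w n| := by
  induction N with
  | zero => simp
  | succ N ih =>
    have h1 := ih fun k hk => hB k (by omega)
    rw [Finset.sum_Icc_succ_top (by omega), Finset.sum_Icc_succ_top (b := N + 1) (by omega) f,
      Finset.sum_Icc_succ_top (b := N) (by omega) (fun n => |w (n + 1) - w n|)]
    have h2 : ∑ n ∈ Finset.Icc 1 (N + 1), (w n : ℂ) * f n + w (N + 1 + 1) * f (N + 1 + 1)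
        - w (N + 1 + 1) * (∑ n ∈ Finset.Icc 1 (N + 1), f n + f (N + 1 + 1)) =
        (∑ n ∈ Finset.Icc 1 (N + 1), (w n : ℂ) * f n - w (N + 1) * ∑ n ∈ Finset.Icc 1 (N + 1), f n)
        - ((w (N + 1 + 1) - w (N + 1) : ℝ) : ℂ) * ∑ n ∈ Finset.Icc 1 (N + 1), f n := by
      push_cast; ring
    rw [h2]
    refine (norm_sub_le _ _).trans ?_
    rw [norm_mul, Complex.norm_real, Real.norm_eq_abs, mul_add]
    have h3 := hB (N + 1) (by omega)
    have h4 := mul_le_mul_of_nonneg_left h3 (abs_nonneg (w (N + 1 + 1) - w (N + 1)))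
    linarith

/-- The variation of a monotone weight telescopes. This version removes the weight log p through 1 /
log; the increasing one below inserts log into a type I sum. -/
theorem norm_sum_mul_le_of_antitone (f : ℕ → ℂ) (w : ℕ → ℝ) (hw : ∀ n, 1 ≤ n → w (n + 1) ≤ w n)
    (hw0 : ∀ n, 0 ≤ w n) (B : ℝ) (N : ℕ) (hB : ∀ k ≤ N, ‖∑ n ∈ Finset.Icc 1 k, f n‖ ≤ B) :
    ‖∑ n ∈ Finset.Icc 1 N, w n * f n‖ ≤ w 1 * B := by
  have hB0 : 0 ≤ B := (norm_nonneg _).trans (hB 0 (by omega))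
  rcases N with _ | N
  · simpa using mul_nonneg (hw0 1) hB0
  have h1 := norm_sum_mul_sub_le f w B N hB
  have h2 : ∑ n ∈ Finset.Icc 1 N, |w (n + 1) - w n| = w 1 - w (N + 1) := by
    clear h1 hB
    induction N with
    | zero => simp
    | succ N ih =>
      rw [Finset.sum_Icc_succ_top (by omega), ih, abs_of_nonpos (by linarith [hw (N + 1) (by omega)])]
      ring
  rw [h2] at h1
  have h3 : ‖(w (N + 1) : ℂ) * ∑ n ∈ Finset.Icc 1 (N + 1), f n‖ ≤ w (N + 1) * B := by
    rw [norm_mul, Complex.norm_real, Real.norm_eq_abs, abs_of_nonneg (hw0 _)]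
    exact mul_le_mul_of_nonneg_left (hB _ le_rfl) (hw0 _)
  have h4 := norm_le_norm_add_norm_sub' (∑ n ∈ Finset.Icc 1 (N + 1), (w n : ℂ) * f n)
    (w (N + 1) * ∑ n ∈ Finset.Icc 1 (N + 1), f n)
  linarith

theorem norm_sum_mul_le_of_monotone (f : ℕ → ℂ) (w : ℕ → ℝ) (hw : ∀ n, 1 ≤ n → w n ≤ w (n + 1))
    (hw0 : ∀ n, 0 ≤ w n) (B : ℝ) (N : ℕ) (hB : ∀ k ≤ N, ‖∑ n ∈ Finset.Icc 1 k, f n‖ ≤ B) :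
    ‖∑ n ∈ Finset.Icc 1 N, w n * f n‖ ≤ 2 * w N * B := by
  have hB0 : 0 ≤ B := (norm_nonneg _).trans (hB 0 (by omega))
  rcases N with _ | N
  · simpa using mul_nonneg (mul_nonneg zero_le_two (hw0 0)) hB0
  have h1 := norm_sum_mul_sub_le f w B N hB
  have h2 : ∑ n ∈ Finset.Icc 1 N, |w (n + 1) - w n| = w (N + 1) - w 1 := by
    clear h1 hB
    induction N with
    | zero => simp
    | succ N ih =>
      rw [Finset.sum_Icc_succ_top (by omega), ih, abs_of_nonneg (by linarith [hw (N + 1) (by omega)])]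
      ring
  rw [h2] at h1
  have h3 : ‖(w (N + 1) : ℂ) * ∑ n ∈ Finset.Icc 1 (N + 1), f n‖ ≤ w (N + 1) * B := by
    rw [norm_mul, Complex.norm_real, Real.norm_eq_abs, abs_of_nonneg (hw0 _)]
    exact mul_le_mul_of_nonneg_left (hB _ le_rfl) (hw0 _)
  have h4 := norm_le_norm_add_norm_sub' (∑ n ∈ Finset.Icc 1 (N + 1), (w n : ℂ) * f n)
    (w (N + 1) * ∑ n ∈ Finset.Icc 1 (N + 1), f n)
  nlinarith [hw0 1]

/-! ### Vaughan's identity and divisor sums. -/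

-- Regrouping the terms with n = mk turns a twisted sum of a Dirichlet convolution into a double sum
-- under the hyperbola, to which type I and type II bounds apply.
open ArithmeticFunction in
theorem sum_Ioc_mul_twist (f g : ArithmeticFunction ℝ) (F : ℕ → ℂ) (N : ℕ) :
    ∑ n ∈ Finset.Ioc 0 N, ((f * g) n : ℂ) * F n =
      ∑ m ∈ Finset.Ioc 0 N, (f m : ℂ) * ∑ k ∈ Finset.Ioc 0 (N / m), (g k : ℂ) * F (m * k) := by
  have h1 : ∑ n ∈ Finset.Ioc 0 N, ((f * g) n : ℂ) * F n =
      ∑ x ∈ Finset.Ioc 0 N ×ˢ Finset.Ioc 0 N with x.1 * x.2 ≤ N,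
        (f x.1 : ℂ) * g x.2 * F (x.1 * x.2) := by
    simp only [mul_apply]
    trans ∑ n ∈ Finset.Ioc 0 N, ∑ x ∈ Finset.Ioc 0 N ×ˢ Finset.Ioc 0 N with x.1 * x.2 = n,
      (f x.1 : ℂ) * g x.2 * F (x.1 * x.2)
    · refine Finset.sum_congr rfl fun n hn ↦ ?_
      simp only [Finset.mem_Ioc] at hn
      rw [Nat.divisorsAntidiagonal_eq_prod_filter_of_le hn.1.ne' hn.2, Complex.ofReal_sum,
        Finset.sum_mul]
      refine Finset.sum_congr rfl fun x hx => ?_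
      rw [(Finset.mem_filter.1 hx).2]; push_cast; ring
    · simp_rw [Finset.sum_filter]
      rw [Finset.sum_comm]
      exact Finset.sum_congr rfl fun _ _ ↦ (by simp_all)
  rw [h1, Finset.sum_filter, Finset.sum_product]
  refine Finset.sum_congr rfl fun n hn ↦ ?_
  rw [← Finset.sum_filter, Finset.mul_sum]
  simp only [Finset.mem_Ioc] at hn
  refine Finset.sum_congr ?_ fun x _ => by ring
  ext k
  simp only [Finset.mem_filter, Finset.mem_Ioc, Nat.le_div_iff_mul_le hn.1, mul_comm k n]
  constructor
  · rintro ⟨h1, h2⟩; exact ⟨h1.1, h2⟩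
  · rintro ⟨h1, h2⟩
    exact ⟨⟨h1, (Nat.le_mul_of_pos_left k hn.1).trans h2⟩, h2⟩

/-- The part of an arithmetic function supported on `n ≤ U`. -/
def lowPart (U : ℕ) (f : ArithmeticFunction ℝ) : ArithmeticFunction ℝ :=
  ⟨fun n => if n ≤ U then f n else 0, by simp⟩

theorem lowPart_apply (U : ℕ) (f : ArithmeticFunction ℝ) (n : ℕ) :
    lowPart U f n = if n ≤ U then f n else 0 := rfl

open ArithmeticFunction in
/-- **Vaughan's identity**. -/
theorem vaughan_identity (U V : ℕ) :
    vonMangoldt = lowPart U vonMangoldt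
      + lowPart V (moebius : ArithmeticFunction ℝ) * log
      - (lowPart V (moebius : ArithmeticFunction ℝ) * lowPart U vonMangoldt) *
          (zeta : ArithmeticFunction ℝ)
      + (vonMangoldt - lowPart U vonMangoldt) *
        (((moebius : ArithmeticFunction ℝ) - lowPart V (moebius : ArithmeticFunction ℝ)) *
          (zeta : ArithmeticFunction ℝ)) := by
  have h1 : vonMangoldt * (zeta : ArithmeticFunction ℝ) = log := vonMangoldt_mul_zeta
  have h2 : (moebius : ArithmeticFunction ℝ) * (zeta : ArithmeticFunction ℝ) = 1 :=
    coe_moebius_mul_coe_zeta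
  -- Only Λ * ζ = log and μ * ζ = 1 enter; the rest is an identity in a commutative ring.
  linear_combination (-(vonMangoldt - lowPart U vonMangoldt)) * h2
    + lowPart V (moebius : ArithmeticFunction ℝ) * h1

theorem sum_inv_le_one_add_log (N : ℕ) :
    ∑ n ∈ Finset.Ioc 0 N, (1 / n : ℝ) ≤ 1 + Real.log N := by
  have h := harmonic_le_one_add_log N
  rw [harmonic_eq_sum_Icc] at h
  push_cast at h
  simpa [one_div] using! h

theorem one_add_log_natCast_nonneg (N : ℕ) : 0 ≤ 1 + Real.log N :=
  add_nonneg zero_le_one (Real.log_natCast_nonneg N)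

theorem log_natCast_mono {m n : ℕ} (h : m ≤ n) : Real.log m ≤ Real.log n := by
  rcases Nat.eq_zero_or_pos m with rfl | hm
  · simpa using Real.log_natCast_nonneg n
  · exact Real.log_le_log (by exact_mod_cast hm) (by exact_mod_cast h)

theorem card_divisors_mul_le (a b : ℕ) :
    (a * b).divisors.card ≤ a.divisors.card * b.divisors.card := by
  rw [Nat.divisors_mul]; exact Finset.card_mul_le

open ArithmeticFunction in
theorem sum_card_divisors_le (N : ℕ) :
    ∑ n ∈ Finset.Ioc 0 N, (n.divisors.card : ℝ) ≤ N * (1 + Real.log N) := by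
  have h1 : ∑ n ∈ Finset.Ioc 0 N, n.divisors.card = ∑ n ∈ Finset.Ioc 0 N, N / n := by
    rw [← sum_Ioc_sigma0_eq_sum_div]
    simp [sigma_zero_apply]
  have h2 : ∑ n ∈ Finset.Ioc 0 N, (n.divisors.card : ℝ) = ∑ n ∈ Finset.Ioc 0 N, ((N / n : ℕ) : ℝ) := by
    exact_mod_cast h1
  rw [h2]
  calc ∑ n ∈ Finset.Ioc 0 N, ((N / n : ℕ) : ℝ) ≤ ∑ n ∈ Finset.Ioc 0 N, (N : ℝ) * (1 / n) := by
        refine Finset.sum_le_sum fun n _ => ?_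
        rw [mul_one_div]; exact Nat.cast_div_le
    _ = N * ∑ n ∈ Finset.Ioc 0 N, (1 / n : ℝ) := by rw [Finset.mul_sum]
    _ ≤ _ := by gcongr; exact sum_inv_le_one_add_log N

open ArithmeticFunction in
theorem sum_card_divisors_div_le (N : ℕ) :
    ∑ n ∈ Finset.Ioc 0 N, (n.divisors.card : ℝ) / n ≤ (1 + Real.log N) ^ 2 := by
  let r : ArithmeticFunction ℝ := ⟨fun n => 1 / n, by simp⟩
  have hr : ∀ n, r n = 1 / n := fun n => rfl
  have h1 : ∀ n ∈ Finset.Ioc 0 N, (n.divisors.card : ℝ) / n = (r * r) n := by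
    intro n hn
    rw [mul_apply]
    have hn0 : n ≠ 0 := by simp at hn; omega
    have : ∀ x ∈ n.divisorsAntidiagonal, r x.1 * r x.2 = 1 / n := by
      intro x hx
      rw [Nat.mem_divisorsAntidiagonal] at hx
      rw [hr, hr, ← hx.1]; push_cast; rw [one_div_mul_one_div]
    rw [Finset.sum_congr rfl this, Finset.sum_const, nsmul_eq_mul]
    have : n.divisorsAntidiagonal.card = n.divisors.card := by
      rw [← Nat.map_div_right_divisors, Finset.card_map]
    rw [this]; ring
  rw [Finset.sum_congr rfl h1, sum_Ioc_mul_eq_sum_sum]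
  have h2 : ∀ n, ∑ m ∈ Finset.Ioc 0 (N / n), r m ≤ 1 + Real.log N := by
    intro n
    refine (sum_inv_le_one_add_log (N / n)).trans ?_
    have := log_natCast_mono (Nat.div_le_self N n)
    linarith
  calc ∑ n ∈ Finset.Ioc 0 N, r n * ∑ m ∈ Finset.Ioc 0 (N / n), r m
      ≤ ∑ n ∈ Finset.Ioc 0 N, r n * (1 + Real.log N) := by
        refine Finset.sum_le_sum fun n _ => mul_le_mul_of_nonneg_left (h2 n) ?_
        rw [hr]; positivity
    _ = (∑ n ∈ Finset.Ioc 0 N, (1 / n : ℝ)) * (1 + Real.log N) := by rw [Finset.sum_mul]; rfl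
    _ ≤ (1 + Real.log N) * (1 + Real.log N) :=
        mul_le_mul_of_nonneg_right (sum_inv_le_one_add_log N) (one_add_log_natCast_nonneg N)
    _ = _ := by ring

-- Write τ for the divisor function. As τ(ab) ≤ τ(a)τ(b) and n has τ(n) factorizations n = ab, τ(n)²
-- is at most (τ * τ)(n), and the first-moment bounds apply to the convolution.
open ArithmeticFunction in
theorem sum_card_divisors_sq_le (N : ℕ) :
    ∑ n ∈ Finset.Ioc 0 N, (n.divisors.card : ℝ) ^ 2 ≤ N * (1 + Real.log N) ^ 3 := by
  let r : ArithmeticFunction ℝ := ⟨fun n => n.divisors.card, by simp⟩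
  have hr : ∀ n, r n = n.divisors.card := fun n => rfl
  have h1 : ∀ n ∈ Finset.Ioc 0 N, (n.divisors.card : ℝ) ^ 2 ≤ (r * r) n := by
    intro n hn
    rw [mul_apply]
    have hc : n.divisorsAntidiagonal.card = n.divisors.card := by
      rw [← Nat.map_div_right_divisors, Finset.card_map]
    calc (n.divisors.card : ℝ) ^ 2 = ∑ x ∈ n.divisorsAntidiagonal, (n.divisors.card : ℝ) := by
          rw [Finset.sum_const, nsmul_eq_mul, hc, sq]
      _ ≤ _ := by
          refine Finset.sum_le_sum fun x hx => ?_
          rw [Nat.mem_divisorsAntidiagonal] at hx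
          rw [hr, hr, ← hx.1]
          exact_mod_cast card_divisors_mul_le x.1 x.2
  refine (Finset.sum_le_sum h1).trans ?_
  rw [sum_Ioc_mul_eq_sum_sum]
  calc ∑ n ∈ Finset.Ioc 0 N, r n * ∑ m ∈ Finset.Ioc 0 (N / n), r m
      ≤ ∑ n ∈ Finset.Ioc 0 N, r n * (N / n * (1 + Real.log N)) := by
        refine Finset.sum_le_sum fun n _ => mul_le_mul_of_nonneg_left ?_ (by rw [hr]; positivity)
        refine (sum_card_divisors_le (N / n)).trans ?_
        have h2 := log_natCast_mono (Nat.div_le_self N n)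
        have h3 : ((N / n : ℕ) : ℝ) ≤ N / n := Nat.cast_div_le
        exact mul_le_mul h3 (by linarith) (one_add_log_natCast_nonneg _) (by positivity)
    _ = (∑ n ∈ Finset.Ioc 0 N, (n.divisors.card : ℝ) / n) * (N * (1 + Real.log N)) := by
        rw [Finset.sum_mul]; refine Finset.sum_congr rfl fun n _ => ?_
        rw [hr]; ring
    _ ≤ (1 + Real.log N) ^ 2 * (N * (1 + Real.log N)) :=
        mul_le_mul_of_nonneg_right (sum_card_divisors_div_le N)
          (mul_nonneg (Nat.cast_nonneg _) (one_add_log_natCast_nonneg N))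
    _ = _ := by ring

/-! ### Bilinear sums. -/

theorem norm_sum_sq_eq (s : Finset ℕ) (f : ℕ → ℂ) :
    ((‖∑ m ∈ s, f m‖ ^ 2 : ℝ) : ℂ) = ∑ m ∈ s, ∑ k ∈ s, (starRingEnd ℂ) (f m) * f k := by
  rw [Complex.ofReal_pow, ← Complex.conj_mul', map_sum, Finset.sum_mul_sum]

/-- The bilinear estimate on a dyadic block. -/
theorem norm_bilinear_block_sq_le {θ : ℝ} {a : ℤ} {q : ℕ} (hq : 0 < q)
    (hc : IsCoprime a (q : ℤ)) (h : |θ - a / q| ≤ 1 / (q : ℝ) ^ 2) (f g : ℕ → ℝ) (A G δ : ℝ)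
    (hδ : 0 < δ) (N M : ℕ) (hM : 0 < M) (hA : ∀ m, m ≤ N → |f m| ≤ A)
    (hG : ∑ n ∈ Finset.Ioc 0 (N / M), g n ^ 2 ≤ G) :
    ‖∑ m ∈ Finset.Ico M (2 * M), (f m : ℂ) *
        ∑ k ∈ Finset.Ioc 0 (N / m), (g k : ℂ) * expi ((m * k : ℕ) * θ)‖ ^ 2 ≤
      G * (A ^ 2 * (M * (((N / M : ℕ) : ℝ) * ((3 * M / q + 1) * (4 * q * δ + 2)) +
        M * (1 / (2 * δ))))) := by
  set N' := N / M with hN'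
  have hA0 : 0 ≤ A := (abs_nonneg _).trans (hA 0 (Nat.zero_le _))
  -- Moving the condition mk ≤ N into the coefficient makes the range of k independent of m, so that
  -- the sums can be interchanged before Cauchy–Schwarz.
  let c : ℕ → ℕ → ℂ := fun k m => if m * k ≤ N then (f m : ℂ) * expi ((m * k : ℕ) * θ) else 0
  have hswap : ∑ m ∈ Finset.Ico M (2 * M), (f m : ℂ) *
        ∑ k ∈ Finset.Ioc 0 (N / m), (g k : ℂ) * expi ((m * k : ℕ) * θ) =
      ∑ k ∈ Finset.Ioc 0 N', (g k : ℂ) * ∑ m ∈ Finset.Ico M (2 * M), c k m := by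
    simp only [Finset.mul_sum]
    rw [Finset.sum_comm (s := Finset.Ioc 0 N')]
    refine Finset.sum_congr rfl fun m hm => ?_
    rw [Finset.mem_Ico] at hm
    have hm0 : 0 < m := by omega
    have hsub : Finset.Ioc 0 (N / m) = (Finset.Ioc 0 N').filter fun k => m * k ≤ N := by
      ext k
      simp only [Finset.mem_filter, Finset.mem_Ioc, Nat.le_div_iff_mul_le hm0, hN',
        Nat.le_div_iff_mul_le hM, mul_comm k]
      constructor
      · rintro ⟨h1, h2⟩
        exact ⟨⟨h1, (Nat.mul_le_mul_right k hm.1).trans h2⟩, h2⟩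
      · rintro ⟨h1, h2⟩; exact ⟨h1.1, h2⟩
    rw [hsub, Finset.sum_filter]
    refine Finset.sum_congr rfl fun k _ => ?_
    simp only [c]
    split_ifs <;> ring
  have hCS : ‖∑ k ∈ Finset.Ioc 0 N', (g k : ℂ) * ∑ m ∈ Finset.Ico M (2 * M), c k m‖ ^ 2 ≤
      (∑ k ∈ Finset.Ioc 0 N', g k ^ 2) *
        ∑ k ∈ Finset.Ioc 0 N', ‖∑ m ∈ Finset.Ico M (2 * M), c k m‖ ^ 2 := by
    have h1 : ‖∑ k ∈ Finset.Ioc 0 N', (g k : ℂ) * ∑ m ∈ Finset.Ico M (2 * M), c k m‖ ≤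
        ∑ k ∈ Finset.Ioc 0 N', |g k| * ‖∑ m ∈ Finset.Ico M (2 * M), c k m‖ := by
      refine (norm_sum_le _ _).trans (le_of_eq ?_)
      simp [Complex.norm_real]
    refine (pow_le_pow_left₀ (norm_nonneg _) h1 2).trans ?_
    refine (Finset.sum_mul_sq_le_sq_mul_sq _ _ _).trans (le_of_eq ?_)
    simp [sq_abs]
  have hpair : ∀ m₁ m₂ : ℕ, ‖∑ k ∈ Finset.Ioc 0 N', (starRingEnd ℂ) (c k m₁) * c k m₂‖ ≤
      A ^ 2 * ‖∑ k ∈ (Finset.Ioc 0 N').filter (fun k => m₁ * k ≤ N ∧ m₂ * k ≤ N),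
        expi (k * (m₂ * θ - m₁ * θ))‖ := by
    intro m₁ m₂
    have h1 : ∑ k ∈ Finset.Ioc 0 N', (starRingEnd ℂ) (c k m₁) * c k m₂ =
        ((f m₁ * f m₂ : ℝ) : ℂ) *
        ∑ k ∈ (Finset.Ioc 0 N').filter (fun k => m₁ * k ≤ N ∧ m₂ * k ≤ N),
          expi (k * (m₂ * θ - m₁ * θ)) := by
      rw [Finset.sum_filter, Finset.mul_sum]
      refine Finset.sum_congr rfl fun k _ => ?_
      simp only [c]
      by_cases e1 : m₁ * k ≤ N <;> by_cases e2 : m₂ * k ≤ N <;> simp [e1, e2]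
      rw [conj_expi, show (k : ℝ) * (m₂ * θ - m₁ * θ) = -(m₁ * k * θ) + m₂ * k * θ by ring,
        expi_add]
      ring
    rw [h1, norm_mul, Complex.norm_real, Real.norm_eq_abs, abs_mul]
    rcases Finset.eq_empty_or_nonempty
      ((Finset.Ioc 0 N').filter (fun k => m₁ * k ≤ N ∧ m₂ * k ≤ N)) with he | ⟨k, hk⟩
    · simp [he]
    · simp only [Finset.mem_filter, Finset.mem_Ioc] at hk
      have e1 := hA m₁ ((Nat.le_mul_of_pos_right m₁ hk.1.1).trans hk.2.1)
      have e2 := hA m₂ ((Nat.le_mul_of_pos_right m₂ hk.1.1).trans hk.2.2)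
      rw [sq]
      gcongr
  have hint : ∀ m₁ m₂ : ℕ, 0 < m₁ → 0 < m₂ →
      (Finset.Ioc 0 N').filter (fun k => m₁ * k ≤ N ∧ m₂ * k ≤ N) =
        Finset.Ico 1 (min N' (min (N / m₁) (N / m₂)) + 1) := by
    intro m₁ m₂ h1 h2
    ext k
    simp only [Finset.mem_filter, Finset.mem_Ioc, Finset.mem_Ico, Nat.lt_add_one_iff, le_min_iff,
      Nat.le_div_iff_mul_le h1, Nat.le_div_iff_mul_le h2, mul_comm k]
    omega
  -- For fixed m₁, the m₂ with (m₂ - m₁)θ within δ of an integer are few and are bounded trivially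
  -- by N'; every other m₂ contributes a geometric sum of size at most 1/(2δ).
  have hrow : ∀ m₁ ∈ Finset.Ico M (2 * M), ∑ m₂ ∈ Finset.Ico M (2 * M),
      ‖∑ k ∈ (Finset.Ioc 0 N').filter (fun k => m₁ * k ≤ N ∧ m₂ * k ≤ N),
        expi (k * (m₂ * θ - m₁ * θ))‖ ≤
      (N' : ℝ) * ((3 * M / q + 1) * (4 * q * δ + 2)) + M * (1 / (2 * δ)) := by
    intro m₁ hm₁
    rw [Finset.mem_Ico] at hm₁
    have hb : ∀ m₂ ∈ Finset.Ico M (2 * M),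
      ‖∑ k ∈ (Finset.Ioc 0 N').filter (fun k => m₁ * k ≤ N ∧ m₂ * k ≤ N),
        expi (k * (m₂ * θ - m₁ * θ))‖ ≤
        (if nearDist (m₂ * θ - m₁ * θ) ≤ δ then (N' : ℝ) else 0) + 1 / (2 * δ) := by
      intro m₂ hm₂
      rw [Finset.mem_Ico] at hm₂
      split_ifs with hnd
      · have h1 := norm_sum_expi_le_card (m₂ * θ - m₁ * θ)
          ((Finset.Ioc 0 N').filter (fun k => m₁ * k ≤ N ∧ m₂ * k ≤ N))
        have h2 : (((Finset.Ioc 0 N').filter (fun k => m₁ * k ≤ N ∧ m₂ * k ≤ N)).card : ℝ) ≤ N' := by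
          have := Finset.card_filter_le (Finset.Ioc 0 N') (fun k => m₁ * k ≤ N ∧ m₂ * k ≤ N)
          rw [Nat.card_Ioc] at this
          exact_mod_cast this
        have : 0 ≤ 1 / (2 * δ) := by positivity
        linarith
      · rw [hint m₁ m₂ (by omega) (by omega), zero_add, le_div_iff₀ (by positivity)]
        refine le_trans ?_ (norm_sum_expi_mul_le (m₂ * θ - m₁ * θ) 1
          (min N' (min (N / m₁) (N / m₂)) + 1))
        gcongr
        exact (not_le.1 hnd).le
    refine (Finset.sum_le_sum hb).trans ?_
    rw [Finset.sum_add_distrib, ← Finset.sum_filter, Finset.sum_const, Finset.sum_const,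
      Nat.card_Ico, nsmul_eq_mul, nsmul_eq_mul, show 2 * M - M = M by omega]
    have h1 := card_nearDist_le hq hc h (m₁ * θ) δ hδ.le M M
    rw [← two_mul] at h1
    have h2 := mul_le_mul_of_nonneg_left h1 (Nat.cast_nonneg N' : (0 : ℝ) ≤ N')
    linarith
  have hsq : ∑ k ∈ Finset.Ioc 0 N', ‖∑ m ∈ Finset.Ico M (2 * M), c k m‖ ^ 2 ≤
      A ^ 2 * (M * ((N' : ℝ) * ((3 * M / q + 1) * (4 * q * δ + 2)) + M * (1 / (2 * δ)))) := by
    have h1 : ((∑ k ∈ Finset.Ioc 0 N', ‖∑ m ∈ Finset.Ico M (2 * M), c k m‖ ^ 2 : ℝ) : ℂ) =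
        ∑ m₁ ∈ Finset.Ico M (2 * M), ∑ m₂ ∈ Finset.Ico M (2 * M),
          ∑ k ∈ Finset.Ioc 0 N', (starRingEnd ℂ) (c k m₁) * c k m₂ := by
      rw [Complex.ofReal_sum, Finset.sum_congr rfl fun k _ => norm_sum_sq_eq _ _, Finset.sum_comm]
      exact Finset.sum_congr rfl fun m _ => Finset.sum_comm
    have h2 : ∑ k ∈ Finset.Ioc 0 N', ‖∑ m ∈ Finset.Ico M (2 * M), c k m‖ ^ 2 =
        ‖∑ m₁ ∈ Finset.Ico M (2 * M), ∑ m₂ ∈ Finset.Ico M (2 * M),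
          ∑ k ∈ Finset.Ioc 0 N', (starRingEnd ℂ) (c k m₁) * c k m₂‖ := by
      rw [← h1, Complex.norm_real, Real.norm_eq_abs, abs_of_nonneg]
      exact Finset.sum_nonneg fun _ _ => by positivity
    rw [h2]
    calc _ ≤ ∑ m₁ ∈ Finset.Ico M (2 * M), ∑ m₂ ∈ Finset.Ico M (2 * M),
          A ^ 2 * ‖∑ k ∈ (Finset.Ioc 0 N').filter (fun k => m₁ * k ≤ N ∧ m₂ * k ≤ N),
            expi (k * (m₂ * θ - m₁ * θ))‖ := by
          refine (norm_sum_le _ _).trans (Finset.sum_le_sum fun m₁ _ => ?_)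
          exact (norm_sum_le _ _).trans (Finset.sum_le_sum fun m₂ _ => hpair m₁ m₂)
      _ ≤ ∑ m₁ ∈ Finset.Ico M (2 * M),
          A ^ 2 * ((N' : ℝ) * ((3 * M / q + 1) * (4 * q * δ + 2)) + M * (1 / (2 * δ))) := by
          refine Finset.sum_le_sum fun m₁ hm₁ => ?_
          rw [← Finset.mul_sum]
          exact mul_le_mul_of_nonneg_left (hrow m₁ hm₁) (by positivity)
      _ = _ := by
          rw [Finset.sum_const, Nat.card_Ico, nsmul_eq_mul, show 2 * M - M = M by omega]; ring
  rw [hswap]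
  refine hCS.trans ?_
  have hG0 : 0 ≤ G := (Finset.sum_nonneg fun _ _ => by positivity).trans hG
  exact mul_le_mul hG hsq (Finset.sum_nonneg fun _ _ => by positivity) hG0

/-- The block estimate with δ = s / N'. It expands into five terms, at most 12, 6, 4, 2 and 1 times
N² / s, and 12 + 6 + 4 + 2 + 1 = 5². -/
theorem bilinear_numeric_bound {M N' N q s l : ℝ} (hM' : 0 < M) (hN'0 : 0 < N') (hq' : 0 < q)
    (hs1 : 1 ≤ s) (hl1 : 1 ≤ l) (hMN : M * N' ≤ N) (hqs : q * s ^ 2 ≤ N) (hss : s ^ 2 ≤ N')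
    (hsM : s ≤ M) (hsq : s ≤ q) :
    N' * l ^ 3 * (l ^ 2 * (M * (N' * ((3 * M / q + 1) * (4 * q * (s / N') + 2)) +
      M * (1 / (2 * (s / N')))))) ≤ (5 * l ^ 3 * (N / √s)) ^ 2 := by
  have hs' : 0 < s := by linarith
  have hP0 : 0 < M * N' := by positivity
  have hN0 : 0 < N := by linarith
  have e1 : N' * l ^ 3 * (l ^ 2 * (M * (N' * ((3 * M / q + 1) * (4 * q * (s / N') + 2)) +
    M * (1 / (2 * (s / N')))))) = l ^ 5 * (12 * (s * M) * (M * N') + 6 * (M * N') ^ 2 / q +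
      4 * (q * s) * (M * N') + 2 * N' * (M * N') + (M * N') ^ 2 / (2 * s)) := by
    field_simp
    ring
  have e2 : (5 * l ^ 3 * (N / √s)) ^ 2 = 25 * l ^ 6 * (N ^ 2 / s) := by
    rw [mul_pow, mul_pow, div_pow, Real.sq_sqrt hs'.le]; ring
  rw [e1, e2]
  obtain ⟨P, hP⟩ : ∃ P, M * N' = P := ⟨_, rfl⟩
  have hPN : P ≤ N := hP ▸ hMN
  have hP1 : 0 < P := hP ▸ hP0
  rw [hP]
  have t1 : 12 * (s * M) * P ≤ 12 * (N ^ 2 / s) := by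
    have : s * M ≤ N / s := by
      rw [le_div_iff₀ hs']
      calc s * M * s = M * s ^ 2 := by ring
        _ ≤ M * N' := by gcongr
        _ ≤ N := hMN
    calc 12 * (s * M) * P ≤ 12 * (N / s) * N := by gcongr
      _ = _ := by ring
  have t2 : 6 * P ^ 2 / q ≤ 6 * (N ^ 2 / s) := by
    rw [mul_div_assoc]; gcongr
  have t3 : 4 * (q * s) * P ≤ 4 * (N ^ 2 / s) := by
    have : q * s ≤ N / s := by
      rw [le_div_iff₀ hs']; linarith
    calc 4 * (q * s) * P ≤ 4 * (N / s) * N := by gcongr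
      _ = _ := by ring
  have t4 : 2 * N' * P ≤ 2 * (N ^ 2 / s) := by
    have : N' ≤ N / s := by
      rw [le_div_iff₀ hs']
      calc N' * s ≤ N' * M := by gcongr
        _ = M * N' := by ring
        _ ≤ N := hMN
    calc 2 * N' * P ≤ 2 * (N / s) * N := by gcongr
      _ = _ := by ring
  have t5 : P ^ 2 / (2 * s) ≤ N ^ 2 / s := by
    gcongr; linarith
  calc _ ≤ l ^ 5 * (12 * (N ^ 2 / s) + 6 * (N ^ 2 / s) + 4 * (N ^ 2 / s) + 2 * (N ^ 2 / s) +
        N ^ 2 / s) := by gcongr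
    _ = 25 * l ^ 5 * (N ^ 2 / s) := by ring
    _ ≤ _ := by gcongr <;> norm_num

theorem norm_bilinear_block_le {θ : ℝ} {a : ℤ} {q : ℕ} (hq : 0 < q)
    (hc : IsCoprime a (q : ℤ)) (h : |θ - a / q| ≤ 1 / (q : ℝ) ^ 2) (f g : ℕ → ℝ)
    (N M s : ℕ) (hs : 0 < s) (hsq : s ≤ q) (hqN : q * s ^ 2 ≤ N) (hM : s ≤ M)
    (hNM : s ^ 2 ≤ N / M)
    (hf : ∀ m, m ≤ N → |f m| ≤ Real.log N) (hg : ∀ n, |g n| ≤ n.divisors.card) :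
    ‖∑ m ∈ Finset.Ico M (2 * M), (f m : ℂ) *
        ∑ k ∈ Finset.Ioc 0 (N / m), (g k : ℂ) * expi ((m * k : ℕ) * θ)‖ ≤
      5 * (1 + Real.log N) ^ 3 * (N / √s) := by
  have hs' : (0 : ℝ) < s := by exact_mod_cast hs
  have hM0 : 0 < M := by omega
  have hN'0 : (0 : ℝ) < (N / M : ℕ) := by
    have : 0 < N / M := lt_of_lt_of_le (by positivity) hNM
    exact_mod_cast this
  have hl1 : 1 ≤ 1 + Real.log N := by have := Real.log_natCast_nonneg N; linarith
  have hG : ∑ n ∈ Finset.Ioc 0 (N / M), g n ^ 2 ≤ (N / M : ℕ) * (1 + Real.log N) ^ 3 := by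
    calc ∑ n ∈ Finset.Ioc 0 (N / M), g n ^ 2
        ≤ ∑ n ∈ Finset.Ioc 0 (N / M), (n.divisors.card : ℝ) ^ 2 := by
          refine Finset.sum_le_sum fun n _ => ?_
          rw [← sq_abs]; exact pow_le_pow_left₀ (abs_nonneg _) (hg n) 2
      _ ≤ (N / M : ℕ) * (1 + Real.log (N / M : ℕ)) ^ 3 := sum_card_divisors_sq_le (N / M)
      _ ≤ _ := by
          have h1 := log_natCast_mono (Nat.div_le_self N M)
          have h2 := one_add_log_natCast_nonneg (N / M)
          gcongr
  have hmain := norm_bilinear_block_sq_le hq hc h f g (1 + Real.log N) _ (s / (N / M : ℕ))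
    (by positivity) N M hM0 (fun m hm => (hf m hm).trans (by linarith)) hG
  have hbound := bilinear_numeric_bound (M := M) (N' := (N / M : ℕ)) (N := N) (q := q) (s := s)
    (l := 1 + Real.log N) (by exact_mod_cast hM0) hN'0 (by exact_mod_cast hq) (by exact_mod_cast hs)
    hl1 (by exact_mod_cast Nat.mul_div_le N M) (by exact_mod_cast hqN) (by exact_mod_cast hNM)
    (by exact_mod_cast hM) (by exact_mod_cast hsq)
  exact le_of_sq_le_sq (hmain.trans hbound) (by positivity)

theorem sum_Ico_two_pow_mul (F : ℕ → ℂ) (M R : ℕ) :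
    ∑ m ∈ Finset.Ico M (2 ^ R * M), F m =
      ∑ k ∈ Finset.range R, ∑ m ∈ Finset.Ico (2 ^ k * M) (2 * (2 ^ k * M)), F m := by
  induction R with
  | zero => simp
  | succ R ih =>
    rw [Finset.sum_range_succ, ← ih, show 2 * (2 ^ R * M) = 2 ^ (R + 1) * M by ring,
      Finset.sum_Ico_consecutive F (Nat.le_mul_of_pos_left M (by positivity))
        (Nat.mul_le_mul_right M (Nat.pow_le_pow_right (by norm_num) (by omega)))]

/-- The bilinear (type II) estimate. -/
theorem norm_bilinear_le {θ : ℝ} {a : ℤ} {q : ℕ} (hq : 0 < q)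
    (hc : IsCoprime a (q : ℤ)) (h : |θ - a / q| ≤ 1 / (q : ℝ) ^ 2) (f g : ℕ → ℝ)
    (N s : ℕ) (hs : 0 < s) (hsq : s ≤ q) (hqN : q * s ^ 2 ≤ N)
    (hf : ∀ m, m ≤ N → |f m| ≤ Real.log N) (hg : ∀ n, |g n| ≤ n.divisors.card)
    (hf0 : ∀ m ≤ s ^ 2, f m = 0) (hg0 : ∀ m ≤ s ^ 2, g m = 0) :
    ‖∑ m ∈ Finset.Ioc 0 N, (f m : ℂ) *
        ∑ k ∈ Finset.Ioc 0 (N / m), (g k : ℂ) * expi ((m * k : ℕ) * θ)‖ ≤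
      10 * (1 + Real.log N) ^ 4 * (N / √s) := by
  have hN0 : 0 < N := lt_of_lt_of_le (by positivity) hqN
  set F : ℕ → ℂ := fun m => (f m : ℂ) *
        ∑ k ∈ Finset.Ioc 0 (N / m), (g k : ℂ) * expi ((m * k : ℕ) * θ) with hF
  -- The dyadic blocks start where `f` may cease to vanish.
  set M := s ^ 2 + 1 with hM
  set R := Nat.log 2 N + 1 with hR
  have h2R : N < 2 ^ R := Nat.lt_pow_succ_log_self (by norm_num) N
  have h1 : ∑ m ∈ Finset.Ioc 0 N, F m = ∑ m ∈ Finset.Ico M (2 ^ R * M), F m := by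
    have hz : ∀ m, N < m → F m = 0 := by
      intro m hm
      simp [hF, Nat.div_eq_of_lt hm]
    have hz2 : ∀ m, m < M → F m = 0 := by
      intro m hm
      simp [hF, hf0 m (by omega)]
    have e1 : ∑ m ∈ Finset.Ioc 0 N, F m = ∑ m ∈ Finset.Icc 0 (2 ^ R * M), F m := by
      refine Finset.sum_subset ?_ ?_
      · intro m hm
        simp only [Finset.mem_Ioc, Finset.mem_Icc] at hm ⊢
        have : 2 ^ R ≤ 2 ^ R * M := Nat.le_mul_of_pos_right _ (by omega)
        omega
      · intro m _ hm
        simp only [Finset.mem_Ioc, not_and, not_le] at hm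
        rcases Nat.eq_zero_or_pos m with rfl | hm0
        · exact hz2 0 (by omega)
        · exact hz m (hm hm0)
    rw [e1]
    symm
    refine Finset.sum_subset ?_ ?_
    · intro m hm
      simp only [Finset.mem_Ico, Finset.mem_Icc] at hm ⊢
      omega
    · intro m hm hm'
      simp only [Finset.mem_Ico, Finset.mem_Icc, not_and, not_lt] at hm hm'
      by_cases hmM : m < M
      · exact hz2 m hmM
      · have e2 := hm' (by omega)
        have : 2 ^ R ≤ 2 ^ R * M := Nat.le_mul_of_pos_right _ (by omega)
        exact hz m (by omega)
  rw [h1, sum_Ico_two_pow_mul]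
  have hblock : ∀ k ∈ Finset.range R,
      ‖∑ m ∈ Finset.Ico (2 ^ k * M) (2 * (2 ^ k * M)), F m‖ ≤
        5 * (1 + Real.log N) ^ 3 * (N / √s) := by
    intro k _
    have hMk : M ≤ 2 ^ k * M := Nat.le_mul_of_pos_left M (by positivity)
    have hsM : s ≤ M := by nlinarith
    by_cases hNM : s ^ 2 ≤ N / (2 ^ k * M)
    · exact norm_bilinear_block_le hq hc h f g N _ s hs hsq hqN (hsM.trans hMk) hNM hf hg
    -- In such a block the inner variable stays below s², where `g` vanishes.
    · have : ∑ m ∈ Finset.Ico (2 ^ k * M) (2 * (2 ^ k * M)), F m = 0 := by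
        refine Finset.sum_eq_zero fun m hm => ?_
        rw [Finset.mem_Ico] at hm
        rw [hF]
        simp only
        rw [Finset.sum_eq_zero, mul_zero]
        intro j hj
        rw [Finset.mem_Ioc] at hj
        have e1 : N / m ≤ N / (2 ^ k * M) := Nat.div_le_div_left hm.1 (by positivity)
        rw [hg0 j (by omega)]
        simp
      rw [this, norm_zero]
      have := one_add_log_natCast_nonneg N
      positivity
  have hRl : (R : ℝ) ≤ 2 * (1 + Real.log N) := by
    have e1 : (Nat.log 2 N : ℝ) ≤ Real.log N / Real.log 2 := by
      have := Real.natLog_le_logb N 2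
      rwa [Real.logb] at this
    have e2 : Real.log N / Real.log 2 ≤ 2 * Real.log N := by
      rw [div_le_iff₀ (Real.log_pos (by norm_num))]
      have := Real.log_two_gt_d9
      have := Real.log_natCast_nonneg N
      nlinarith
    rw [hR]; push_cast
    linarith
  have hl := one_add_log_natCast_nonneg N
  calc _ ≤ ∑ k ∈ Finset.range R, 5 * (1 + Real.log N) ^ 3 * (N / √s) :=
        (norm_sum_le _ _).trans (Finset.sum_le_sum hblock)
    _ = R * (5 * (1 + Real.log N) ^ 3 * (N / √s)) := by
        rw [Finset.sum_const, Finset.card_range, nsmul_eq_mul]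
    _ ≤ (2 * (1 + Real.log N)) * (5 * (1 + Real.log N) ^ 3 * (N / √s)) := by gcongr
    _ = _ := by ring

/-! ### Exponential sums over primes. -/

/-- The type I input: kθ is at least 1/(2q) away from the integers, so the geometric sum is at most
q, whatever its length. -/
theorem norm_sum_expi_Ioc_le_of_approx {θ : ℝ} {a : ℤ} {q : ℕ} (hq : 0 < q)
    (hc : IsCoprime a (q : ℤ)) (h : |θ - a / q| ≤ 1 / (q : ℝ) ^ 2) {k : ℕ} (hk : 0 < k)
    (hkq : 2 * k ≤ q) (N : ℕ) : ‖∑ n ∈ Finset.Ioc 0 N, expi ((k * n : ℕ) * θ)‖ ≤ q := by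
  have hq' : (0 : ℝ) < q := by exact_mod_cast hq
  have h1 := inv_le_abs_mul_sub_of_approx hq hc h hk hkq (round (k * θ))
  have h2 := norm_sum_expi_mul_le (k * θ) 1 (N + 1)
  have h3 : ∑ n ∈ Finset.Ioc 0 N, expi ((k * n : ℕ) * θ) =
      ∑ n ∈ Finset.Ico 1 (N + 1), expi (n * (k * θ)) := by
    refine Finset.sum_congr ?_ fun n _ => ?_
    · ext n; simp only [Finset.mem_Ioc, Finset.mem_Ico]; omega
    · congr 1; push_cast; ring
  rw [h3]
  have h4 : ‖∑ n ∈ Finset.Ico 1 (N + 1), expi (n * (k * θ))‖ * (2 * (1 / (2 * q))) ≤ 1 := by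
    refine le_trans ?_ h2
    gcongr
    exact h1
  have h5 : 2 * (1 / (2 * q : ℝ)) = 1 / q := by field_simp
  rw [h5, mul_one_div, div_le_one hq'] at h4
  exact h4

theorem Icc_one_eq_Ioc_zero (N : ℕ) : Finset.Icc 1 N = Finset.Ioc 0 N := by
  ext; simp only [Finset.mem_Icc, Finset.mem_Ioc]; omega

theorem arithmeticFunction_sub_apply (f g : ArithmeticFunction ℝ) (n : ℕ) :
    (f - g) n = f n - g n := by
  rw [sub_eq_add_neg, ArithmeticFunction.add_apply, ArithmeticFunction.neg_apply, sub_eq_add_neg]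

theorem arithmeticFunction_add_apply (f g : ArithmeticFunction ℝ) (n : ℕ) :
    (f + g) n = f n + g n := ArithmeticFunction.add_apply

open ArithmeticFunction in
/-- **Vinogradov's estimate** for exponential sums with the von Mangoldt function. -/
theorem norm_sum_vonMangoldt_expi_le {θ : ℝ} {a : ℤ} {q : ℕ} (hq : 0 < q)
    (hc : IsCoprime a (q : ℤ)) (h : |θ - a / q| ≤ 1 / (q : ℝ) ^ 2)
    (N s : ℕ) (hs : 0 < s) (hsq : 2 * s ^ 4 ≤ q) (hqN : q * s ^ 5 ≤ N) :
    ‖∑ n ∈ Finset.Ioc 0 N, (vonMangoldt n : ℂ) * expi (n * θ)‖ ≤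
      14 * (1 + Real.log N) ^ 4 * (N / √s) := by
  have hs1 : (1 : ℝ) ≤ s := by exact_mod_cast hs
  have hs0 : (0 : ℝ) < s := by linarith
  have hN0 : 0 < N := lt_of_lt_of_le (by positivity) hqN
  have hlog := Real.log_natCast_nonneg N
  have hqN' : (q : ℝ) * s ^ 5 ≤ N := by exact_mod_cast hqN
  have hq1 : (1 : ℝ) ≤ q := by exact_mod_cast hq
  -- Both cuts in Vaughan's identity are at s². Type I moduli then reach U² = s⁴, which must be at
  -- most q/2, and the type I sums total O(s⁴ q log N), that is O((N/s) log N). The four pieces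
  -- contribute 1 + 2 + 1 + 10 = 14.
  set U := s ^ 2 with hU
  set μR : ArithmeticFunction ℝ := (moebius : ArithmeticFunction ℝ) with hμR
  set ζR : ArithmeticFunction ℝ := (zeta : ArithmeticFunction ℝ) with hζR
  set F : ℕ → ℂ := fun n => expi (n * θ) with hF
  have hμ1 : ∀ n, |μR n| ≤ 1 := by
    intro n
    rw [hμR, intCoe_apply]
    exact_mod_cast abs_moebius_le_one (n := n)
  have hΛ : ∀ m, m ≤ N → |vonMangoldt m| ≤ Real.log N := by
    intro m hm
    rw [abs_of_nonneg vonMangoldt_nonneg]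
    exact vonMangoldt_le_log.trans (log_natCast_mono hm)
  have hdec : ∑ n ∈ Finset.Ioc 0 N, (vonMangoldt n : ℂ) * F n =
      ∑ n ∈ Finset.Ioc 0 N, ((lowPart U vonMangoldt) n : ℂ) * F n
      + ∑ n ∈ Finset.Ioc 0 N, ((lowPart U μR * log) n : ℂ) * F n
      - ∑ n ∈ Finset.Ioc 0 N, (((lowPart U μR * lowPart U vonMangoldt) * ζR) n : ℂ) * F n
      + ∑ n ∈ Finset.Ioc 0 N, (((vonMangoldt - lowPart U vonMangoldt) *
          ((μR - lowPart U μR) * ζR)) n : ℂ) * F n := by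
    rw [← Finset.sum_add_distrib, ← Finset.sum_sub_distrib, ← Finset.sum_add_distrib]
    refine Finset.sum_congr rfl fun n _ => ?_
    have e := congrArg (fun f : ArithmeticFunction ℝ => f n) (vaughan_identity U U)
    simp only [arithmeticFunction_add_apply, arithmeticFunction_sub_apply] at e
    rw [← hμR, ← hζR] at e
    rw [e]
    push_cast
    ring
  have hfour : ((s : ℝ) ^ 4 * (q : ℝ)) * (s : ℝ) ≤ (N : ℝ) := by
    have e : ((s : ℝ) ^ 4 * (q : ℝ)) * (s : ℝ) = q * s ^ 5 := by ring
    rw [e]; exact hqN'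
  have hsq4 : (s : ℝ) ^ 4 * q ≤ N / s := by rw [le_div_iff₀ hs0]; exact hfour
  have hs2 : (s : ℝ) ^ 2 ≤ N / s := by
    refine le_trans ?_ hsq4
    calc (s : ℝ) ^ 2 = (s : ℝ) ^ 2 * 1 * 1 := by ring
      _ ≤ (s : ℝ) ^ 2 * (s : ℝ) ^ 2 * (q : ℝ) := by gcongr; exact one_le_pow₀ hs1
      _ = _ := by ring
  have hT1 : ‖∑ n ∈ Finset.Ioc 0 N, ((lowPart U vonMangoldt) n : ℂ) * F n‖ ≤
      Real.log N * (N / s) := by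
    calc _ ≤ ∑ n ∈ Finset.Ioc 0 N, (if n ≤ U then Real.log N else 0) := by
          refine (norm_sum_le _ _).trans (Finset.sum_le_sum fun n hn => ?_)
          rw [Finset.mem_Ioc] at hn
          rw [norm_mul, hF, norm_expi, mul_one, Complex.norm_real, Real.norm_eq_abs, lowPart_apply]
          split_ifs
          · exact hΛ n hn.2
          · simp
      _ ≤ (U : ℝ) * Real.log N := by
          rw [← Finset.sum_filter, Finset.sum_const, nsmul_eq_mul]
          gcongr
          have : (Finset.Ioc 0 N).filter (fun n => n ≤ U) ⊆ Finset.Ioc 0 U := by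
            intro n hn
            simp only [Finset.mem_filter, Finset.mem_Ioc] at hn ⊢
            omega
          simpa using Finset.card_le_card this
      _ ≤ _ := by
          rw [hU, mul_comm]; push_cast; gcongr
  have hT2 : ‖∑ n ∈ Finset.Ioc 0 N, ((lowPart U μR * log) n : ℂ) * F n‖ ≤
      2 * Real.log N * (N / s) := by
    rw [sum_Ioc_mul_twist]
    calc _ ≤ ∑ m ∈ Finset.Ioc 0 N, (if m ≤ U then 2 * Real.log N * q else 0) := by
          refine (norm_sum_le _ _).trans (Finset.sum_le_sum fun m hm => ?_)
          rw [Finset.mem_Ioc] at hm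
          rw [norm_mul, Complex.norm_real, Real.norm_eq_abs, lowPart_apply]
          split_ifs with hmU
          · have h2m : 2 * m ≤ q := by
              have : s ^ 2 ≤ s ^ 4 := Nat.pow_le_pow_right hs (by norm_num)
              omega
            have e1 := norm_sum_mul_le_of_monotone (fun k => expi ((m * k : ℕ) * θ))
              (fun k => Real.log k) (fun n _ => log_natCast_mono (Nat.le_succ n))
              (fun n => Real.log_natCast_nonneg n) q (N / m)
              (fun k _ => by
                rw [Icc_one_eq_Ioc_zero]
                exact norm_sum_expi_Ioc_le_of_approx hq hc h hm.1 h2m k)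
            rw [Icc_one_eq_Ioc_zero] at e1
            have e2 : ‖∑ k ∈ Finset.Ioc 0 (N / m), ((log k : ℝ) : ℂ) * F (m * k)‖ ≤
                2 * Real.log N * q := by
              refine e1.trans ?_
              have := log_natCast_mono (Nat.div_le_self N m)
              gcongr
            calc _ ≤ 1 * (2 * Real.log N * q) := by
                  gcongr
                  exact hμ1 m
              _ = _ := one_mul _
          · simp
      _ ≤ (U : ℝ) * (2 * Real.log N * q) := by
          rw [← Finset.sum_filter, Finset.sum_const, nsmul_eq_mul]
          gcongr
          have : (Finset.Ioc 0 N).filter (fun n => n ≤ U) ⊆ Finset.Ioc 0 U := by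
            intro n hn
            simp only [Finset.mem_filter, Finset.mem_Ioc] at hn ⊢
            omega
          simpa using Finset.card_le_card this
      _ = 2 * Real.log N * (s ^ 2 * q) := by rw [hU]; push_cast; ring
      _ ≤ 2 * Real.log N * (N / s) := by
          gcongr
          refine le_trans ?_ hsq4
          gcongr
          · norm_num
  have hc0 : ∀ k, U * U < k → (lowPart U μR * lowPart U vonMangoldt) k = 0 := by
    intro k hk
    rw [mul_apply]
    refine Finset.sum_eq_zero fun x hx => ?_
    rw [Nat.mem_divisorsAntidiagonal] at hx
    rw [lowPart_apply, lowPart_apply]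
    by_cases e1 : x.1 ≤ U
    · by_cases e2 : x.2 ≤ U
      · have := Nat.mul_le_mul e1 e2
        omega
      · simp [e2]
    · simp [e1]
  -- Dropping the truncations and the signs leaves the divisor sum of Λ, which is log k.
  have hc1 : ∀ k, |(lowPart U μR * lowPart U vonMangoldt) k| ≤ Real.log k := by
    intro k
    rw [mul_apply]
    calc _ ≤ ∑ x ∈ k.divisorsAntidiagonal, vonMangoldt x.2 := by
          refine (Finset.abs_sum_le_sum_abs _ _).trans (Finset.sum_le_sum fun x _ => ?_)
          rw [abs_mul, ← one_mul (vonMangoldt x.2)]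
          refine mul_le_mul ?_ ?_ (abs_nonneg _) zero_le_one
          · rw [lowPart_apply]; split_ifs
            · exact hμ1 _
            · simp
          · rw [lowPart_apply]; split_ifs
            · rw [abs_of_nonneg vonMangoldt_nonneg]
            · simp
      _ = Real.log k := by
          rw [Nat.sum_divisorsAntidiagonal' (fun _ i => vonMangoldt i)]
          exact vonMangoldt_sum
  have hT3 : ‖∑ n ∈ Finset.Ioc 0 N,
      (((lowPart U μR * lowPart U vonMangoldt) * ζR) n : ℂ) * F n‖ ≤ Real.log N * (N / s) := by
    rw [sum_Ioc_mul_twist]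
    calc _ ≤ ∑ m ∈ Finset.Ioc 0 N, (if m ≤ U * U then Real.log N * q else 0) := by
          refine (norm_sum_le _ _).trans (Finset.sum_le_sum fun m hm => ?_)
          rw [Finset.mem_Ioc] at hm
          rw [norm_mul, Complex.norm_real, Real.norm_eq_abs]
          split_ifs with hmU
          · have h2m : 2 * m ≤ q := by
              have : U * U = s ^ 4 := by rw [hU]; ring
              omega
            have e1 := norm_sum_expi_Ioc_le_of_approx hq hc h hm.1 h2m (N / m)
            have e2 : ∑ k ∈ Finset.Ioc 0 (N / m), (ζR k : ℂ) * F (m * k) =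
                ∑ k ∈ Finset.Ioc 0 (N / m), expi ((m * k : ℕ) * θ) := by
              refine Finset.sum_congr rfl fun k hk => ?_
              rw [Finset.mem_Ioc] at hk
              rw [hζR, natCoe_apply, zeta_apply_ne (by omega)]
              simp [hF]
            rw [e2]
            exact mul_le_mul ((hc1 m).trans (log_natCast_mono hm.2)) e1 (norm_nonneg _) hlog
          · rw [hc0 m (by omega)]; simp
      _ ≤ ((U * U : ℕ) : ℝ) * (Real.log N * q) := by
          rw [← Finset.sum_filter, Finset.sum_const, nsmul_eq_mul]
          gcongr
          have : (Finset.Ioc 0 N).filter (fun n => n ≤ U * U) ⊆ Finset.Ioc 0 (U * U) := by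
            intro n hn
            simp only [Finset.mem_filter, Finset.mem_Ioc] at hn ⊢
            omega
          simpa using Finset.card_le_card this
      _ = Real.log N * (s ^ 4 * q) := by rw [hU]; push_cast; ring
      _ ≤ Real.log N * (N / s) := by gcongr
  have hT4 : ‖∑ n ∈ Finset.Ioc 0 N, (((vonMangoldt - lowPart U vonMangoldt) *
          ((μR - lowPart U μR) * ζR)) n : ℂ) * F n‖ ≤ 10 * (1 + Real.log N) ^ 4 * (N / √s) := by
    rw [sum_Ioc_mul_twist]
    refine norm_bilinear_le hq hc h (fun m => (vonMangoldt - lowPart U vonMangoldt) m)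
      (fun m => ((μR - lowPart U μR) * ζR) m) N s hs ?_ ?_ ?_ ?_ ?_ ?_
    · nlinarith [Nat.pow_le_pow_right hs (show 1 ≤ 4 by norm_num)]
    · exact le_trans (Nat.mul_le_mul_left q (Nat.pow_le_pow_right hs (by norm_num))) hqN
    · intro m hm
      simp only [arithmeticFunction_sub_apply, lowPart_apply]
      split_ifs
      · simpa using hlog
      · simpa using hΛ m hm
    · intro n
      simp only [mul_apply]
      refine (Finset.abs_sum_le_sum_abs _ _).trans ?_
      have hcd : n.divisorsAntidiagonal.card = n.divisors.card := by
        rw [← Nat.map_div_right_divisors, Finset.card_map]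
      rw [← hcd, ← nsmul_one, ← Finset.sum_const]
      refine Finset.sum_le_sum fun x _ => ?_
      rw [abs_mul, ← one_mul (1 : ℝ)]
      refine mul_le_mul ?_ ?_ (abs_nonneg _) zero_le_one
      · simp only [arithmeticFunction_sub_apply, lowPart_apply]
        split_ifs
        · simp
        · simpa using hμ1 x.1
      · rw [hζR, natCoe_apply, zeta_apply]
        split_ifs <;> simp
    · intro m hm
      simp [arithmeticFunction_sub_apply, lowPart_apply, hU, hm]
    · intro m hm
      simp only [mul_apply]
      refine Finset.sum_eq_zero fun x hx => ?_
      have hx1 : x.1 ≤ U := (Nat.divisor_le (Nat.fst_mem_divisors_of_mem_antidiagonal hx)).trans hm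
      simp [arithmeticFunction_sub_apply, lowPart_apply, hx1]
  rw [hdec]
  have hss : (N : ℝ) / s ≤ N / √s := by
    gcongr
    rw [Real.sqrt_le_left hs0.le]
    nlinarith
  have hl4 : Real.log N ≤ (1 + Real.log N) ^ 4 := by
    calc Real.log N ≤ (1 + Real.log N) ^ 1 := by rw [pow_one]; linarith
      _ ≤ _ := pow_le_pow_right₀ (by linarith) (by norm_num)
  have hfin : Real.log N * (N / s) ≤ (1 + Real.log N) ^ 4 * (N / √s) := by gcongr
  refine (norm_add_le _ _).trans ?_
  have := norm_sub_le (∑ n ∈ Finset.Ioc 0 N, ((lowPart U vonMangoldt) n : ℂ) * F n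
      + ∑ n ∈ Finset.Ioc 0 N, ((lowPart U μR * log) n : ℂ) * F n)
      (∑ n ∈ Finset.Ioc 0 N, (((lowPart U μR * lowPart U vonMangoldt) * ζR) n : ℂ) * F n)
  have := norm_add_le (∑ n ∈ Finset.Ioc 0 N, ((lowPart U vonMangoldt) n : ℂ) * F n)
    (∑ n ∈ Finset.Ioc 0 N, ((lowPart U μR * log) n : ℂ) * F n)
  linarith

-- Passing from Λ to primes costs ψ(k) - θ(k) = O(√k log k) in Chebyshev's functions. Partial
-- summation later requires uniformity in k ≤ X: if ks < X the trivial bound suffices, and otherwise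
-- q s⁶ ≤ X implies the condition q s⁵ ≤ k for length k.
open ArithmeticFunction in
theorem norm_sum_log_prime_expi_le {θ : ℝ} {a : ℤ} {q : ℕ} (hq : 0 < q)
    (hc : IsCoprime a (q : ℤ)) (h : |θ - a / q| ≤ 1 / (q : ℝ) ^ 2)
    (X s k : ℕ) (hs : 0 < s) (hsq : 2 * s ^ 4 ≤ q) (hqX : q * s ^ 6 ≤ X) (hk : k ≤ X) :
    ‖∑ n ∈ Finset.Icc 1 k, (if n.Prime then (Real.log n : ℂ) * expi (n * θ) else 0)‖ ≤
      16 * (1 + Real.log X) ^ 4 * (X / √s) := by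
  have hs1 : (1 : ℝ) ≤ s := by exact_mod_cast hs
  have hs0 : (0 : ℝ) < s := by linarith
  have hlog := Real.log_natCast_nonneg X
  have hlogk := log_natCast_mono hk
  have hlogk0 := Real.log_natCast_nonneg k
  have hkX : (k : ℝ) ≤ X := by exact_mod_cast hk
  have hsX : s ≤ X := by
    refine le_trans ?_ hqX
    calc s = 1 * s ^ 1 := by ring
      _ ≤ q * s ^ 6 := Nat.mul_le_mul hq (Nat.pow_le_pow_right hs (by norm_num))
  have hsX' : (s : ℝ) ≤ X := by exact_mod_cast hsX
  have hl4 : Real.log X ≤ (1 + Real.log X) ^ 4 := by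
    calc Real.log X ≤ (1 + Real.log X) ^ 1 := by rw [pow_one]; linarith
      _ ≤ _ := pow_le_pow_right₀ (by linarith) (by norm_num)
  rw [Icc_one_eq_Ioc_zero]
  rcases lt_or_ge (k * s) X with hks | hks
  · have hks' : (k : ℝ) ≤ X / s := by
      rw [le_div_iff₀ hs0]; exact_mod_cast hks.le
    have hss : (X : ℝ) / s ≤ X / √s := by
      gcongr
      rw [Real.sqrt_le_left hs0.le]
      nlinarith
    calc _ ≤ ∑ n ∈ Finset.Ioc 0 k, Real.log X := by
          refine (norm_sum_le _ _).trans (Finset.sum_le_sum fun n hn => ?_)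
          rw [Finset.mem_Ioc] at hn
          split_ifs
          · rw [norm_mul, norm_expi, mul_one, Complex.norm_real, Real.norm_eq_abs,
              abs_of_nonneg (Real.log_natCast_nonneg n)]
            exact log_natCast_mono (by omega)
          · simpa using hlog
      _ = Real.log X * k := by
          rw [Finset.sum_const, Nat.card_Ioc, nsmul_eq_mul, Nat.sub_zero, mul_comm]
      _ ≤ (1 + Real.log X) ^ 4 * (X / √s) := by
          gcongr
          exact hks'.trans hss
      _ ≤ 16 * ((1 + Real.log X) ^ 4 * (X / √s)) := by
          have : 0 ≤ (1 + Real.log X) ^ 4 * (X / √s) := by positivity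
          linarith
      _ = _ := by ring
  · have hqk : q * s ^ 5 ≤ k := by
      have : q * s ^ 5 * s ≤ k * s := by
        calc q * s ^ 5 * s = q * s ^ 6 := by ring
          _ ≤ X := hqX
          _ ≤ k * s := hks
      exact Nat.le_of_mul_le_mul_right this hs
    have hk0 : 0 < k := lt_of_lt_of_le (by positivity) hqk
    have hk1 : (1 : ℝ) ≤ k := by exact_mod_cast hk0
    have h1 := norm_sum_vonMangoldt_expi_le hq hc h k s hs hsq hqk
    have h2 : ∑ n ∈ Finset.Ioc 0 k, (if n.Prime then (Real.log n : ℂ) * expi (n * θ) else 0) =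
        ∑ n ∈ Finset.Ioc 0 k, (vonMangoldt n : ℂ) * expi (n * θ) -
        ∑ n ∈ Finset.Ioc 0 k with ¬ n.Prime, (vonMangoldt n : ℂ) * expi (n * θ) := by
      rw [Finset.sum_filter, ← Finset.sum_sub_distrib]
      refine Finset.sum_congr rfl fun n _ => ?_
      by_cases hp : n.Prime
      · simp [hp, vonMangoldt_apply_prime hp]
      · simp [hp]
    have h3 : ‖∑ n ∈ Finset.Ioc 0 k with ¬ n.Prime, (vonMangoldt n : ℂ) * expi (n * θ)‖ ≤
        2 * √k * Real.log k := by
      refine le_trans ?_ (Chebyshev.psi_sub_theta_le hk1)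
      rw [Chebyshev.psi_sub_theta_eq_sum_not_prime, Nat.floor_natCast]
      refine (norm_sum_le _ _).trans (Finset.sum_le_sum fun n _ => ?_)
      rw [norm_mul, norm_expi, mul_one, Complex.norm_real, Real.norm_eq_abs,
        abs_of_nonneg vonMangoldt_nonneg]
    have h4 : √(k : ℝ) ≤ X / √s := by
      rw [le_div_iff₀ (Real.sqrt_pos.2 hs0)]
      calc √(k : ℝ) * √s ≤ √X * √X := by gcongr
        _ = X := Real.mul_self_sqrt (by positivity)
    rw [h2]
    refine (norm_sub_le _ _).trans ?_
    calc _ ≤ 14 * (1 + Real.log k) ^ 4 * (k / √s) + 2 * √k * Real.log k := add_le_add h1 h3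
      _ ≤ 14 * (1 + Real.log X) ^ 4 * (X / √s) + 2 * (X / √s) * (1 + Real.log X) ^ 4 := by
          gcongr
          exact hlogk.trans hl4
      _ = _ := by ring

/-- Chebyshev's lower bound, with log(X + 1) estimated by the tangent of log at 4. It allows a bound
in terms of X to be restated relative to π(X). -/
theorem div_le_primeCounting {X : ℕ} (hX : 4 ≤ X) :
    (X : ℝ) / (4 * (1 + Real.log X)) ≤ Nat.primeCounting X := by
  have hX' : (4 : ℝ) ≤ X := by exact_mod_cast hX
  refine le_trans ?_ (Chebyshev.pi_ge X)
  have hl : 0 < Real.log X := Real.log_pos (by linarith)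
  have h1 : Real.log (X + 1) ≤ (X + 1) / 4 - 1 + 2 * Real.log 2 := by
    have h2 := Real.log_le_sub_one_of_pos (show (0 : ℝ) < (X + 1) / 4 by positivity)
    rw [Real.log_div (by positivity) (by norm_num), show (4 : ℝ) = 2 ^ 2 by norm_num,
      Real.log_pow] at h2
    push_cast at h2
    linarith
  have h3 := Real.log_two_gt_d9
  have h4 := Real.log_two_lt_d9
  rw [div_le_div_iff₀ (by positivity) hl]
  have h5 : (X : ℝ) ≤ (X * Real.log 2 - Real.log (X + 1)) * 4 := by nlinarith
  nlinarith

/-- **Vinogradov's estimate** for exponential sums over primes. -/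
theorem norm_sum_primesLE_expi_le {θ : ℝ} {a : ℤ} {q : ℕ} (hq : 0 < q)
    (hc : IsCoprime a (q : ℤ)) (h : |θ - a / q| ≤ 1 / (q : ℝ) ^ 2)
    (X s : ℕ) (hX : 4 ≤ X) (hs : 0 < s) (hsq : 2 * s ^ 4 ≤ q) (hqX : q * s ^ 6 ≤ X) :
    ‖∑ p ∈ Nat.primesLE X, expi (p * θ)‖ ≤
      128 * (1 + Real.log X) ^ 5 / √s * Nat.primeCounting X := by
  -- The maximum avoids log 1 = 0 and keeps the weight positive and decreasing from n = 1 on; it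
  -- does not affect primes.
  set w : ℕ → ℝ := fun n => 1 / Real.log (max n 2 : ℕ) with hw
  have hs1 : (1 : ℝ) ≤ s := by exact_mod_cast hs
  have hs0 : (0 : ℝ) < s := by linarith
  have hwpos : ∀ n : ℕ, 0 < Real.log (max n 2 : ℕ) := fun n => Real.log_pos (by
    have : 2 ≤ max n 2 := le_max_right _ _
    exact_mod_cast (by omega : 1 < max n 2))
  have h1 := norm_sum_mul_le_of_antitone
    (fun n => if n.Prime then (Real.log n : ℂ) * expi (n * θ) else 0) w
    (fun n _ => by
      simp only [hw]
      exact one_div_le_one_div_of_le (hwpos n) (log_natCast_mono (by omega)))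
    (fun n => by simp only [hw]; exact (one_div_pos.2 (hwpos n)).le)
    _ X (fun k hk => norm_sum_log_prime_expi_le hq hc h X s k hs hsq hqX hk)
  have h2 : ∑ n ∈ Finset.Icc 1 X, (w n : ℂ) *
      (if n.Prime then (Real.log n : ℂ) * expi (n * θ) else 0) =
      ∑ p ∈ Nat.primesLE X, expi (p * θ) := by
    rw [Nat.primesLE_eq_filter_Icc_one, Finset.sum_filter]
    refine Finset.sum_congr rfl fun n _ => ?_
    split_ifs with hp
    · have h3 : max n 2 = n := max_eq_left hp.two_le
      have h4 : (Real.log n : ℂ) ≠ 0 := by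
        have := (hwpos n).ne'
        rw [h3] at this
        exact_mod_cast this
      simp only [hw, h3]
      rw [Complex.ofReal_div, Complex.ofReal_one]
      field_simp
    · simp
  rw [h2] at h1
  have h5 : w 1 ≤ 2 := by
    simp only [hw]
    norm_num
    rw [inv_le_comm₀ (Real.log_pos (by norm_num)) (by norm_num)]
    have := Real.log_two_gt_d9
    norm_num at this ⊢
    linarith
  have h6 := div_le_primeCounting hX
  have hl : 0 < 1 + Real.log X := by have := Real.log_natCast_nonneg X; linarith
  have hsq0 : 0 < √(s : ℝ) := Real.sqrt_pos.2 hs0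
  rw [div_le_iff₀ (by positivity)] at h6
  calc _ ≤ w 1 * (16 * (1 + Real.log X) ^ 4 * (X / √s)) := h1
    _ ≤ 2 * (16 * (1 + Real.log X) ^ 4 *
        ((Nat.primeCounting X * (4 * (1 + Real.log X))) / √s)) := by gcongr
    _ = _ := by ring

/-! ### Fejér means on the torus. -/

/-- The Fejér kernel, normalized to have the value `1` at `0`. -/
noncomputable def fejer (M : ℕ) (x : ℝ) : ℝ := ‖(1 / M : ℂ) * ∑ h ∈ Finset.range M, expi (h * x)‖ ^ 2

theorem fejer_nonneg (M : ℕ) (x : ℝ) : 0 ≤ fejer M x := by unfold fejer; positivity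

theorem fejer_eq (M : ℕ) (x : ℝ) : (fejer M x : ℂ) =
    ∑ a ∈ Finset.range M, ∑ b ∈ Finset.range M, (1 / (M : ℂ) ^ 2) * expi (((a : ℝ) - b) * x) := by
  rw [fejer, Finset.mul_sum, norm_sum_sq_eq, Finset.sum_comm]
  refine Finset.sum_congr rfl fun a _ => Finset.sum_congr rfl fun b _ => ?_
  rw [map_mul, conj_expi, show ((a : ℝ) - b) * x = -(b * x) + a * x by ring, expi_add]
  simp
  ring

theorem sum_expi_mul_div (M : ℕ) (hM : 0 < M) (c : ℤ) :
    ∑ k ∈ Finset.range M, expi (k * (c / M : ℝ)) = if (M : ℤ) ∣ c then (M : ℂ) else 0 := by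
  have hM' : (M : ℝ) ≠ 0 := by positivity
  split_ifs with h
  · obtain ⟨e, rfl⟩ := h
    have : ∀ k ∈ Finset.range M, expi (k * (((M * e : ℤ) : ℝ) / M)) = 1 := by
      intro k _
      have : (k : ℝ) * (((M * e : ℤ) : ℝ) / M) = ((k * e : ℤ) : ℝ) := by
        push_cast; field_simp
      rw [this, expi_int]
    rw [Finset.sum_congr rfl this]; simp
  · have h1 := norm_sum_expi_mul_le (c / M : ℝ) 0 M
    have hz : expi (c / M : ℝ) ≠ 1 := by
      intro h1
      rw [expi, Complex.exp_eq_one_iff] at h1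
      obtain ⟨e, he⟩ := h1
      apply h
      refine ⟨e, ?_⟩
      have h2 : ((c / M : ℝ) : ℂ) = e := by
        have hpi : (2 * Real.pi * Complex.I : ℂ) ≠ 0 := Complex.two_pi_I_ne_zero
        apply mul_right_cancel₀ hpi
        rw [← he]; ring
      have h3 : (c / M : ℝ) = e := by exact_mod_cast h2
      rw [div_eq_iff hM'] at h3
      have : c = e * M := by exact_mod_cast h3
      rw [this]; ring
    simp only [expi_nat_mul]
    rw [geom_sum_eq hz, ← expi_nat_mul]
    have : (M : ℝ) * (c / M) = (c : ℤ) := by field_simp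
    rw [this, expi_int]; simp

/-- Averaging over M equally spaced points annihilates every frequency not divisible by M. The
frequencies a - b of the kernel are smaller than M in absolute value, so only the diagonal survives:
the translates form an exact partition of unity. -/
theorem sum_fejer (M : ℕ) (hM : 0 < M) (t : ℝ) :
    ∑ k ∈ Finset.range M, fejer M (t - k / M) = 1 := by
  have hM' : (M : ℂ) ≠ 0 := by exact_mod_cast hM.ne'
  have h : ((∑ k ∈ Finset.range M, fejer M (t - k / M) : ℝ) : ℂ) = 1 := by
    push_cast
    simp only [fejer_eq]
    rw [Finset.sum_comm]
    have h1 : ∀ a ∈ Finset.range M, ∑ k ∈ Finset.range M, ∑ b ∈ Finset.range M,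
        (1 / (M : ℂ) ^ 2) * expi (((a : ℝ) - b) * (t - k / M)) = 1 / (M : ℂ) := by
      intro a ha
      rw [Finset.sum_comm]
      have h2 : ∀ b ∈ Finset.range M, ∑ k ∈ Finset.range M,
        (1 / (M : ℂ) ^ 2) * expi (((a : ℝ) - b) * (t - k / M)) = if b = a then 1 / (M : ℂ) else 0 := by
        intro b hb
        have h3 : ∀ k : ℕ, (1 / (M : ℂ) ^ 2) * expi (((a : ℝ) - b) * (t - k / M)) =
            (1 / (M : ℂ) ^ 2) * expi (((a : ℝ) - b) * t) * expi (k * (((b - a : ℤ) : ℝ) / M)) := by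
          intro k
          rw [mul_assoc, ← expi_add]; congr 2; push_cast; ring
        simp only [h3]
        rw [← Finset.mul_sum, sum_expi_mul_div M hM]
        rw [Finset.mem_range] at ha hb
        by_cases hab : b = a
        · subst hab
          simp [expi_zero]
          field_simp
        · rw [if_neg, if_neg hab, mul_zero]
          intro hd
          have := Int.eq_zero_of_abs_lt_dvd hd (by rw [abs_lt]; omega)
          omega
      rw [Finset.sum_congr rfl h2, Finset.sum_ite_eq' _ a, if_pos ha]
    rw [Finset.sum_congr rfl h1]
    simp [hM']
  exact_mod_cast h

theorem fejer_mul_nearDist_sq_le (M : ℕ) (hM : 0 < M) (x : ℝ) :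
    fejer M x * nearDist x ^ 2 ≤ 1 / (4 * (M : ℝ) ^ 2) := by
  have hM' : (0 : ℝ) < M := by exact_mod_cast hM
  have h := norm_sum_expi_mul_le x 0 M
  rw [← Finset.range_eq_Ico] at h
  rw [fejer, norm_mul, mul_pow]
  have h1 : ‖(1 / M : ℂ)‖ = 1 / M := by simp
  rw [h1]
  have h2 : (‖∑ n ∈ Finset.range M, expi (n * x)‖ * (2 * nearDist x)) ^ 2 ≤ 1 :=
    pow_le_one₀ (mul_nonneg (norm_nonneg _) (mul_nonneg zero_le_two (nearDist_nonneg x))) h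
  calc (1 / (M : ℝ)) ^ 2 * ‖∑ n ∈ Finset.range M, expi (n * x)‖ ^ 2 * nearDist x ^ 2
      = 1 / (4 * (M : ℝ) ^ 2) * (‖∑ n ∈ Finset.range M, expi (n * x)‖ * (2 * nearDist x)) ^ 2 := by
        generalize ‖∑ n ∈ Finset.range M, expi (n * x)‖ = y
        field_simp; ring
    _ ≤ 1 / (4 * (M : ℝ) ^ 2) * 1 := by gcongr
    _ = _ := mul_one _

/-- The grid has m² points and the distances are split at 1/m. Near points contribute at most 1/m
since the total mass is 1; at a far point one more factor m·`nearDist` > 1 brings in the quadratic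
decay of the kernel. -/
theorem sum_nearDist_mul_fejer_le (m : ℕ) (hm : 0 < m) (t : ℝ) :
    ∑ k ∈ Finset.range (m ^ 2), nearDist (t - k / (m ^ 2 : ℕ)) * fejer (m ^ 2) (t - k / (m ^ 2 : ℕ)) ≤
      2 / m := by
  have hm' : (0 : ℝ) < m := by exact_mod_cast hm
  have hM : 0 < m ^ 2 := by positivity
  have h1 : ∀ x : ℝ, nearDist x * fejer (m ^ 2) x ≤ (1 / m) * fejer (m ^ 2) x + 1 / (4 * (m : ℝ) ^ 3) := by
    intro x
    have hf := fejer_nonneg (m ^ 2) x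
    rcases le_or_gt (nearDist x) (1 / m) with h | h
    · have := mul_le_mul_of_nonneg_right h hf
      have : 0 ≤ 1 / (4 * (m : ℝ) ^ 3) := by positivity
      linarith
    · have h2 := fejer_mul_nearDist_sq_le (m ^ 2) hM x
      have h3 : 1 < m * nearDist x := by rwa [div_lt_iff₀ hm', mul_comm] at h
      have h0 : 0 ≤ nearDist x * fejer (m ^ 2) x := mul_nonneg (nearDist_nonneg x) hf
      have h4 : nearDist x * fejer (m ^ 2) x ≤ m * (fejer (m ^ 2) x * nearDist x ^ 2) := by
        calc nearDist x * fejer (m ^ 2) x = 1 * (nearDist x * fejer (m ^ 2) x) := (one_mul _).symm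
          _ ≤ (m * nearDist x) * (nearDist x * fejer (m ^ 2) x) := by gcongr
          _ = _ := by ring
      have h5 : (m : ℝ) * (fejer (m ^ 2) x * nearDist x ^ 2) ≤ 1 / (4 * (m : ℝ) ^ 3) := by
        calc _ ≤ m * (1 / (4 * ((m ^ 2 : ℕ) : ℝ) ^ 2)) := by gcongr
          _ = _ := by push_cast; field_simp
      have : 0 ≤ 1 / (m : ℝ) * fejer (m ^ 2) x := by positivity
      linarith
  calc _ ≤ ∑ k ∈ Finset.range (m ^ 2), ((1 / m) * fejer (m ^ 2) (t - k / (m ^ 2 : ℕ)) +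
        1 / (4 * (m : ℝ) ^ 3)) := Finset.sum_le_sum fun k _ => h1 _
    _ = 1 / m + m ^ 2 * (1 / (4 * (m : ℝ) ^ 3)) := by
        rw [Finset.sum_add_distrib, ← Finset.mul_sum, sum_fejer _ hM, Finset.sum_const,
          Finset.card_range, nsmul_eq_mul]
        push_cast; ring
    _ ≤ _ := by
        have : (m : ℝ) ^ 2 * (1 / (4 * (m : ℝ) ^ 3)) = 1 / 4 * (1 / m) := by field_simp
        rw [this, div_eq_mul_one_div 2 (m : ℝ)]
        have : 0 < 1 / (m : ℝ) := by positivity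
        linarith

/-- The two-dimensional torus. -/
abbrev Torus := UnitAddCircle × UnitAddCircle

/-- The point of the torus with the given real coordinates. -/
def torusPt (s t : ℝ) : Torus := ((s : UnitAddCircle), (t : UnitAddCircle))

theorem dist_torusPt_le (s t s' t' : ℝ) :
    dist (torusPt s t) (torusPt s' t') ≤ nearDist (s - s') + nearDist (t - t') := by
  rw [Prod.dist_eq, torusPt, torusPt, dist_eq_norm, dist_eq_norm, ← AddCircle.coe_sub,
    ← AddCircle.coe_sub, UnitAddCircle.norm_eq, UnitAddCircle.norm_eq]
  exact max_le_add_of_nonneg (abs_nonneg _) (abs_nonneg _)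

/-- The discrete Fejér mean of a function on the torus. -/
noncomputable def fejerMean (M : ℕ) (g : Torus → ℝ) (s t : ℝ) : ℝ :=
  ∑ k ∈ Finset.range M, ∑ l ∈ Finset.range M,
    g (torusPt (k / M) (l / M)) * (fejer M (s - k / M) * fejer M (t - l / M))

theorem sum_sum_fejer (M : ℕ) (hM : 0 < M) (s t : ℝ) :
    ∑ k ∈ Finset.range M, ∑ l ∈ Finset.range M, fejer M (s - k / M) * fejer M (t - l / M) = 1 := by
  rw [← Finset.sum_mul_sum, sum_fejer M hM, sum_fejer M hM, one_mul]

theorem fejerMean_nonneg (M : ℕ) (g : Torus → ℝ) (hg : ∀ x, 0 ≤ g x) (s t : ℝ) :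
    0 ≤ fejerMean M g s t :=
  Finset.sum_nonneg fun _ _ => Finset.sum_nonneg fun _ _ =>
    mul_nonneg (hg _) (mul_nonneg (fejer_nonneg _ _) (fejer_nonneg _ _))

theorem fejerMean_le_one (M : ℕ) (hM : 0 < M) (g : Torus → ℝ) (hg : ∀ x, g x ≤ 1) (s t : ℝ) :
    fejerMean M g s t ≤ 1 := by
  rw [← sum_sum_fejer M hM s t]
  refine Finset.sum_le_sum fun _ _ => Finset.sum_le_sum fun _ _ => ?_
  exact mul_le_of_le_one_left (mul_nonneg (fejer_nonneg _ _) (fejer_nonneg _ _)) (hg _)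

theorem abs_fejerMean_sub_le (m : ℕ) (hm : 0 < m) (g : Torus → ℝ) (K : ℝ) (hK : 0 ≤ K)
    (hg : ∀ x y, |g x - g y| ≤ K * dist x y) (s t : ℝ) :
    |fejerMean (m ^ 2) g s t - g (torusPt s t)| ≤ 4 * K / m := by
  have hM : 0 < m ^ 2 := by positivity
  set M := m ^ 2 with hMdef
  have h0 := sum_sum_fejer M hM s t
  have h1 : fejerMean M g s t - g (torusPt s t) =
      ∑ k ∈ Finset.range M, ∑ l ∈ Finset.range M,
        (g (torusPt (k / M) (l / M)) - g (torusPt s t)) *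
          (fejer M (s - k / M) * fejer M (t - l / M)) := by
    simp only [sub_mul, Finset.sum_sub_distrib]
    have h2 : g (torusPt s t) = g (torusPt s t) * 1 := (mul_one _).symm
    rw [← h0] at h2
    simp only [Finset.mul_sum] at h2
    rw [← h2, fejerMean]
  have hs := sum_nearDist_mul_fejer_le m hm s
  have ht := sum_nearDist_mul_fejer_le m hm t
  rw [← hMdef] at hs ht
  rw [h1]
  calc _ ≤ ∑ k ∈ Finset.range M, ∑ l ∈ Finset.range M,
        (K * (nearDist (s - k / M) + nearDist (t - l / M))) *
          (fejer M (s - k / M) * fejer M (t - l / M)) := by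
        refine (Finset.abs_sum_le_sum_abs _ _).trans (Finset.sum_le_sum fun k _ => ?_)
        refine (Finset.abs_sum_le_sum_abs _ _).trans (Finset.sum_le_sum fun l _ => ?_)
        have hf : 0 ≤ fejer M (s - k / M) * fejer M (t - l / M) :=
          mul_nonneg (fejer_nonneg _ _) (fejer_nonneg _ _)
        rw [abs_mul, abs_of_nonneg hf]
        refine mul_le_mul_of_nonneg_right ?_ hf
        refine (hg _ _).trans ?_
        rw [dist_comm]
        exact mul_le_mul_of_nonneg_left (dist_torusPt_le _ _ _ _) hK
    _ = K * ((∑ k ∈ Finset.range M, nearDist (s - k / M) * fejer M (s - k / M)) *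
          (∑ l ∈ Finset.range M, fejer M (t - l / M)) +
        (∑ k ∈ Finset.range M, fejer M (s - k / M)) *
          (∑ l ∈ Finset.range M, nearDist (t - l / M) * fejer M (t - l / M))) := by
        rw [Finset.sum_mul_sum, Finset.sum_mul_sum, ← Finset.sum_add_distrib, Finset.mul_sum]
        refine Finset.sum_congr rfl fun k _ => ?_
        rw [← Finset.sum_add_distrib, Finset.mul_sum]
        refine Finset.sum_congr rfl fun l _ => ?_
        ring
    _ ≤ K * (2 / m + 2 / m) := by
        rw [sum_fejer M hM, sum_fejer M hM, mul_one, one_mul]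
        gcongr
    _ = _ := by ring

/-- The discrete Fejér mean is a trigonometric polynomial with bounded coefficients. -/
theorem exists_fejerMean_eq (M : ℕ) (hM : 0 < M) (g : Torus → ℝ) (hg0 : ∀ x, 0 ≤ g x)
    (hg1 : ∀ x, g x ≤ 1) :
    ∃ (c : (Fin M × Fin M) × (Fin M × Fin M) × (Fin M × Fin M) → ℂ)
      (u v : (Fin M × Fin M) × (Fin M × Fin M) × (Fin M × Fin M) → ℤ),
      (∑ x, ‖c x‖ ≤ (M : ℝ) ^ 2) ∧ (∀ x, |u x| ≤ M ∧ |v x| ≤ M) ∧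
      ∀ s t : ℝ, (fejerMean M g s t : ℂ) = ∑ x, c x * expi (u x * s + v x * t) := by
  have hM' : (M : ℂ) ≠ 0 := by exact_mod_cast hM.ne'
  have hMr : (M : ℝ) ≠ 0 := by exact_mod_cast hM.ne'
  -- `x.1` is the grid point, `x.2.2` the pair from the double sum of the kernel in `s`, and `x.2.1`
  -- the pair for `t`. There are M⁶ coefficients, each at most M⁻⁴.
  refine ⟨fun x => (g (torusPt (x.1.1 / M) (x.1.2 / M)) : ℂ) * (1 / (M : ℂ) ^ 4) *
      expi (-(((x.2.2.1 : ℝ) - x.2.2.2) * (x.1.1 / M) + ((x.2.1.1 : ℝ) - x.2.1.2) * (x.1.2 / M))),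
    fun x => (x.2.2.1 : ℤ) - (x.2.2.2 : ℤ), fun x => (x.2.1.1 : ℤ) - (x.2.1.2 : ℤ), ?_, ?_, ?_⟩
  · calc _ ≤ ∑ x : (Fin M × Fin M) × (Fin M × Fin M) × (Fin M × Fin M), 1 / (M : ℝ) ^ 4 := by
          refine Finset.sum_le_sum fun x _ => ?_
          rw [norm_mul, norm_expi, mul_one, norm_mul, Complex.norm_real, Real.norm_eq_abs,
            abs_of_nonneg (hg0 _)]
          have : ‖(1 / (M : ℂ) ^ 4)‖ = 1 / (M : ℝ) ^ 4 := by simp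
          rw [this]
          exact mul_le_of_le_one_left (by positivity) (hg1 _)
      _ = (M : ℝ) ^ 2 := by
          simp only [Finset.sum_const, Finset.card_univ, Fintype.card_prod, Fintype.card_fin,
            nsmul_eq_mul]
          push_cast
          field_simp
      _ ≤ _ := le_rfl
  · intro x
    have h1 := x.2.1.1.2
    have h2 := x.2.1.2.2
    have h3 := x.2.2.1.2
    have h4 := x.2.2.2.2
    simp only [abs_le]
    omega
  · intro s t
    simp only [fejerMean]
    push_cast
    simp only [fejer_eq, Fintype.sum_prod_type, Finset.sum_range]
    refine Finset.sum_congr rfl fun k _ => Finset.sum_congr rfl fun l _ => ?_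
    simp only [Finset.sum_mul, Finset.mul_sum]
    refine Finset.sum_congr rfl fun a' _ => Finset.sum_congr rfl fun b' _ =>
      Finset.sum_congr rfl fun a _ => Finset.sum_congr rfl fun b _ => ?_
    have e : expi (-(((a : ℝ) - b) * (k / M) + ((a' : ℝ) - b') * (l / M))) *
        expi (((a : ℝ) - b) * s + ((a' : ℝ) - b') * t) =
        expi (((a : ℝ) - b) * (s - k / M)) * expi (((a' : ℝ) - b') * (t - l / M)) := by
      rw [← expi_add, ← expi_add]; congr 1; ring
    rw [mul_assoc _ (expi (-_)), e]
    ring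

theorem abs_prod_sub_prod_le {d : ℕ} (f g : Fin d → ℝ) (hf0 : ∀ i, 0 ≤ f i) (hf1 : ∀ i, f i ≤ 1)
    (hg0 : ∀ i, 0 ≤ g i) (hg1 : ∀ i, g i ≤ 1) :
    |∏ i, f i - ∏ i, g i| ≤ ∑ i, |f i - g i| := by
  induction d with
  | zero => simp
  | succ d ih =>
    rw [Fin.prod_univ_succ, Fin.prod_univ_succ, Fin.sum_univ_succ]
    have h := ih (fun i => f i.succ) (fun i => g i.succ) (fun i => hf0 _) (fun i => hf1 _)
      (fun i => hg0 _) (fun i => hg1 _)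
    have hP0 : 0 ≤ ∏ i : Fin d, f i.succ := Finset.prod_nonneg fun i _ => hf0 _
    have hP1 : ∏ i : Fin d, f i.succ ≤ 1 := Finset.prod_le_one (fun i _ => hf0 _) fun i _ => hf1 _
    have e : f 0 * ∏ i : Fin d, f i.succ - g 0 * ∏ i : Fin d, g i.succ =
        (f 0 - g 0) * ∏ i : Fin d, f i.succ +
          g 0 * (∏ i : Fin d, f i.succ - ∏ i : Fin d, g i.succ) := by ring
    rw [e]
    refine (abs_add_le _ _).trans (add_le_add ?_ ?_)
    · rw [abs_mul, abs_of_nonneg hP0]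
      exact mul_le_of_le_one_right (abs_nonneg _) hP1
    · rw [abs_mul, abs_of_nonneg (hg0 0)]
      exact (mul_le_of_le_one_left (abs_nonneg _) (hg1 0)).trans h

/-! ### Comparing averages through exponential sums. -/

/-- The average of a function over a finite set of natural numbers. -/
noncomputable def avg (A : Finset ℕ) (f : ℕ → ℝ) : ℝ := (∑ n ∈ A, f n) / A.card

theorem avg_mono (A : Finset ℕ) {f g : ℕ → ℝ} (h : ∀ n ∈ A, f n ≤ g n) : avg A f ≤ avg A g :=
  div_le_div_of_nonneg_right (Finset.sum_le_sum h) (Nat.cast_nonneg _)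

theorem avg_sub (A : Finset ℕ) (f g : ℕ → ℝ) : avg A (fun n => f n - g n) = avg A f - avg A g := by
  simp only [avg, Finset.sum_sub_distrib, sub_div]

theorem avg_sum {ι : Type*} (A : Finset ℕ) (s : Finset ι) (f : ι → ℕ → ℝ) :
    avg A (fun n => ∑ i ∈ s, f i n) = ∑ i ∈ s, avg A (f i) := by
  simp only [avg]
  rw [Finset.sum_comm, Finset.sum_div]

theorem avg_const (A : Finset ℕ) (hA : A.Nonempty) (c : ℝ) : avg A (fun _ => c) = c := by
  have : (A.card : ℝ) ≠ 0 := by exact_mod_cast hA.card_pos.ne'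
  simp only [avg, Finset.sum_const, nsmul_eq_mul]
  field_simp

theorem abs_avg_le (A : Finset ℕ) (hA : A.Nonempty) {f : ℕ → ℝ} {c : ℝ} (h : ∀ n, |f n| ≤ c) :
    |avg A f| ≤ c := by
  rw [abs_le]
  constructor
  · rw [← avg_const A hA (-c)]
    exact avg_mono A fun n _ => (abs_le.1 (h n)).1
  · rw [← avg_const A hA c]
    exact avg_mono A fun n _ => (abs_le.1 (h n)).2

/-- Replacing each factor by its Fejér mean costs 4K/m, for d factors and two averages. The product
of the means is a trigonometric polynomial whose coefficients have absolute sum at most m⁴ per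
factor, since the grid is of size m². Comparing two sets with each other avoids the evaluation of a
main term. -/
theorem abs_avg_sub_avg_le_of_expi {d : ℕ} (A B : Finset ℕ) (hA : A.Nonempty) (hB : B.Nonempty)
    (m : ℕ) (hm : 0 < m) (K ε : ℝ) (hK : 0 ≤ K) (g : Fin d → Torus → ℝ)
    (hg0 : ∀ i x, 0 ≤ g i x) (hg1 : ∀ i x, g i x ≤ 1)
    (hg : ∀ i x y, |g i x - g i y| ≤ K * dist x y) (α β : Fin d → ℝ)
    (hε : ∀ u v : Fin d → ℤ, (∀ i, |u i| ≤ (m : ℤ) ^ 2 ∧ |v i| ≤ (m : ℤ) ^ 2) →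
      ‖(∑ n ∈ A, expi (n * ∑ i, (u i * α i + v i * β i))) / A.card -
        (∑ n ∈ B, expi (n * ∑ i, (u i * α i + v i * β i))) / B.card‖ ≤ ε) :
    |avg A (fun n => ∏ i, g i (torusPt (n * α i) (n * β i))) -
      avg B (fun n => ∏ i, g i (torusPt (n * α i) (n * β i)))| ≤
      8 * d * K / m + ((m : ℝ) ^ 4) ^ d * ε := by
  have hM : 0 < m ^ 2 := by positivity
  have hm' : (0 : ℝ) < m := by exact_mod_cast hm
  choose c u v hc huv hP using fun i => exists_fejerMean_eq (m ^ 2) hM (g i) (hg0 i) (hg1 i)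
  set G : ℕ → ℝ := fun n => ∏ i, g i (torusPt (n * α i) (n * β i)) with hG
  set P : ℕ → ℝ := fun n => ∏ i, fejerMean (m ^ 2) (g i) (n * α i) (n * β i) with hPdef
  have hGP : ∀ n, |G n - P n| ≤ 4 * d * K / m := by
    intro n
    refine (abs_prod_sub_prod_le _ _ (fun i => hg0 _ _) (fun i => hg1 _ _)
      (fun i => fejerMean_nonneg _ _ (hg0 i) _ _)
      (fun i => fejerMean_le_one _ hM _ (hg1 i) _ _)).trans ?_
    calc _ ≤ ∑ i : Fin d, 4 * K / m := by
          refine Finset.sum_le_sum fun i _ => ?_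
          rw [abs_sub_comm]
          exact abs_fejerMean_sub_le m hm (g i) K hK (hg i) _ _
      _ = _ := by simp; ring
  have hexp : ∀ n : ℕ, (P n : ℂ) = ∑ φ : (i : Fin d) → _, (∏ i, c i (φ i)) *
      expi (n * ∑ i, ((u i (φ i) : ℤ) * α i + (v i (φ i) : ℤ) * β i)) := by
    intro n
    rw [hPdef]
    simp only [Complex.ofReal_prod, hP]
    rw [Finset.prod_univ_sum, Fintype.piFinset_univ]
    refine Finset.sum_congr rfl fun φ _ => ?_
    rw [Finset.prod_mul_distrib, ← expi_sum, Finset.mul_sum]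
    congr 2
    refine Finset.sum_congr rfl fun i _ => ?_
    ring
  have havg : ∀ S : Finset ℕ, ((avg S P : ℝ) : ℂ) = ∑ φ : (i : Fin d) → _, (∏ i, c i (φ i)) *
      ((∑ n ∈ S, expi (n * ∑ i, ((u i (φ i) : ℤ) * α i + (v i (φ i) : ℤ) * β i))) / S.card) := by
    intro S
    rw [avg]
    push_cast
    simp only [hexp]
    rw [Finset.sum_comm, Finset.sum_div]
    refine Finset.sum_congr rfl fun φ _ => ?_
    rw [← Finset.mul_sum, mul_div_assoc]
  have hmain : |avg A P - avg B P| ≤ ((m : ℝ) ^ 4) ^ d * ε := by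
    have hε0 : 0 ≤ ε := (norm_nonneg _).trans (hε 0 0 (fun i => by simp))
    rw [← Real.norm_eq_abs, ← Complex.norm_real, Complex.ofReal_sub, havg, havg,
      ← Finset.sum_sub_distrib]
    calc _ ≤ ∑ φ : (i : Fin d) → _, (∏ i, ‖c i (φ i)‖) * ε := by
          refine (norm_sum_le _ _).trans (Finset.sum_le_sum fun φ _ => ?_)
          rw [← mul_sub, norm_mul, norm_prod]
          refine mul_le_mul_of_nonneg_left ?_ (Finset.prod_nonneg fun _ _ => norm_nonneg _)
          exact hε (fun i => u i (φ i)) (fun i => v i (φ i)) fun i => by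
            have := huv i (φ i)
            push_cast at this
            exact this
      _ = (∏ i, ∑ x, ‖c i x‖) * ε := by
          rw [← Finset.sum_mul, Finset.prod_univ_sum, Fintype.piFinset_univ]
      _ ≤ (∏ i : Fin d, (m : ℝ) ^ 4) * ε := by
          refine mul_le_mul_of_nonneg_right ?_ hε0
          refine Finset.prod_le_prod (fun i _ => Finset.sum_nonneg fun _ _ => norm_nonneg _)
            fun i _ => ?_
          have := hc i
          push_cast at this
          rw [← pow_mul] at this
          exact this
      _ = _ := by simp
  have hd : ∀ S : Finset ℕ, S.Nonempty → |avg S G - avg S P| ≤ 4 * d * K / m := by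
    intro S hS
    rw [← avg_sub]
    exact abs_avg_le S hS hGP
  have h1 := abs_le.1 (hd A hA)
  have h2 := abs_le.1 (hd B hB)
  have h3 := abs_le.1 hmain
  have h4 : 8 * d * K / m = 4 * d * K / m + 4 * d * K / m := by ring
  rw [abs_le]
  constructor <;> linarith

/-! ### Elementary properties of Zeckendorf digits. -/

open Real (goldenRatio goldenConj)

/-- The Zeckendorf digit as a natural number. -/
def digit (j n : ℕ) : ℕ := if j ∈ Nat.zeckendorf n then 1 else 0

theorem digit_le_one (j n : ℕ) : digit j n ≤ 1 := by unfold digit; split_ifs <;> omega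

/-- For n < F_K the sum stays below F_(K+2), so the greedy algorithm removes F_(K+1) first and
continues with n. -/
theorem digit_fib_add {K n : ℕ} (hK : 1 ≤ K) (hn : n < Nat.fib K) (i : ℕ) :
    digit i (Nat.fib (K + 1) + n) = if i = K + 1 then 1 else digit i n := by
  have hpos : 0 < Nat.fib (K + 1) := Nat.fib_pos.2 (by omega)
  have hg : Nat.greatestFib (Nat.fib (K + 1) + n) = K + 1 := by
    apply le_antisymm
    · rw [← Nat.lt_succ_iff, Nat.greatestFib_lt, Nat.fib_add_two (n := K)]
      omega
    · rw [Nat.le_greatestFib]; omega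
  rw [digit, digit, Nat.zeckendorf_of_pos (by omega), hg, Nat.add_sub_cancel_left]
  simp only [List.mem_cons]
  by_cases h : i = K + 1 <;> simp [h]

theorem digit_eq_zero {K n : ℕ} (hn : n < Nat.fib K) {i : ℕ} (hi : K ≤ i) : digit i n = 0 := by
  rw [digit, if_neg]
  intro h
  have h1 : Nat.fib i ≤ ((Nat.zeckendorf n).map Nat.fib).sum :=
    List.single_le_sum (fun _ _ => Nat.zero_le _) _ (List.mem_map_of_mem h)
  rw [Nat.sum_zeckendorf_fib] at h1
  have := Nat.fib_mono hi
  omega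

/-- An integer below F_(K+2) is either below F_(K+1), or F_(K+1) plus a remainder below F_K. The
bound K is carried along so that statements about digit sums of length K can be proved. -/
theorem zeckendorf_induction {P : ℕ → ℕ → Prop} (h1 : P 1 0)
    (hs : ∀ K n, 1 ≤ K → n < Nat.fib K → P K n → P (K + 1) n)
    (ht : ∀ K n, 1 ≤ K → n < Nat.fib K → P K n → P (K + 2) (Nat.fib (K + 1) + n)) :
    ∀ K n, 1 ≤ K → n < Nat.fib K → P K n := by
  intro K
  induction K using Nat.strong_induction_on with
  | _ K ih =>
    intro n hK hn
    match K, hK, hn with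
    | 1, _, hn =>
      have : n = 0 := by simpa using hn
      rw [this]; exact h1
    | 2, _, hn =>
      have : n = 0 := by simpa using hn
      subst this
      exact hs 1 0 le_rfl (by simp) h1
    | k + 3, _, hn =>
      by_cases hlt : n < Nat.fib (k + 2)
      · exact hs (k + 2) n (by omega) hlt (ih (k + 2) (by omega) n (by omega) hlt)
      · have h2 : Nat.fib (k + 3) = Nat.fib (k + 1) + Nat.fib (k + 2) := Nat.fib_add_two
        have h3 : n - Nat.fib (k + 2) < Nat.fib (k + 1) := by omega
        have h4 := ht (k + 1) (n - Nat.fib (k + 2)) (by omega) h3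
          (ih (k + 1) (by omega) _ (by omega) h3)
        rw [show Nat.fib (k + 1 + 1) + (n - Nat.fib (k + 2)) = n by
          rw [show k + 1 + 1 = k + 2 by omega]; omega] at h4
        exact h4

/-- Gives the explicit index n + 3 from which all digits of n vanish, so that sums over all digits
can be written as finite sums. -/
theorem lt_fib_add_three (n : ℕ) : n < Nat.fib (n + 3) := by
  have := Nat.le_fib_add_one (n + 3)
  omega

theorem digit_mul_digit_succ (n i : ℕ) : digit i n * digit (i + 1) n = 0 := by
  refine zeckendorf_induction (P := fun _ n => ∀ i, digit i n * digit (i + 1) n = 0) ?_ ?_ ?_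
    (n + 3) n (by omega) (lt_fib_add_three n) i
  · intro i; simp [digit]
  · intro K n _ _ h; exact h
  · intro K n hK hn h i
    rw [digit_fib_add hK hn, digit_fib_add hK hn]
    by_cases h1 : i = K + 1
    · rw [if_pos h1, if_neg (by omega), digit_eq_zero hn (by omega)]
    · by_cases h2 : i + 1 = K + 1
      · rw [digit_eq_zero hn (by omega : K ≤ i)]; simp [h1]
      · rw [if_neg h1, if_neg h2]; exact h i

theorem digit_zero (n : ℕ) : digit 0 n = 0 := by
  refine zeckendorf_induction (P := fun _ n => digit 0 n = 0) ?_ ?_ ?_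
    (n + 3) n (by omega) (lt_fib_add_three n)
  · simp [digit]
  · intro K n _ _ h; exact h
  · intro K n hK hn h
    rw [digit_fib_add hK hn, if_neg (by omega), h]

theorem sum_digit_mul_fib {K n : ℕ} (hK : 1 ≤ K) (hn : n < Nat.fib K) :
    ∑ i ∈ Finset.range K, digit i n * Nat.fib i = n := by
  refine zeckendorf_induction
    (P := fun K n => ∑ i ∈ Finset.range K, digit i n * Nat.fib i = n) ?_ ?_ ?_ K n hK hn
  · simp [digit]
  · intro K n _ hn h
    rw [Finset.sum_range_succ, h, digit_eq_zero hn le_rfl]; simp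
  · intro K n hK hn h
    rw [Finset.sum_range_succ, Finset.sum_range_succ]
    simp only [digit_fib_add hK hn]
    rw [if_pos trivial, if_neg (by omega), digit_eq_zero hn le_rfl]
    have : ∀ i ∈ Finset.range K, (if i = K + 1 then 1 else digit i n) * Nat.fib i =
        digit i n * Nat.fib i := by
      intro i hi
      rw [Finset.mem_range] at hi
      rw [if_neg (by omega)]
    rw [Finset.sum_congr rfl this, h]
    omega

/-! ### Bounds for digit expansions in base `φ` and in base `ψ` -/

/-- A digit 1 on top forces a 0 below it, and γ^(j+2) = γ^(j+1) + γ^j absorbs both positions. -/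
theorem sum_mul_goldenRatio_pow_le (c : ℕ → ℕ) (hc : ∀ i, c i ≤ 1) (hcc : ∀ i, c i * c (i + 1) = 0)
    (j : ℕ) : ∑ i ∈ Finset.range j, (c i : ℝ) * goldenRatio ^ i ≤ goldenRatio ^ j := by
  have hg := Real.one_lt_goldenRatio
  induction j using Nat.strong_induction_on with
  | _ j ih =>
    match j with
    | 0 => simp
    | 1 =>
      have : (c 0 : ℝ) ≤ 1 := by exact_mod_cast hc 0
      simp; linarith
    | j + 2 =>
      rw [Finset.sum_range_succ]
      have hsq : goldenRatio ^ (j + 2) = goldenRatio ^ (j + 1) + goldenRatio ^ j := by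
        rw [pow_add, Real.goldenRatio_sq]; ring
      have hp : 0 < goldenRatio ^ (j + 1) := by positivity
      have hp' : 0 < goldenRatio ^ j := by positivity
      by_cases h : c (j + 1) = 0
      · rw [h]
        have := ih (j + 1) (by omega)
        simp only [Nat.cast_zero, zero_mul, add_zero]
        linarith
      · have h1 : c (j + 1) = 1 := by have := hc (j + 1); omega
        have h2 : c j = 0 := by have := hcc j; rw [h1] at this; omega
        rw [Finset.sum_range_succ, h1, h2]
        have := ih j (by omega)
        simp only [Nat.cast_zero, zero_mul, add_zero, Nat.cast_one, one_mul]
        linarith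

/-- Horner's scheme S = c₀ + ψS', with S' the value of the shifted digits. Multiplication by ψ maps
[-1, γ] onto [-1, -ψ]; if c₀ = 1 then c₁ = 0, so S' lies in [-1, -ψ] and S in [-ψ, γ]. The four
claims support each other in the induction. -/
theorem sum_mul_goldenConj_pow_mem (R : ℕ) : ∀ (c : ℕ → ℕ), (∀ i, c i ≤ 1) →
    (∀ i, c i * c (i + 1) = 0) →
    -1 ≤ ∑ i ∈ Finset.range R, (c i : ℝ) * goldenConj ^ i ∧
    ∑ i ∈ Finset.range R, (c i : ℝ) * goldenConj ^ i ≤ goldenRatio ∧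
    (c 0 = 0 → ∑ i ∈ Finset.range R, (c i : ℝ) * goldenConj ^ i ≤ -goldenConj) ∧
    (c 0 = 1 → 0 < R → -goldenConj ≤ ∑ i ∈ Finset.range R, (c i : ℝ) * goldenConj ^ i) := by
  have hg := Real.one_lt_goldenRatio
  have hψ := Real.goldenConj_neg
  have hsum := Real.goldenRatio_add_goldenConj
  have hprod := Real.goldenRatio_mul_goldenConj
  have hψsq := Real.goldenConj_sq
  induction R with
  | zero => intro c _ _; simp; constructor <;> intros <;> linarith
  | succ R ih =>
    intro c hc hcc
    obtain ⟨h1, h2, h3, h4⟩ := ih (fun i => c (i + 1)) (fun i => hc _) (fun i => hcc _)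
    have hS : ∑ i ∈ Finset.range (R + 1), (c i : ℝ) * goldenConj ^ i =
        c 0 + goldenConj * ∑ i ∈ Finset.range R, (c (i + 1) : ℝ) * goldenConj ^ i := by
      rw [Finset.sum_range_succ', Finset.mul_sum, add_comm]
      congr 1
      · simp
      · exact Finset.sum_congr rfl fun i _ => by ring
    rw [hS]
    generalize ∑ i ∈ Finset.range R, (c (i + 1) : ℝ) * goldenConj ^ i = S at *
    rcases (by have := hc 0; omega : c 0 = 0 ∨ c 0 = 1) with h0 | h0
    · have e0 : (c 0 : ℝ) = 0 := by rw [h0]; simp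
      rw [e0]
      refine ⟨by nlinarith, by nlinarith, fun _ => by nlinarith, fun h _ => by omega⟩
    · have hc1 : c 1 = 0 := by have := hcc 0; rw [h0] at this; simpa using this
      have h3' := h3 hc1
      have e0 : (c 0 : ℝ) = 1 := by rw [h0]; simp
      rw [e0]
      refine ⟨by nlinarith, by nlinarith, fun h => by omega, fun _ _ => by nlinarith⟩

/-- The normalized contribution of the digits below `j`. -/
noncomputable def lowVal (j n : ℕ) : ℝ :=
  (∑ i ∈ Finset.range j, (digit i n : ℝ) * goldenRatio ^ i) / goldenRatio ^ j

/-- The conjugate of the contribution of the digits from `j` on. -/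
noncomputable def highVal (j n : ℕ) : ℝ :=
  ∑ i ∈ Finset.range (n + 3), (digit (i + j) n : ℝ) * goldenConj ^ i

/-- The integer with digits `δ_{i+j}(n)`, with `F_{i+e}` in place of `F_{i+j}`. -/
def highInt (e j n : ℕ) : ℕ := ∑ i ∈ Finset.range (n + 3), digit (i + j) n * Nat.fib (i + e)

/-- The integer formed by the digits below `j`. -/
def lowInt (j n : ℕ) : ℕ := ∑ i ∈ Finset.range j, digit i n * Nat.fib i

theorem lowVal_nonneg (j n : ℕ) : 0 ≤ lowVal j n :=
  div_nonneg (Finset.sum_nonneg fun _ _ => by have := Real.goldenRatio_pos; positivity)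
    (pow_nonneg Real.goldenRatio_pos.le _)

theorem lowVal_le_one (j n : ℕ) : lowVal j n ≤ 1 := by
  rw [lowVal, div_le_one (pow_pos Real.goldenRatio_pos _)]
  exact sum_mul_goldenRatio_pow_le _ (fun i => digit_le_one i n) (digit_mul_digit_succ n) j

/-- The digit before j must be 0, so the lower digits give at most γ^(j-1) = -ψ γ^j. -/
theorem lowVal_le_of_digit {j n : ℕ} (h : digit j n = 1) : lowVal j n ≤ -goldenConj := by
  have hp := pow_pos Real.goldenRatio_pos
  rcases j with _ | j
  · rw [digit_zero] at h; omega
  · have h0 : digit j n = 0 := by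
      have := digit_mul_digit_succ n j
      rw [h] at this; omega
    rw [lowVal, Finset.sum_range_succ, h0, div_le_iff₀ (hp _)]
    have h1 := sum_mul_goldenRatio_pow_le _ (fun i => digit_le_one i n) (digit_mul_digit_succ n) j
    have h2 : -goldenConj * goldenRatio ^ (j + 1) = goldenRatio ^ j := by
      have := Real.goldenRatio_mul_goldenConj
      rw [pow_succ]; linear_combination (-goldenRatio ^ j) * this
    rw [h2]
    simpa using h1

theorem highVal_mem (j n : ℕ) : -1 ≤ highVal j n ∧ highVal j n ≤ goldenRatio ∧
    (digit j n = 0 → highVal j n ≤ -goldenConj) ∧ (digit j n = 1 → -goldenConj ≤ highVal j n) := by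
  obtain ⟨h1, h2, h3, h4⟩ := sum_mul_goldenConj_pow_mem (n + 3) (fun i => digit (i + j) n)
    (fun i => digit_le_one _ n) (fun i => by
      rw [show i + 1 + j = (i + j) + 1 by ring]; exact digit_mul_digit_succ n (i + j))
  simp only [zero_add] at h3 h4
  exact ⟨h1, h2, h3, fun h => h4 h (by omega)⟩

/-- From ψ^i = F_(i+1) - γF_i. Thus `highVal` measures the position of γ·`highInt 0` modulo 1. -/
theorem highVal_eq (j n : ℕ) : highVal j n = highInt 1 j n - goldenRatio * highInt 0 j n := by
  simp only [highVal, highInt]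
  push_cast
  rw [Finset.mul_sum, ← Finset.sum_sub_distrib]
  refine Finset.sum_congr rfl fun i _ => ?_
  rw [← Real.fib_succ_sub_goldenRatio_mul_fib]
  simp only [add_zero]
  ring

theorem sum_range_digit_split {M : Type*} [AddCommMonoid M] (f : ℕ → ℕ → M)
    (hf : ∀ i, f i 0 = 0) (j n : ℕ) :
    ∑ i ∈ Finset.range (n + 3), f i (digit i n) = ∑ i ∈ Finset.range j, f i (digit i n) +
      ∑ i ∈ Finset.range (n + 3), f (i + j) (digit (i + j) n) := by
  have h1 : ∑ i ∈ Finset.range (n + 3), f i (digit i n) =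
      ∑ i ∈ Finset.range (j + (n + 3)), f i (digit i n) := by
    refine Finset.sum_subset (fun i hi => ?_) fun i _ hi => ?_
    · rw [Finset.mem_range] at hi ⊢; omega
    · rw [Finset.mem_range, not_lt] at hi
      rw [digit_eq_zero (lt_fib_add_three n) hi, hf]
  rw [h1, Finset.sum_range_add]
  simp only [add_comm j]

/-- The addition formula F_(i+j) = F_i F_(j-1) + F_(i+1) F_j. In particular n is recovered from
`lowInt` and the two values of `highInt`. -/
theorem eq_lowInt_add (j n : ℕ) (hj : 1 ≤ j) :
    n = lowInt j n + highInt 0 j n * Nat.fib (j - 1) + highInt 1 j n * Nat.fib j := by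
  have h1 := sum_digit_mul_fib (by omega) (lt_fib_add_three n)
  rw [sum_range_digit_split (fun i d => d * Nat.fib i) (fun i => by simp) j n] at h1
  conv_lhs => rw [← h1]
  rw [lowInt, highInt, highInt, add_assoc, Finset.sum_mul, Finset.sum_mul,
    ← Finset.sum_add_distrib]
  congr 1
  refine Finset.sum_congr rfl fun i _ => ?_
  obtain ⟨k, rfl⟩ : ∃ k, j = k + 1 := ⟨j - 1, by omega⟩
  rw [← add_assoc, Nat.fib_add]
  simp only [Nat.add_sub_cancel, add_zero]
  ring

/-- All digits evaluated in base `ψ`. -/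
theorem abs_highVal_zero_le (n : ℕ) : |highVal 0 n| ≤ goldenRatio := by
  obtain ⟨h1, h2, -, -⟩ := highVal_mem 0 n
  have := Real.one_lt_goldenRatio
  rw [abs_le]; constructor <;> linarith

theorem sqrt_five_mul_fib (i : ℕ) : √5 * (Nat.fib i : ℝ) = goldenRatio ^ i - goldenConj ^ i := by
  rw [Real.coe_fib_eq]
  field_simp

/-- Binet's formula summed over the digits. In the upper part γ^j is factored out and Binet is used
again, as γ^i = ψ^i + √5 F_i. What remains after division by √5 γ^j is an integer, a function of
(`lowVal`, `highVal`), and a negligible term. -/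
theorem sqrt_five_mul_eq (j n : ℕ) : √5 * (n : ℝ) =
    goldenRatio ^ j * (lowVal j n + highVal j n + √5 * highInt 0 j n) - highVal 0 n := by
  have hp : goldenRatio ^ j ≠ 0 := (pow_pos Real.goldenRatio_pos _).ne'
  have h1 : (n : ℝ) = ∑ i ∈ Finset.range (n + 3), (digit i n : ℝ) * Nat.fib i := by
    exact_mod_cast (sum_digit_mul_fib (by omega) (lt_fib_add_three n)).symm
  have h2 : √5 * (n : ℝ) = ∑ i ∈ Finset.range (n + 3), (digit i n : ℝ) * goldenRatio ^ i -
      highVal 0 n := by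
    conv_lhs => rw [h1]
    rw [highVal, Finset.mul_sum, ← Finset.sum_sub_distrib]
    refine Finset.sum_congr rfl fun i _ => ?_
    have := sqrt_five_mul_fib i
    rw [add_zero]
    linear_combination (digit i n : ℝ) * this
  rw [h2, sum_range_digit_split (fun i d => (d : ℝ) * goldenRatio ^ i) (fun i => by simp) j n]
  congr 1
  have h3 : goldenRatio ^ j * lowVal j n =
      ∑ i ∈ Finset.range j, (digit i n : ℝ) * goldenRatio ^ i := by
    rw [lowVal]; field_simp
  rw [← h3, add_assoc, mul_add]
  congr 1
  rw [highVal, highInt]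
  push_cast
  rw [Finset.mul_sum, ← Finset.sum_add_distrib, Finset.mul_sum]
  refine Finset.sum_congr rfl fun i _ => ?_
  have := sqrt_five_mul_fib i
  rw [add_zero, pow_add]
  linear_combination (-(digit (i + j) n : ℝ) * goldenRatio ^ j) * this

theorem sqrt_five_mul_lowInt (j n : ℕ) :
    ∃ t : ℝ, |t| ≤ goldenRatio ∧ √5 * (lowInt j n : ℝ) = goldenRatio ^ j * lowVal j n - t := by
  have hp : goldenRatio ^ j ≠ 0 := (pow_pos Real.goldenRatio_pos _).ne'
  refine ⟨∑ i ∈ Finset.range j, (digit i n : ℝ) * goldenConj ^ i, ?_, ?_⟩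
  · obtain ⟨h1, h2, -, -⟩ := sum_mul_goldenConj_pow_mem j (fun i => digit i n)
      (fun i => digit_le_one _ n) (digit_mul_digit_succ n)
    have := Real.one_lt_goldenRatio
    rw [abs_le]; constructor <;> linarith
  · have h3 : goldenRatio ^ j * lowVal j n =
        ∑ i ∈ Finset.range j, (digit i n : ℝ) * goldenRatio ^ i := by
      rw [lowVal]; field_simp
    rw [h3, lowInt, ← Finset.sum_sub_distrib]
    push_cast
    rw [Finset.mul_sum]
    refine Finset.sum_congr rfl fun i _ => ?_
    have := sqrt_five_mul_fib i
    linear_combination (digit i n : ℝ) * this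

theorem goldenRatio_bounds : 1.618 < goldenRatio ∧ goldenRatio < 1.6181 := by
  have h5 : (2.236 : ℝ) < √5 := by
    rw [Real.lt_sqrt (by norm_num)]; norm_num
  have h6 : √5 < (2.2361 : ℝ) := by
    rw [Real.sqrt_lt' (by norm_num)]; norm_num
  rw [Real.goldenRatio]
  constructor <;> linarith

theorem goldenConj_eq : goldenConj = 1 - goldenRatio := by
  linarith [Real.goldenRatio_add_goldenConj]

theorem sqrt_five_eq : √5 = 2 * goldenRatio - 1 := by
  rw [← Real.goldenRatio_sub_goldenConj, goldenConj_eq]; ring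

/-! ### Reading a digit off a point of the torus. -/

/-- The values of the digits near the index `j` lie close to the boundary of the domain which they
fill out. -/
def NearBoundary (j : ℕ) (η : ℝ) (n : ℕ) : Prop :=
  |lowVal j n| ≤ 3 * η ∨ |lowVal j n + goldenConj| ≤ 3 * η ∨ |lowVal j n - 1| ≤ 3 * η ∨
  |highVal j n + 1| ≤ 3 * η ∨ |highVal j n + goldenConj| ≤ 3 * η ∨
  |highVal j n - goldenRatio| ≤ 3 * η

/-- The point of the torus that determines the digits of `n` near the index `j`. -/
noncomputable def digitPt (j n : ℕ) : Torus :=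
  torusPt (n * (1 / goldenRatio ^ j)) (n * (goldenRatio / goldenRatio ^ j))

theorem nearDist_fst_le_dist (s t s' t' : ℝ) :
    nearDist (s - s') ≤ dist (torusPt s t) (torusPt s' t') := by
  rw [Prod.dist_eq, torusPt, torusPt, dist_eq_norm, ← AddCircle.coe_sub, UnitAddCircle.norm_eq]
  exact le_max_left _ _

theorem nearDist_snd_le_dist (s t s' t' : ℝ) :
    nearDist (t - t') ≤ dist (torusPt s t) (torusPt s' t') := by
  rw [Prod.dist_eq, torusPt, torusPt, dist_eq_norm, dist_eq_norm, ← AddCircle.coe_sub,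
    ← AddCircle.coe_sub, UnitAddCircle.norm_eq, UnitAddCircle.norm_eq]
  exact le_max_right _ _

theorem abs_mul_inv_sub_le (j n : ℕ) :
    |n * (1 / goldenRatio ^ j) - ((lowVal j n + highVal j n) / √5 + highInt 0 j n)| ≤
      1 / goldenRatio ^ j := by
  have hp : 0 < goldenRatio ^ j := pow_pos Real.goldenRatio_pos _
  obtain ⟨hg1, hg2⟩ := goldenRatio_bounds
  have h5 := sqrt_five_eq
  have h50 : 0 < √5 := by rw [h5]; linarith
  have h := sqrt_five_mul_eq j n
  have e : n * (1 / goldenRatio ^ j) - ((lowVal j n + highVal j n) / √5 + highInt 0 j n) =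
      -(highVal 0 n) / (√5 * goldenRatio ^ j) := by
    field_simp
    linear_combination h
  rw [e, abs_div, abs_neg, abs_of_pos (by positivity : 0 < √5 * goldenRatio ^ j),
    div_le_div_iff₀ (by positivity) hp]
  have := abs_highVal_zero_le n
  nlinarith

/-- γ times the estimate for the first coordinate: `highVal_eq` replaces γ·`highInt 0` by the
integer `highInt 1` minus `highVal`, and γ - √5 = ψ yields the new coefficient of `highVal`. -/
theorem abs_mul_inv_sub_le' (j n : ℕ) :
    |n * (goldenRatio / goldenRatio ^ j) -
      ((goldenRatio * lowVal j n + goldenConj * highVal j n) / √5 + highInt 1 j n)| ≤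
      2 / goldenRatio ^ j := by
  obtain ⟨hg1, hg2⟩ := goldenRatio_bounds
  have hp : 0 < goldenRatio ^ j := pow_pos Real.goldenRatio_pos _
  have h5 := sqrt_five_eq
  have h50 : 0 < √5 := by rw [h5]; linarith
  have h1 := abs_mul_inv_sub_le j n
  have h2 := highVal_eq j n
  have e : n * (goldenRatio / goldenRatio ^ j) -
      ((goldenRatio * lowVal j n + goldenConj * highVal j n) / √5 + highInt 1 j n) =
      goldenRatio * (n * (1 / goldenRatio ^ j) -
        ((lowVal j n + highVal j n) / √5 + highInt 0 j n)) := by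
    have h3 : goldenConj = goldenRatio - √5 := by
      rw [← Real.goldenRatio_sub_goldenConj]; ring
    have h4 : (highInt 1 j n : ℝ) = highVal j n + goldenRatio * highInt 0 j n := by
      rw [h2]; ring
    rw [h3, h4]
    field_simp
    ring
  rw [e, abs_mul, abs_of_pos Real.goldenRatio_pos]
  calc _ ≤ goldenRatio * (1 / goldenRatio ^ j) := by gcongr
    _ ≤ 2 * (1 / goldenRatio ^ j) := by gcongr; linarith
    _ = _ := by ring

theorem exists_int_abs_sub_le {s s' x x' η a b : ℝ} {k k' : ℕ} (h : nearDist (s - s') ≤ η)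
    (h1 : |s - (x + k)| ≤ a) (h2 : |s' - (x' + k')| ≤ b) :
    ∃ B : ℤ, |x - x' - B| ≤ η + a + b := by
  refine ⟨round (s - s') - k + k', ?_⟩
  rw [nearDist] at h
  rw [abs_le] at *
  push_cast
  constructor <;> linarith [h.1, h.2, h1.1, h1.2, h2.1, h2.2]

/-- For digit 0 the pair (`lowVal`, `highVal`) lies in [0, 1] × [-1, -ψ], for digit 1 in [0, -ψ] ×
[-ψ, γ]. Closeness on the torus means that the two pairs differ by nearly a vector of the lattice
generated by (γ - 1, γ) and (1, -1), whose covolume √5 is the total area of the rectangles.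
Translates of the rectangles meet only along edges, so both points are close to an edge. -/
theorem nearBoundary_of_dist_le {j n n' : ℕ} {ε η : ℝ} (hη : η = ε + 4 / goldenRatio ^ j)
    (hη1 : η ≤ 1 / 10) (hn : digit j n = 1) (hn' : digit j n' = 0)
    (hd : dist (digitPt j n) (digitPt j n') ≤ ε) : NearBoundary j η n ∧ NearBoundary j η n' := by
  obtain ⟨hg1, hg2⟩ := goldenRatio_bounds
  have hp : 0 < goldenRatio ^ j := pow_pos Real.goldenRatio_pos _
  have hpi : 0 < 1 / goldenRatio ^ j := by positivity
  have h5 := sqrt_five_eq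
  have h50 : 0 < √5 := by rw [h5]; linarith
  have hψ := goldenConj_eq
  obtain ⟨B₁, hB₁⟩ := exists_int_abs_sub_le ((nearDist_fst_le_dist _ _ _ _).trans hd)
    (abs_mul_inv_sub_le j n) (abs_mul_inv_sub_le j n')
  obtain ⟨B₂, hB₂⟩ := exists_int_abs_sub_le ((nearDist_snd_le_dist _ _ _ _).trans hd)
    (abs_mul_inv_sub_le' j n) (abs_mul_inv_sub_le' j n')
  have e1 : ε + 1 / goldenRatio ^ j + 1 / goldenRatio ^ j ≤ η := by
    rw [hη]; have : 4 / goldenRatio ^ j = 4 * (1 / goldenRatio ^ j) := by ring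
    linarith
  have e2 : ε + 2 / goldenRatio ^ j + 2 / goldenRatio ^ j ≤ η := by
    rw [hη]; apply le_of_eq; ring
  replace hB₁ := hB₁.trans e1
  replace hB₂ := hB₂.trans e2
  have u1 := lowVal_nonneg j n
  have u2 := lowVal_le_of_digit hn
  have u1' := lowVal_nonneg j n'
  have u2' := lowVal_le_one j n'
  obtain ⟨-, w2, -, w1⟩ := highVal_mem j n
  replace w1 := w1 hn
  obtain ⟨w1', -, w2', -⟩ := highVal_mem j n'
  replace w2' := w2' hn'
  clear e1 e2 hd hη hp hpi
  unfold NearBoundary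
  generalize lowVal j n = u at *
  generalize lowVal j n' = u' at *
  generalize highVal j n = w at *
  generalize highVal j n' = w' at *
  obtain ⟨p, hp⟩ : ∃ p, p = (u + w) / √5 - (u' + w') / √5 := ⟨_, rfl⟩
  obtain ⟨s, hs⟩ : ∃ s, s = (goldenRatio * u + goldenConj * w) / √5 -
    (goldenRatio * u' + goldenConj * w') / √5 := ⟨_, rfl⟩
  rw [← hp] at hB₁
  rw [← hs] at hB₂
  have hp' : (2 * goldenRatio - 1) * p = (u - u') + (w - w') := by
    rw [← h5, hp]; field_simp; ring
  have hs' : (2 * goldenRatio - 1) * s = goldenRatio * (u - u') + (1 - goldenRatio) * (w - w') := by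
    rw [← h5, hs, hψ]; field_simp; ring
  have hne : (2 * goldenRatio - 1) ≠ 0 := by linarith
  have hsq := Real.goldenRatio_sq
  -- The linear map to torus coordinates is inverted, so the integers B₁ ≈ p and B₂ ≈ s determine
  -- the lattice vector (B₂ + (γ - 1)B₁, γB₁ - B₂).
  have hU : u - u' = s - (1 - goldenRatio) * p := by
    apply mul_left_cancel₀ hne
    linear_combination (-1 : ℝ) * hs' + (1 - goldenRatio) * hp'
  have hW : w - w' = goldenRatio * p - s := by
    apply mul_left_cancel₀ hne
    linear_combination (1 : ℝ) * hs' - goldenRatio * hp'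
  rw [hψ] at *
  rw [abs_le] at hB₁ hB₂
  have hr : 0 ≤ 2 * goldenRatio - 1 := by linarith
  have hφ0 : 0 ≤ goldenRatio := by linarith
  have hφ1 : 0 ≤ goldenRatio - 1 := by linarith
  have m1 := mul_nonneg hφ0 (show 0 ≤ u - u' + 1 by linarith)
  have m2 := mul_nonneg hφ0 (show 0 ≤ goldenRatio - 1 - (u - u') by linarith)
  have m3 := mul_nonneg hφ1 (show 0 ≤ w - w' by linarith)
  have m4 := mul_nonneg hφ1 (show 0 ≤ goldenRatio + 1 - (w - w') by linarith)
  have p1 : -(1 / 2) < p := by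
    by_contra! hcon
    have := mul_le_mul_of_nonneg_left hcon hr
    linarith
  have p2 : p < 3 / 2 := by
    by_contra! hcon
    have := mul_le_mul_of_nonneg_left hcon hr
    linarith
  have s1 : -(3 / 2) < s := by
    by_contra! hcon
    have := mul_le_mul_of_nonneg_left hcon hr
    linarith
  have s2 : s < 1 / 2 := by
    by_contra! hcon
    have := mul_le_mul_of_nonneg_left hcon hr
    linarith
  have b1 : (-1 : ℝ) < B₁ := by linarith
  have b2 : (B₁ : ℝ) < 2 := by linarith
  have b3 : (-2 : ℝ) < B₂ := by linarith
  have b4 : (B₂ : ℝ) < 1 := by linarith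
  have b1' : -1 < B₁ := by exact_mod_cast b1
  have b2' : B₁ < 2 := by exact_mod_cast b2
  have b3' : -2 < B₂ := by exact_mod_cast b3
  have b4' : B₂ < 1 := by exact_mod_cast b4
  have hη0 : 0 ≤ η := by linarith [hB₁.1, hB₁.2]
  have hU2 : |u - u' - (B₂ - (1 - goldenRatio) * B₁)| ≤ 3 * η := by
    have n1 := mul_le_mul_of_nonneg_left hB₁.1 hφ1
    have n2 := mul_le_mul_of_nonneg_left hB₁.2 hφ1
    have n3 := mul_nonneg (show 0 ≤ 2 - goldenRatio by linarith) hη0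
    rw [hU, abs_le]; constructor <;> linarith [hB₂.1, hB₂.2]
  have hW2 : |w - w' - (goldenRatio * B₁ - B₂)| ≤ 3 * η := by
    have n1 := mul_le_mul_of_nonneg_left hB₁.1 hφ0
    have n2 := mul_le_mul_of_nonneg_left hB₁.2 hφ0
    have n3 := mul_nonneg (show 0 ≤ 2 - goldenRatio by linarith) hη0
    rw [hW, abs_le]; constructor <;> linarith [hB₂.1, hB₂.2]
  rw [abs_le] at hU2 hW2
  -- The sizes of the rectangles leave four lattice vectors. In turn they force: the common edge
  -- `highVal` = -ψ; `lowVal` at 0 and 1; `lowVal` at -ψ and 0; `highVal` at γ and -1.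
  obtain rfl | rfl : B₁ = 0 ∨ B₁ = 1 := by omega
  · obtain rfl | rfl : B₂ = 0 ∨ B₂ = -1 := by omega
    · push_cast at hU2 hW2
      constructor
      · right; right; right; right; left; rw [abs_le]; constructor <;> linarith
      · right; right; right; right; left; rw [abs_le]; constructor <;> linarith
    · push_cast at hU2 hW2
      constructor
      · left; rw [abs_le]; constructor <;> linarith
      · right; right; left; rw [abs_le]; constructor <;> linarith
  · obtain rfl | rfl : B₂ = 0 ∨ B₂ = -1 := by omega
    · push_cast at hU2 hW2
      constructor
      · right; left; rw [abs_le]; constructor <;> linarith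
      · left; rw [abs_le]; constructor <;> linarith
    · push_cast at hU2 hW2
      constructor
      · right; right; right; right; right; rw [abs_le]; constructor <;> linarith
      · right; right; right; left; rw [abs_le]; constructor <;> linarith

/-! ### Counting integers near the boundary -/

/-- An integer is determined by `lowInt`, `highInt 0` and `highInt 1`. As `highVal` lies in [-1, γ],
the last differs from ⌊γ·`highInt 0`⌋ by one of -1, 0, 1, 2, hence the factor 4. -/
theorem card_le_of_parts {j N : ℕ} (hj : 1 ≤ j) (P : ℕ → Prop) [DecidablePred P] (S₁ S₂ : Finset ℕ)
    (h1 : ∀ n < N, P n → lowInt j n ∈ S₁) (h2 : ∀ n < N, P n → highInt 0 j n ∈ S₂) :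
    ((Finset.range N).filter P).card ≤ S₁.card * S₂.card * 4 := by
  have h4 : (Finset.Icc (-1 : ℤ) 2).card = 4 := by simp
  rw [← h4, ← Finset.card_product, ← Finset.card_product]
  refine Finset.card_le_card_of_injOn (fun n => ((lowInt j n, highInt 0 j n),
    (highInt 1 j n : ℤ) - ⌊goldenRatio * highInt 0 j n⌋)) ?_ ?_
  · intro n hn
    rw [Finset.mem_coe, Finset.mem_filter, Finset.mem_range] at hn
    simp only [Finset.coe_product, Set.mem_prod, Finset.mem_coe, Finset.mem_Icc]
    refine ⟨⟨h1 n hn.1 hn.2, h2 n hn.1 hn.2⟩, ?_⟩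
    obtain ⟨e1, e2, -, -⟩ := highVal_mem j n
    rw [highVal_eq] at e1 e2
    have f1 := Int.floor_le (goldenRatio * highInt 0 j n)
    have f2 := Int.lt_floor_add_one (goldenRatio * highInt 0 j n)
    have hg := Real.goldenRatio_lt_two
    constructor
    · have : (-2 : ℝ) < ((highInt 1 j n : ℤ) - ⌊goldenRatio * highInt 0 j n⌋ : ℤ) := by
        push_cast; linarith
      have : -2 < (highInt 1 j n : ℤ) - ⌊goldenRatio * highInt 0 j n⌋ := by exact_mod_cast this
      omega
    · have : ((highInt 1 j n : ℤ) - ⌊goldenRatio * highInt 0 j n⌋ : ℤ) < (3 : ℝ) := by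
        push_cast; linarith
      have : (highInt 1 j n : ℤ) - ⌊goldenRatio * highInt 0 j n⌋ < 3 := by exact_mod_cast this
      omega
  · intro n _ m _ hnm
    simp only [Prod.mk.injEq] at hnm
    obtain ⟨⟨a1, a2⟩, a3⟩ := hnm
    rw [a2] at a3
    have a4 : highInt 1 j n = highInt 1 j m := by omega
    rw [eq_lowInt_add j n hj, eq_lowInt_add j m hj, a1, a2, a4]

theorem highInt_zero_lt {j n N : ℕ} (hn : n < N) :
    highInt 0 j n < ⌊N / goldenRatio ^ j⌋₊ + 4 := by
  have hp : 0 < goldenRatio ^ j := pow_pos Real.goldenRatio_pos _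
  have h5 := sqrt_five_eq
  obtain ⟨hg1, hg2⟩ := goldenRatio_bounds
  have h50 : 2 < √5 := by rw [h5]; linarith
  have h1 := abs_le.1 (abs_mul_inv_sub_le j n)
  have h2 : (n : ℝ) * (1 / goldenRatio ^ j) ≤ N / goldenRatio ^ j := by
    rw [mul_one_div]; gcongr
  have h3 : 1 / goldenRatio ^ j ≤ 1 := by
    rw [div_le_one hp]; exact one_le_pow₀ (by linarith)
  have h4 : -1 ≤ (lowVal j n + highVal j n) / √5 := by
    rw [le_div_iff₀ (by linarith)]
    have := lowVal_nonneg j n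
    have := (highVal_mem j n).1
    linarith
  have h6 := Nat.lt_floor_add_one (N / goldenRatio ^ j)
  have : (highInt 0 j n : ℝ) < ((⌊N / goldenRatio ^ j⌋₊ + 4 : ℕ) : ℝ) := by
    push_cast; linarith [h1.1]
  exact_mod_cast this

theorem card_range_filter_abs_le (a r : ℝ) (hr : 0 ≤ r) (R : ℕ) :
    (((Finset.range R).filter fun n : ℕ => |(n : ℝ) - a| ≤ r).card : ℝ) ≤ 2 * r + 1 := by
  have h1 : ((Finset.range R).filter fun n : ℕ => |(n : ℝ) - a| ≤ r).card ≤
      (Finset.Icc ⌈a - r⌉ ⌊a + r⌋).card := by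
    refine Finset.card_le_card_of_injOn (fun n => (n : ℤ)) ?_ (fun n _ m _ h => by simpa using h)
    intro n hn
    simp only [Finset.coe_filter, Finset.mem_range, Set.mem_ofPred_eq, abs_le] at hn
    simp only [Finset.coe_Icc, Set.mem_Icc, Int.ceil_le, Int.le_floor]
    push_cast
    constructor <;> linarith [hn.2.1, hn.2.2]
  rw [Int.card_Icc] at h1
  have h2 : ((⌊a + r⌋ + 1 - ⌈a - r⌉).toNat : ℝ) ≤ 2 * r + 1 := by
    have e1 := Int.floor_le (a + r)
    have e2 := Int.le_ceil (a - r)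
    rcases le_total 0 (⌊a + r⌋ + 1 - ⌈a - r⌉) with h | h
    · have h4 : ((⌊a + r⌋ + 1 - ⌈a - r⌉).toNat : ℝ) = ((⌊a + r⌋ + 1 - ⌈a - r⌉ : ℤ) : ℝ) := by
        rw [← Int.cast_natCast, Int.toNat_of_nonneg h]
      rw [h4]; push_cast; linarith
    · rw [Int.toNat_of_nonpos h]; push_cast; linarith
  exact le_trans (by exact_mod_cast h1) h2

theorem lowInt_le (j n : ℕ) : (lowInt j n : ℝ) ≤ goldenRatio ^ j + 1 := by
  obtain ⟨t, ht, h⟩ := sqrt_five_mul_lowInt j n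
  obtain ⟨hg1, hg2⟩ := goldenRatio_bounds
  have h5 := sqrt_five_eq
  have hp : 0 < goldenRatio ^ j := pow_pos Real.goldenRatio_pos _
  have h1 := lowVal_le_one j n
  have h2 := (abs_le.1 ht).1
  have h3 : (0 : ℝ) ≤ lowInt j n := Nat.cast_nonneg _
  rw [h5] at h
  nlinarith

/-- √5·`lowInt` equals γ^j·`lowVal` up to a bounded error, so `lowInt` is confined to a short
interval while `highInt 0` is free. -/
theorem card_lowVal_near_le (j N : ℕ) (hj : 1 ≤ j) (c δ : ℝ) (hδ : 0 ≤ δ) :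
    (((Finset.range N).filter fun n => |lowVal j n - c| ≤ δ).card : ℝ) ≤
      (δ * goldenRatio ^ j + 5) * (N / goldenRatio ^ j + 4) * 4 := by
  obtain ⟨hg1, hg2⟩ := goldenRatio_bounds
  have h5 := sqrt_five_eq
  have hp : 0 < goldenRatio ^ j := pow_pos Real.goldenRatio_pos _
  have h50 : 0 < √5 := by rw [h5]; linarith
  set S₁ := (Finset.range (⌊goldenRatio ^ j⌋₊ + 3)).filter
    fun r : ℕ => |(r : ℝ) - goldenRatio ^ j * c / √5| ≤ (δ * goldenRatio ^ j + 2) / 2 with hS₁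
  set S₂ := Finset.range (⌊N / goldenRatio ^ j⌋₊ + 4) with hS₂
  have h1 := card_le_of_parts (N := N) hj (fun n => |lowVal j n - c| ≤ δ) S₁ S₂ ?_ ?_
  · have h2 : (S₁.card : ℝ) ≤ δ * goldenRatio ^ j + 5 := by
      have := card_range_filter_abs_le (goldenRatio ^ j * c / √5) ((δ * goldenRatio ^ j + 2) / 2)
        (by positivity) (⌊goldenRatio ^ j⌋₊ + 3)
      linarith
    have h3 : (S₂.card : ℝ) ≤ N / goldenRatio ^ j + 4 := by
      rw [hS₂, Finset.card_range]; push_cast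
      have := Nat.floor_le (show 0 ≤ N / goldenRatio ^ j by positivity)
      linarith
    calc _ ≤ ((S₁.card * S₂.card * 4 : ℕ) : ℝ) := by exact_mod_cast h1
      _ ≤ _ := by push_cast; gcongr
  · intro n _ hn
    rw [hS₁, Finset.mem_filter, Finset.mem_range]
    constructor
    · have e1 := lowInt_le j n
      have e2 := Nat.lt_floor_add_one (goldenRatio ^ j)
      have : (lowInt j n : ℝ) < ((⌊goldenRatio ^ j⌋₊ + 3 : ℕ) : ℝ) := by push_cast; linarith
      exact_mod_cast this
    · obtain ⟨t, ht, h⟩ := sqrt_five_mul_lowInt j n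
      have e : (lowInt j n : ℝ) - goldenRatio ^ j * c / √5 =
          (goldenRatio ^ j * (lowVal j n - c) - t) / √5 := by
        field_simp; linarith
      rw [e, abs_div, abs_of_pos h50, div_le_iff₀ h50]
      have e2 : |goldenRatio ^ j * (lowVal j n - c) - t| ≤ goldenRatio ^ j * δ + goldenRatio := by
        refine (abs_sub _ _).trans (add_le_add ?_ ht)
        rw [abs_mul, abs_of_pos hp]
        exact mul_le_mul_of_nonneg_left hn hp.le
      refine e2.trans ?_
      have : 0 ≤ goldenRatio ^ j * δ := by positivity
      rw [h5]; nlinarith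
  · intro n hn _
    rw [hS₂, Finset.mem_range]
    exact highInt_zero_lt hn

/-- The approximation is F_(k+1)/F_k with F_k the largest Fibonacci number up to B; its error is
|ψ|^k / F_k. Since B ≤ 2F_k, only 3·2 + 1 = 7 blocks are needed. -/
theorem card_nearDist_goldenRatio_le (B : ℕ) (hB : 2 ≤ B) (c δ : ℝ) (hδ : 0 ≤ δ) :
    (((Finset.range B).filter fun h : ℕ => nearDist (h * goldenRatio - c) ≤ δ).card : ℝ) ≤
      7 * (4 * B * δ + 2) := by
  set k := Nat.greatestFib B with hk
  have h1 : Nat.fib k ≤ B := Nat.fib_greatestFib_le B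
  have h2 : B < Nat.fib (k + 1) := Nat.lt_fib_greatestFib_add_one B
  have hk1 : 1 ≤ k := by
    have : Nat.fib 1 ≤ B := by simp; omega
    exact Nat.le_greatestFib.2 this
  obtain ⟨m, hm⟩ : ∃ m, k = m + 1 := ⟨k - 1, by omega⟩
  have h3 : B ≤ 2 * Nat.fib k := by
    have : Nat.fib (m + 1 + 1) = Nat.fib m + Nat.fib (m + 1) := Nat.fib_add_two
    have h4 : Nat.fib m ≤ Nat.fib (m + 1) := Nat.fib_mono (by omega)
    rw [hm] at h2 ⊢; omega
  have hq : 0 < Nat.fib k := Nat.fib_pos.2 (by omega)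
  have hq' : (0 : ℝ) < Nat.fib k := by exact_mod_cast hq
  have hψ1 : |goldenConj| ^ k ≤ 1 / Nat.fib k := by
    have e1 : |goldenConj| = goldenRatio⁻¹ := by
      rw [abs_of_neg Real.goldenConj_neg, Real.inv_goldenRatio]
    rw [e1, inv_pow, ← one_div]
    refine one_div_le_one_div_of_le hq' ?_
    have e2 := Real.goldenRatio_mul_fib_succ_add_fib m
    rw [← hm] at e2
    have e3 : (0 : ℝ) ≤ Nat.fib m := Nat.cast_nonneg _
    have e4 := Real.one_lt_goldenRatio
    nlinarith
  have happ : |goldenRatio - ((Nat.fib (k + 1) : ℤ) : ℝ) / Nat.fib k| ≤ 1 / (Nat.fib k : ℝ) ^ 2 := by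
    have e1 := Real.fib_succ_sub_goldenRatio_mul_fib k
    have e2 : goldenRatio - ((Nat.fib (k + 1) : ℤ) : ℝ) / Nat.fib k = -goldenConj ^ k / Nat.fib k := by
      rw [← e1]; push_cast; field_simp; ring
    rw [e2, abs_div, abs_neg, abs_pow, abs_of_pos hq', sq, ← div_div]
    gcongr
  have hcop : IsCoprime ((Nat.fib (k + 1) : ℤ)) ((Nat.fib k : ℕ) : ℤ) :=
    Nat.isCoprime_iff_coprime.2 (Nat.fib_coprime_fib_succ k).symm
  have h4 := card_nearDist_le hq hcop happ c δ hδ 0 B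
  rw [zero_add, ← Finset.range_eq_Ico] at h4
  refine h4.trans ?_
  have h3' : (B : ℝ) ≤ 2 * Nat.fib k := by exact_mod_cast h3
  have h1' : (Nat.fib k : ℝ) ≤ B := by exact_mod_cast h1
  have h6 : 3 * (B : ℝ) / Nat.fib k + 1 ≤ 7 := by
    have : 3 * (B : ℝ) / Nat.fib k ≤ 6 := by rw [div_le_iff₀ hq']; linarith
    linarith
  gcongr

/-- If `highVal` is within δ of c, then γ·`highInt 0` is within δ of -c modulo 1, which
equidistribution of the multiples of γ makes rare; `lowInt` is free. -/
theorem card_highVal_near_le (j N : ℕ) (hj : 1 ≤ j) (c δ : ℝ) (hδ : 0 ≤ δ) :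
    (((Finset.range N).filter fun n => |highVal j n - c| ≤ δ).card : ℝ) ≤
      (goldenRatio ^ j + 3) * (7 * (4 * (N / goldenRatio ^ j + 4) * δ + 2)) * 4 := by
  have hp : 0 < goldenRatio ^ j := pow_pos Real.goldenRatio_pos _
  set B := ⌊N / goldenRatio ^ j⌋₊ + 4 with hB
  set S₁ := Finset.range (⌊goldenRatio ^ j⌋₊ + 3) with hS₁
  set S₂ := (Finset.range B).filter fun h : ℕ => nearDist (h * goldenRatio - (-c)) ≤ δ with hS₂
  have hBle : (B : ℝ) ≤ N / goldenRatio ^ j + 4 := by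
    rw [hB]; push_cast
    have := Nat.floor_le (show 0 ≤ N / goldenRatio ^ j by positivity)
    linarith
  have h1 := card_le_of_parts (N := N) hj (fun n => |highVal j n - c| ≤ δ) S₁ S₂ ?_ ?_
  · have h2 : (S₁.card : ℝ) ≤ goldenRatio ^ j + 3 := by
      rw [hS₁, Finset.card_range]; push_cast
      have := Nat.floor_le hp.le
      linarith
    have h3 : (S₂.card : ℝ) ≤ 7 * (4 * (N / goldenRatio ^ j + 4) * δ + 2) := by
      refine (card_nearDist_goldenRatio_le B (by omega) (-c) δ hδ).trans ?_
      gcongr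
    calc _ ≤ ((S₁.card * S₂.card * 4 : ℕ) : ℝ) := by exact_mod_cast h1
      _ ≤ _ := by push_cast; gcongr
  · intro n _ _
    rw [hS₁, Finset.mem_range]
    have e1 := lowInt_le j n
    have e2 := Nat.lt_floor_add_one (goldenRatio ^ j)
    have : (lowInt j n : ℝ) < ((⌊goldenRatio ^ j⌋₊ + 3 : ℕ) : ℝ) := by push_cast; linarith
    exact_mod_cast this
  · intro n hn hP
    rw [hS₂, Finset.mem_filter, Finset.mem_range]
    refine ⟨highInt_zero_lt hn, ?_⟩
    refine (nearDist_le_abs_sub_int _ (highInt 1 j n)).trans ?_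
    rw [highVal_eq] at hP
    rw [abs_sub_comm] at hP
    refine le_trans (le_of_eq ?_) hP
    congr 1
    push_cast; ring

open Classical in
/-- Few integers lie near the boundary. -/
theorem exists_card_nearBoundary_le (j : ℕ) (hj : 1 ≤ j) (η : ℝ) (hη : 0 < η) :
    ∃ N₀ : ℕ, ∀ N, N₀ ≤ N → (((Finset.range N).filter (NearBoundary j η)).card : ℝ) ≤
      10000 * (η + 1 / goldenRatio ^ j) * N := by
  have hp : 0 < goldenRatio ^ j := pow_pos Real.goldenRatio_pos _
  have hp1 : 1 ≤ goldenRatio ^ j := one_le_pow₀ Real.one_lt_goldenRatio.le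
  -- With y = N / γ^j this ensures y ≥ 4 and yη ≥ 1, which absorbs the additive constants of the
  -- counting bounds.
  refine ⟨⌈4 * goldenRatio ^ j + goldenRatio ^ j / η⌉₊, fun N hN => ?_⟩
  have hN' : 4 * goldenRatio ^ j + goldenRatio ^ j / η ≤ N := Nat.ceil_le.1 hN
  have hpη : 0 < goldenRatio ^ j / η := by positivity
  obtain ⟨y, hy⟩ : ∃ y, y = N / goldenRatio ^ j := ⟨_, rfl⟩
  have hNy : (N : ℝ) = y * goldenRatio ^ j := by rw [hy]; field_simp
  have hy4 : 4 ≤ y := by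
    rw [hy, le_div_iff₀ hp]; linarith
  have hyη : 1 ≤ y * η := by
    have : 1 / η ≤ y := by
      rw [hy, le_div_iff₀ hp]
      calc 1 / η * goldenRatio ^ j = goldenRatio ^ j / η := by ring
        _ ≤ N := by linarith
    rwa [div_le_iff₀ hη] at this
  have hu : ∀ c, (((Finset.range N).filter fun n => |lowVal j n - c| ≤ 3 * η).card : ℝ) ≤
      40 * (η + 1 / goldenRatio ^ j) * N := by
    intro c
    refine (card_lowVal_near_le j N hj c (3 * η) (by positivity)).trans ?_
    rw [← hy, hNy]
    have e : 40 * (η + 1 / goldenRatio ^ j) * (y * goldenRatio ^ j) =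
        40 * (η * goldenRatio ^ j + 1) * y := by field_simp
    rw [e]
    have : 0 ≤ η * goldenRatio ^ j := by positivity
    nlinarith
  have hw : ∀ c, (((Finset.range N).filter fun n => |highVal j n - c| ≤ 3 * η).card : ℝ) ≤
      3136 * η * N := by
    intro c
    refine (card_highVal_near_le j N hj c (3 * η) (by positivity)).trans ?_
    rw [← hy, hNy]
    have e1 : goldenRatio ^ j + 3 ≤ 4 * goldenRatio ^ j := by linarith
    have e2 : 7 * (4 * (y + 4) * (3 * η) + 2) ≤ 182 * (y * η) := by nlinarith
    calc _ ≤ (4 * goldenRatio ^ j) * (182 * (y * η)) * 4 := by gcongr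
      _ ≤ _ := by
        have : 0 ≤ y * η * goldenRatio ^ j := by positivity
        nlinarith
  have hsub : (Finset.range N).filter (NearBoundary j η) ⊆
      ((Finset.range N).filter fun n => |lowVal j n - 0| ≤ 3 * η) ∪
      ((Finset.range N).filter fun n => |lowVal j n - (-goldenConj)| ≤ 3 * η) ∪
      ((Finset.range N).filter fun n => |lowVal j n - 1| ≤ 3 * η) ∪
      ((Finset.range N).filter fun n => |highVal j n - (-1)| ≤ 3 * η) ∪
      ((Finset.range N).filter fun n => |highVal j n - (-goldenConj)| ≤ 3 * η) ∪
      ((Finset.range N).filter fun n => |highVal j n - goldenRatio| ≤ 3 * η) := by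
    intro n hn
    simp only [Finset.mem_filter, NearBoundary] at hn
    simp only [Finset.mem_union, Finset.mem_filter, sub_zero, sub_neg_eq_add]
    tauto
  have hcard := (Finset.card_le_card hsub).trans (Finset.card_union_le _ _)
  have c4 := Finset.card_union_le
    (((Finset.range N).filter fun n => |lowVal j n - 0| ≤ 3 * η) ∪
      ((Finset.range N).filter fun n => |lowVal j n - (-goldenConj)| ≤ 3 * η) ∪
      ((Finset.range N).filter fun n => |lowVal j n - 1| ≤ 3 * η) ∪
      ((Finset.range N).filter fun n => |highVal j n - (-1)| ≤ 3 * η))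
      ((Finset.range N).filter fun n => |highVal j n - (-goldenConj)| ≤ 3 * η)
  have c3 := Finset.card_union_le
    (((Finset.range N).filter fun n => |lowVal j n - 0| ≤ 3 * η) ∪
      ((Finset.range N).filter fun n => |lowVal j n - (-goldenConj)| ≤ 3 * η) ∪
      ((Finset.range N).filter fun n => |lowVal j n - 1| ≤ 3 * η))
      ((Finset.range N).filter fun n => |highVal j n - (-1)| ≤ 3 * η)
  have c2 := Finset.card_union_le
    (((Finset.range N).filter fun n => |lowVal j n - 0| ≤ 3 * η) ∪
      ((Finset.range N).filter fun n => |lowVal j n - (-goldenConj)| ≤ 3 * η))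
      ((Finset.range N).filter fun n => |lowVal j n - 1| ≤ 3 * η)
  have c1 := Finset.card_union_le
    ((Finset.range N).filter fun n => |lowVal j n - 0| ≤ 3 * η)
      ((Finset.range N).filter fun n => |lowVal j n - (-goldenConj)| ≤ 3 * η)
  have htot := hcard.trans (Nat.add_le_add_right (c4.trans (Nat.add_le_add_right (c3.trans
    (Nat.add_le_add_right (c2.trans (Nat.add_le_add_right c1 _)) _)) _)) _)
  have htot' := (Nat.cast_le (α := ℝ)).2 htot
  push_cast at htot'
  have u1 := hu 0
  have u2 := hu (-goldenConj)
  have u3 := hu 1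
  have w1 := hw (-1)
  have w2 := hw (-goldenConj)
  have w3 := hw goldenRatio
  have hpos : 0 ≤ 1 / goldenRatio ^ j * (N : ℝ) := by positivity
  have hpos2 : 0 ≤ η * (N : ℝ) := by positivity
  linarith

/-! ### Lipschitz detectors for digits. -/

/-- The set of points of the torus coming from integers with prescribed `j`-th digit. -/
def digitSet (j v : ℕ) : Set Torus := {t | ∃ n, digit j n = v ∧ digitPt j n = t}

/-- A Lipschitz function which is `1` on `digitSet j v`. -/
noncomputable def digitBump (K : ℝ) (j v : ℕ) (t : Torus) : ℝ :=
  max (1 - K * Metric.infDist t (digitSet j v)) 0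

/-- A Lipschitz function that detects integers near the boundary. -/
noncomputable def boundaryBump (K : ℝ) (j : ℕ) (t : Torus) : ℝ :=
  max (digitBump K j 0 t + digitBump K j 1 t - 1) 0

theorem digitBump_nonneg (K : ℝ) (j v : ℕ) (t : Torus) : 0 ≤ digitBump K j v t := le_max_right _ _

theorem digitBump_le_one {K : ℝ} (hK : 0 ≤ K) (j v : ℕ) (t : Torus) : digitBump K j v t ≤ 1 := by
  have := mul_nonneg hK (Metric.infDist_nonneg (x := t) (s := digitSet j v))
  exact max_le (by linarith) zero_le_one

theorem digitBump_digitPt (K : ℝ) (j n : ℕ) : digitBump K j (digit j n) (digitPt j n) = 1 := by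
  have h : digitPt j n ∈ digitSet j (digit j n) := ⟨n, rfl, rfl⟩
  rw [digitBump, Metric.infDist_zero_of_mem h]; norm_num

theorem abs_digitBump_sub_le {K : ℝ} (hK : 0 ≤ K) (j v : ℕ) (s t : Torus) :
    |digitBump K j v s - digitBump K j v t| ≤ K * dist s t := by
  refine (abs_max_sub_max_le_abs _ _ _).trans ?_
  have h := (Metric.lipschitz_infDist_pt (digitSet j v)).dist_le_mul t s
  rw [Real.dist_eq, NNReal.coe_one, one_mul, dist_comm] at h
  rw [show 1 - K * Metric.infDist s (digitSet j v) - (1 - K * Metric.infDist t (digitSet j v)) =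
    K * (Metric.infDist t (digitSet j v) - Metric.infDist s (digitSet j v)) by ring, abs_mul,
    abs_of_nonneg hK]
  gcongr

theorem boundaryBump_nonneg (K : ℝ) (j : ℕ) (t : Torus) : 0 ≤ boundaryBump K j t := le_max_right _ _

theorem boundaryBump_le_one {K : ℝ} (hK : 0 ≤ K) (j : ℕ) (t : Torus) : boundaryBump K j t ≤ 1 :=
  max_le (by linarith [digitBump_le_one hK j 0 t, digitBump_le_one hK j 1 t]) zero_le_one

theorem abs_boundaryBump_sub_le {K : ℝ} (hK : 0 ≤ K) (j : ℕ) (s t : Torus) :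
    |boundaryBump K j s - boundaryBump K j t| ≤ 2 * K * dist s t := by
  refine (abs_max_sub_max_le_abs _ _ _).trans ?_
  have h0 := abs_le.1 (abs_digitBump_sub_le hK j 0 s t)
  have h1 := abs_le.1 (abs_digitBump_sub_le hK j 1 s t)
  rw [abs_le]
  constructor <;> linarith [h0.1, h0.2, h1.1, h1.2]

theorem digitSet_nonempty {j v : ℕ} (hj : 2 ≤ j) (hv : v ≤ 1) : (digitSet j v).Nonempty := by
  obtain rfl | rfl : v = 0 ∨ v = 1 := by omega
  · exact ⟨_, 0, digit_eq_zero (K := 1) (by simp) (by omega), rfl⟩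
  · refine ⟨_, Nat.fib j, ?_, rfl⟩
    obtain ⟨k, rfl⟩ : ∃ k, j = k + 1 := ⟨j - 1, by omega⟩
    have := digit_fib_add (K := k) (n := 0) (by omega) (Nat.fib_pos.2 (by omega)) (k + 1)
    simpa using this

/-- A positive value requires an integer with the opposite digit whose point is within 1/K, and then
both integers lie near the boundary. -/
theorem boundaryBump_digitPt_le {K η : ℝ} (hK : 0 < K) {j : ℕ} (hj : 2 ≤ j)
    (hη : η = 1 / K + 4 / goldenRatio ^ j) (hη1 : η ≤ 1 / 10) (n : ℕ) [Decidable (NearBoundary j η n)] :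
    boundaryBump K j (digitPt j n) ≤ if NearBoundary j η n then 1 else 0 := by
  split_ifs with hn
  · exact boundaryBump_le_one hK.le _ _
  · by_contra! hcon
    apply hn
    have h1 := digitBump_digitPt K j n
    have key : ∀ v ≤ 1, 0 < digitBump K j v (digitPt j n) →
        ∃ n', digit j n' = v ∧ dist (digitPt j n) (digitPt j n') ≤ 1 / K := by
      intro v hv h
      rw [digitBump, lt_max_iff, or_iff_left (lt_irrefl _), sub_pos, ← lt_div_iff₀' hK,
        Metric.infDist_lt_iff (digitSet_nonempty hj hv)] at h
      obtain ⟨_, ⟨n', h', rfl⟩, hd⟩ := h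
      exact ⟨n', h', hd.le⟩
    rw [boundaryBump, lt_max_iff, or_iff_left (lt_irrefl _)] at hcon
    have := digit_le_one j n
    obtain h0 | h0 : digit j n = 0 ∨ digit j n = 1 := by omega
    · rw [h0] at h1
      obtain ⟨n', h', hd⟩ := key 1 le_rfl (by linarith)
      rw [dist_comm] at hd
      exact (nearBoundary_of_dist_le hη hη1 h' h0 hd).2
    · rw [h0] at h1
      obtain ⟨n', h', hd⟩ := key 0 zero_le_one (by linarith)
      exact (nearBoundary_of_dist_le hη hη1 h0 h' hd).1

/-- The bump of the correct digit equals 1, so the bump of the wrong digit is all that is left in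
the boundary bump. The error made by a digit bump is therefore itself a Lipschitz function of the
point. -/
theorem digitBump_eq_boundaryBump {K : ℝ} {j v n : ℕ} (hv : v ≤ 1) (h : digit j n ≠ v) :
    digitBump K j v (digitPt j n) = boundaryBump K j (digitPt j n) := by
  have h1 := digitBump_digitPt K j n
  have := digit_le_one j n
  obtain ⟨h0, rfl⟩ | ⟨h0, rfl⟩ : (digit j n = 0 ∧ v = 1) ∨ (digit j n = 1 ∧ v = 0) := by omega
  · rw [h0] at h1
    rw [boundaryBump, h1, add_sub_cancel_left, max_eq_left (digitBump_nonneg _ _ _ _)]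
  · rw [h0] at h1
    rw [boundaryBump, h1, add_sub_cancel_right, max_eq_left (digitBump_nonneg _ _ _ _)]

theorem avg_add (A : Finset ℕ) (f g : ℕ → ℝ) :
    avg A (fun n => f n + g n) = avg A f + avg A g := by
  simp only [avg, Finset.sum_add_distrib, add_div]

/-- The frequencies of digit patterns in two sets of integers are close to each other, if the
exponential sums over the two sets are. -/
theorem abs_avg_digits_sub_le {d : ℕ} (A B : Finset ℕ) (hA : A.Nonempty) (hB : B.Nonempty) (m : ℕ)
    (hm : 1 ≤ m) (K : ℝ) (hK : 0 < K) (ε : ℝ) (j v : Fin d → ℕ) (hj : ∀ i, 2 ≤ j i)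
    (hv : ∀ i, v i ≤ 1) (hη1 : ∀ i, 1 / K + 4 / goldenRatio ^ j i ≤ 1 / 10) (b : ℝ)
    [∀ j η n, Decidable (NearBoundary j η n)]
    (hb : ∀ i, avg B (fun n => if NearBoundary (j i) (1 / K + 4 / goldenRatio ^ j i) n
      then 1 else 0) ≤ b)
    (hε : ∀ u w : Fin d → ℤ, (∀ i, |u i| ≤ (m : ℤ) ^ 2 ∧ |w i| ≤ (m : ℤ) ^ 2) →
      ‖(∑ n ∈ A, expi (n * ∑ i, (u i * (1 / goldenRatio ^ j i) +
          w i * (goldenRatio / goldenRatio ^ j i)))) / A.card -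
        (∑ n ∈ B, expi (n * ∑ i, (u i * (1 / goldenRatio ^ j i) +
          w i * (goldenRatio / goldenRatio ^ j i)))) / B.card‖ ≤ ε) :
    |avg A (fun n => if ∀ i, digit (j i) n = v i then 1 else 0) -
      avg B (fun n => if ∀ i, digit (j i) n = v i then 1 else 0)| ≤
      (d + 1) * (8 * d * (2 * K) / m + ((m : ℝ) ^ 4) ^ d * ε) + 2 * d * b := by
  set T : ℝ := 8 * d * (2 * K) / m + ((m : ℝ) ^ 4) ^ d * ε with hT
  have h1 := abs_avg_sub_avg_le_of_expi A B hA hB m hm (2 * K) ε (by positivity)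
    (fun i => digitBump K (j i) (v i)) (fun i t => digitBump_nonneg _ _ _ _)
    (fun i t => digitBump_le_one hK.le _ _ _)
    (fun i s t => (abs_digitBump_sub_le hK.le _ _ s t).trans (by gcongr; linarith)) _ _ hε
  change |avg A (fun n => ∏ i, digitBump K (j i) (v i) (digitPt (j i) n)) -
    avg B (fun n => ∏ i, digitBump K (j i) (v i) (digitPt (j i) n))| ≤ T at h1
  -- Elements of `A` near the boundary are not counted directly: the average of the boundary bump is
  -- transferred from `B` by the same comparison, with all other factors equal to 1. Its Lipschitz
  -- constant is the reason for using 2K throughout.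
  have h2 : ∀ i, |avg A (fun n => boundaryBump K (j i) (digitPt (j i) n)) -
      avg B (fun n => boundaryBump K (j i) (digitPt (j i) n))| ≤ T := by
    intro i
    have h := abs_avg_sub_avg_le_of_expi A B hA hB m hm (2 * K) ε (by positivity)
      (fun i' => if i' = i then boundaryBump K (j i') else fun _ => 1)
      (fun i' t => by split_ifs; exacts [boundaryBump_nonneg _ _ _, zero_le_one])
      (fun i' t => by split_ifs; exacts [boundaryBump_le_one hK.le _ _, le_rfl])
      (fun i' s t => by
        split_ifs
        · exact abs_boundaryBump_sub_le hK.le _ s t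
        · rw [sub_self, abs_zero]; positivity) _ _ hε
    have e : ∀ n : ℕ, ∏ i', (if i' = i then boundaryBump K (j i') else fun _ => 1)
        (digitPt (j i') n) = boundaryBump K (j i) (digitPt (j i) n) := by
      intro n
      rw [Finset.prod_eq_single i]
      · simp
      · intro b _ hb; simp [hb]
      · simp
    change |avg A (fun n => ∏ i', (if i' = i then boundaryBump K (j i') else fun _ => 1)
        (digitPt (j i') n)) - avg B (fun n => ∏ i', (if i' = i then boundaryBump K (j i') else
        fun _ => 1) (digitPt (j i') n))| ≤ T at h
    simpa only [e] using h
  have h3 : ∀ i, avg B (fun n => boundaryBump K (j i) (digitPt (j i) n)) ≤ b := fun i =>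
    (avg_mono _ fun n _ => boundaryBump_digitPt_le hK (hj i) rfl (hη1 i) n).trans (hb i)
  have lower : ∀ n, (if ∀ i, digit (j i) n = v i then (1 : ℝ) else 0) ≤
      ∏ i, digitBump K (j i) (v i) (digitPt (j i) n) := by
    intro n
    split_ifs with h
    · rw [Finset.prod_eq_one]
      intro i _; rw [← h i]; exact digitBump_digitPt _ _ _
    · exact Finset.prod_nonneg fun i _ => digitBump_nonneg _ _ _ _
  -- If some digit is wrong, its factor is a boundary bump and the other factors are at most 1.
  have upper : ∀ n, ∏ i, digitBump K (j i) (v i) (digitPt (j i) n) ≤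
      (if ∀ i, digit (j i) n = v i then (1 : ℝ) else 0) +
        ∑ i, boundaryBump K (j i) (digitPt (j i) n) := by
    intro n
    split_ifs with h
    · have e1 : ∏ i, digitBump K (j i) (v i) (digitPt (j i) n) ≤ 1 :=
        Finset.prod_le_one (fun i _ => digitBump_nonneg _ _ _ _)
          (fun i _ => digitBump_le_one hK.le _ _ _)
      have e2 : 0 ≤ ∑ i, boundaryBump K (j i) (digitPt (j i) n) :=
        Finset.sum_nonneg fun i _ => boundaryBump_nonneg _ _ _
      linarith
    · push Not at h
      obtain ⟨i, hi⟩ := h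
      rw [zero_add]
      calc _ ≤ digitBump K (j i) (v i) (digitPt (j i) n) := by
            rw [← Finset.mul_prod_erase _ _ (Finset.mem_univ i)]
            refine mul_le_of_le_one_right (digitBump_nonneg _ _ _ _) ?_
            exact Finset.prod_le_one (fun i _ => digitBump_nonneg _ _ _ _)
              (fun i _ => digitBump_le_one hK.le _ _ _)
        _ = boundaryBump K (j i) (digitPt (j i) n) := digitBump_eq_boundaryBump (hv i) hi
        _ ≤ _ := Finset.single_le_sum (f := fun i => boundaryBump K (j i) (digitPt (j i) n))
          (fun i _ => boundaryBump_nonneg _ _ _) (Finset.mem_univ i)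
  have lA := avg_mono (A := A) fun n _ => lower n
  have lB := avg_mono (A := B) fun n _ => lower n
  have uA := avg_mono (A := A) fun n _ => upper n
  have uB := avg_mono (A := B) fun n _ => upper n
  rw [avg_add, avg_sum] at uA uB
  have sB : ∑ i, avg B (fun n => boundaryBump K (j i) (digitPt (j i) n)) ≤ d * b := by
    calc _ ≤ ∑ _i : Fin d, b := Finset.sum_le_sum fun i _ => h3 i
      _ = _ := by simp
  have sA : ∑ i, avg A (fun n => boundaryBump K (j i) (digitPt (j i) n)) ≤ d * (T + b) := by
    calc _ ≤ ∑ _i : Fin d, (T + b) := Finset.sum_le_sum fun i _ => by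
          linarith [h3 i, (abs_le.1 (h2 i)).2]
      _ = _ := by simp [mul_add]
  have hT0 : 0 ≤ T := (abs_nonneg _).trans h1
  have hdT : 0 ≤ (d : ℝ) * T := by positivity
  have hb0 : 0 ≤ (d : ℝ) * b := by
    refine le_trans (Finset.sum_nonneg fun i _ => ?_) sB
    exact div_nonneg (Finset.sum_nonneg fun n _ => boundaryBump_nonneg _ _ _) (Nat.cast_nonneg _)
  rw [abs_le] at h1 ⊢
  constructor <;> linarith [h1.1, h1.2]

theorem one_div_goldenRatio_add : 1 / goldenRatio + 1 / goldenRatio ^ 2 = 1 := by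
  have h := Real.goldenRatio_sq
  have h0 := Real.goldenRatio_pos
  generalize goldenRatio = g at *
  field_simp
  linarith

/-! ### The linear recursion -/

/-- Two sequences driven by the (transposed) transition matrix of the chain, restricted to allowed
values by the weights `α` and `β`. -/
structure IsDriven (α β p q : ℕ → ℝ) : Prop where
  fst : ∀ k, p (k + 1) = α k * (p k / goldenRatio + q k)
  snd : ∀ k, q (k + 1) = β k * (p k / goldenRatio ^ 2)

theorem IsDriven.sub {α β p q p' q' : ℕ → ℝ} (h : IsDriven α β p q) (h' : IsDriven α β p' q')
    (c : ℝ) : IsDriven α β (fun k => p k - c * p' k) (fun k => q k - c * q' k) :=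
  ⟨fun k => by rw [h.fst, h'.fst]; ring, fun k => by rw [h.snd, h'.snd]; ring⟩

theorem IsDriven.shift {α β p q : ℕ → ℝ} (h : IsDriven α β p q) (r : ℕ) :
    IsDriven (fun k => α (k + r)) (fun k => β (k + r)) (fun k => p (k + r)) (fun k => q (k + r)) :=
  ⟨fun k => by rw [← h.fst]; congr 1; ring, fun k => by rw [← h.snd]; congr 1; ring⟩

/-- The transition matrix has eigenvalues 1 and -1/γ²; vectors with entry sum 0 form the second
eigenspace of its transpose. -/
theorem IsDriven.eq_of_unrestricted {α β e f : ℕ → ℝ} (h : IsDriven α β e f) (r : ℕ)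
    (hα : ∀ k < r, α k = 1) (hβ : ∀ k < r, β k = 1) (h0 : e 0 + f 0 = 0) :
    ∀ k ≤ r, e k = (-(1 / goldenRatio ^ 2)) ^ k * e 0 ∧ f k = -e k := by
  have h1 := one_div_goldenRatio_add
  intro k
  induction k with
  | zero => intro _; constructor <;> linarith
  | succ k ih =>
    intro hk
    obtain ⟨e1, e2⟩ := ih (by omega)
    have e3 : e (k + 1) = -(1 / goldenRatio ^ 2) * e k := by
      rw [h.fst, hα k (by omega), e2]
      linear_combination (e k) * h1
    refine ⟨by rw [e3, e1]; ring, ?_⟩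
    rw [h.snd, hβ k (by omega), e3]; ring

/-- A stochastic step followed by weights of modulus at most 1 does not increase the ℓ¹ norm. -/
theorem IsDriven.abs_add_abs_le {α β e f : ℕ → ℝ} (h : IsDriven α β e f)
    (hα : ∀ k, |α k| ≤ 1) (hβ : ∀ k, |β k| ≤ 1) {r k : ℕ} (hk : r ≤ k) :
    |e k| + |f k| ≤ |e r| + |f r| := by
  induction k, hk using Nat.le_induction with
  | base => exact le_rfl
  | succ k hk ih =>
    refine le_trans ?_ ih
    have h1 := one_div_goldenRatio_add
    have hg := Real.goldenRatio_pos
    have e1 : |e (k + 1)| ≤ |e k| * (1 / goldenRatio) + |f k| := by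
      rw [h.fst, abs_mul]
      refine (mul_le_of_le_one_left (abs_nonneg _) (hα k)).trans ?_
      refine (abs_add_le _ _).trans ?_
      rw [abs_div, abs_of_pos hg, mul_one_div]
    have e2 : |f (k + 1)| ≤ |e k| * (1 / goldenRatio ^ 2) := by
      rw [h.snd, abs_mul]
      refine (mul_le_of_le_one_left (abs_nonneg _) (hβ k)).trans ?_
      rw [abs_div, abs_of_pos (by positivity : 0 < goldenRatio ^ 2), mul_one_div]
    calc _ ≤ |e k| * (1 / goldenRatio + 1 / goldenRatio ^ 2) + |f k| := by linarith
      _ = _ := by rw [h1, mul_one]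

theorem IsDriven.add_eq {α β p q : ℕ → ℝ} (h : IsDriven α β p q) (r : ℕ)
    (hα : ∀ k, r ≤ k → α k = 1) (hβ : ∀ k, r ≤ k → β k = 1) {k : ℕ} (hk : r ≤ k) :
    p k + q k = p r + q r := by
  induction k, hk using Nat.le_induction with
  | base => rfl
  | succ k hk ih =>
    rw [h.fst, h.snd, hα k hk, hβ k hk, ← ih]
    linear_combination (p k) * one_div_goldenRatio_add

/-! ### The Markov chain -/

/-- The probability that the chain takes allowed values up to time `k` and the value `t` at time
`k`. -/
noncomputable def chainProb {Ω : Type*} [MeasurableSpace Ω] (P : MeasureTheory.Measure Ω) (Z : ℕ → Ω → Fin 2)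
    (A : ℕ → Fin 2 → Prop) (k : ℕ) (t : Fin 2) : ℝ :=
  P.real {ω | (∀ i ≤ k, A i (Z i ω)) ∧ Z k ω = t}

section Chain

variable {Ω : Type*} [MeasurableSpace Ω] {P : MeasureTheory.Measure Ω}
  [MeasureTheory.IsProbabilityMeasure P] {Z : ℕ → Ω → Fin 2}

theorem measureReal_eq_sum_fin_two {f : Ω → Fin 2} (hf : Measurable f) (S : Set Ω) :
    P.real S = P.real {ω | ω ∈ S ∧ f ω = 0} + P.real {ω | ω ∈ S ∧ f ω = 1} := by
  have h := MeasureTheory.measureReal_inter_add_sdiff (μ := P) (s := S)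
    (hf (measurableSet_singleton 0))
  rw [← h]
  congr 2
  ext ω
  simp only [Set.mem_sdiff, Set.mem_preimage, Set.mem_singleton_iff, Set.mem_ofPred_eq]
  have : ¬f ω = 0 ↔ f ω = 1 := by omega
  rw [this]

/-- Extends the Markov property from a fixed past to sets of allowed values before time k. The
induction on k sums over the two values at time k and returns to a path prescribed one step earlier.
-/
theorem IsMarkovChain.transition_of_forall {init : Fin 2 → ℝ} {T : Matrix (Fin 2) (Fin 2) ℝ}
    (hZ : IsMarkovChain P Z init T) (A : ℕ → Fin 2 → Prop) (K : ℕ) (t : Fin 2) (k : ℕ) (hk : k ≤ K)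
    (s : ℕ → Fin 2) :
    P.real {ω | (∀ i < k, A i (Z i ω)) ∧ (∀ i, k ≤ i → i ≤ K → Z i ω = s i) ∧ Z (K + 1) ω = t} =
      P.real {ω | (∀ i < k, A i (Z i ω)) ∧ ∀ i, k ≤ i → i ≤ K → Z i ω = s i} * T (s K) t := by
  induction k generalizing s with
  | zero =>
    have := hZ.transition K s t
    simpa using this
  | succ k ih =>
    have h2 : ∀ u : Fin 2, ∀ R : Ω → Prop,
        {ω | ω ∈ {ω | (∀ i < k + 1, A i (Z i ω)) ∧ (∀ i, k + 1 ≤ i → i ≤ K → Z i ω = s i) ∧ R ω} ∧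
          Z k ω = u} = {ω | A k u ∧ (∀ i < k, A i (Z i ω)) ∧
          (∀ i, k ≤ i → i ≤ K → Z i ω = Function.update s k u i) ∧ R ω} := by
      intro u R
      ext ω
      simp only [Set.mem_ofPred_eq]
      constructor
      · rintro ⟨⟨h1, h2, h3⟩, h4⟩
        refine ⟨h4 ▸ h1 k (by omega), fun i hi => h1 i (by omega), fun i hi hiK => ?_, h3⟩
        rcases eq_or_lt_of_le hi with rfl | hi
        · rw [Function.update_self, h4]
        · rw [Function.update_of_ne (by omega), h2 i hi hiK]
      · rintro ⟨h1, h2, h3, h4⟩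
        have hk' : Z k ω = u := by rw [h3 k le_rfl (by omega), Function.update_self]
        refine ⟨⟨fun i hi => ?_, fun i hi hiK => ?_, h4⟩, hk'⟩
        · rcases eq_or_lt_of_le (Nat.lt_succ_iff.1 hi) with rfl | hi
          · rwa [hk']
          · exact h2 i hi
        · rw [h3 i (by omega) hiK, Function.update_of_ne (by omega)]
    have h3 : ∀ u : Fin 2, P.real {ω | A k u ∧ (∀ i < k, A i (Z i ω)) ∧
          (∀ i, k ≤ i → i ≤ K → Z i ω = Function.update s k u i) ∧ Z (K + 1) ω = t} =
        P.real {ω | A k u ∧ (∀ i < k, A i (Z i ω)) ∧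
          (∀ i, k ≤ i → i ≤ K → Z i ω = Function.update s k u i) ∧ True} * T (s K) t := by
      intro u
      by_cases hA : A k u
      · have := ih (by omega) (Function.update s k u)
        rw [Function.update_of_ne (by omega)] at this
        simpa only [hA, true_and, and_true] using this
      · simp [hA]
    have e : {ω | (∀ i < k + 1, A i (Z i ω)) ∧ ∀ i, k + 1 ≤ i → i ≤ K → Z i ω = s i} =
        {ω | (∀ i < k + 1, A i (Z i ω)) ∧ (∀ i, k + 1 ≤ i → i ≤ K → Z i ω = s i) ∧ True} := by
      simp only [and_true]
    rw [e, measureReal_eq_sum_fin_two (hZ.measurable k), h2, h2, h3, h3, ← add_mul, ← h2, ← h2,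
      ← measureReal_eq_sum_fin_two (hZ.measurable k)]

theorem IsMarkovChain.chainProb_succ {init : Fin 2 → ℝ} {T : Matrix (Fin 2) (Fin 2) ℝ}
    (hZ : IsMarkovChain P Z init T) (A : ℕ → Fin 2 → Prop) [∀ i t, Decidable (A i t)] (k : ℕ)
    (t : Fin 2) :
    chainProb P Z A (k + 1) t = (if A (k + 1) t then 1 else 0) *
      (chainProb P Z A k 0 * T 0 t + chainProb P Z A k 1 * T 1 t) := by
  have key : ∀ s : Fin 2, P.real {ω | ω ∈ {ω | (∀ i ≤ k, A i (Z i ω)) ∧ Z (k + 1) ω = t} ∧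
      Z k ω = s} = chainProb P Z A k s * T s t := by
    intro s
    have h := hZ.transition_of_forall A k t k le_rfl (fun _ => s)
    by_cases hs : A k s
    · rw [chainProb]
      convert h using 2
      · congr 1
        ext ω
        simp only [Set.mem_ofPred_eq]
        constructor
        · rintro ⟨⟨h1, h2⟩, h3⟩
          exact ⟨fun i hi => h1 i hi.le, fun i hi hi' => by rw [le_antisymm hi' hi, h3], h2⟩
        · rintro ⟨h1, h2, h3⟩
          have h4 := h2 k le_rfl le_rfl
          refine ⟨⟨fun i hi => ?_, h3⟩, h4⟩
          rcases eq_or_lt_of_le hi with rfl | hi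
          · rwa [h4]
          · exact h1 i hi
      · congr 1
        ext ω
        simp only [Set.mem_ofPred_eq]
        constructor
        · rintro ⟨h1, h3⟩
          exact ⟨fun i hi => h1 i hi.le, fun i hi hi' => by rw [le_antisymm hi' hi, h3]⟩
        · rintro ⟨h1, h2⟩
          have h4 := h2 k le_rfl le_rfl
          refine ⟨fun i hi => ?_, h4⟩
          rcases eq_or_lt_of_le hi with rfl | hi
          · rwa [h4]
          · exact h1 i hi
    · rw [chainProb]
      have e1 : {ω | ω ∈ {ω | (∀ i ≤ k, A i (Z i ω)) ∧ Z (k + 1) ω = t} ∧ Z k ω = s} = ∅ := by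
        ext ω
        simp only [Set.mem_ofPred_eq, Set.mem_empty_iff_false, iff_false]
        rintro ⟨⟨h1, -⟩, h2⟩
        exact hs (h2 ▸ h1 k le_rfl)
      have e2 : {ω | (∀ i ≤ k, A i (Z i ω)) ∧ Z k ω = s} = ∅ := by
        ext ω
        simp only [Set.mem_ofPred_eq, Set.mem_empty_iff_false, iff_false]
        rintro ⟨h1, h2⟩
        exact hs (h2 ▸ h1 k le_rfl)
      rw [e1, e2]; simp
  rw [← key, ← key, ← measureReal_eq_sum_fin_two (hZ.measurable k), chainProb]
  split_ifs with hA
  · rw [one_mul]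
    congr 1
    ext ω
    simp only [Set.mem_ofPred_eq]
    constructor
    · exact fun h => ⟨fun i hi => h.1 i (by omega), h.2⟩
    · rintro ⟨h1, h2⟩
      refine ⟨fun i hi => ?_, h2⟩
      rcases eq_or_lt_of_le hi with rfl | hi
      · rwa [h2]
      · exact h1 i (by omega)
  · rw [zero_mul]
    have e1 : {ω | (∀ i ≤ k + 1, A i (Z i ω)) ∧ Z (k + 1) ω = t} = ∅ := by
      ext ω
      simp only [Set.mem_ofPred_eq, Set.mem_empty_iff_false, iff_false]
      rintro ⟨h1, h2⟩
      exact hA (h2 ▸ h1 (k + 1) le_rfl)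
    rw [e1]; simp

theorem IsMarkovChain.isDriven (hZ : IsMarkovChain P Z digitStationary digitTransition)
    (A : ℕ → Fin 2 → Prop) [∀ i t, Decidable (A i t)] :
    IsDriven (fun k => if A (k + 1) 0 then 1 else 0) (fun k => if A (k + 1) 1 then 1 else 0)
      (fun k => chainProb P Z A k 0) (fun k => chainProb P Z A k 1) := by
  constructor <;> intro k <;> rw [hZ.chainProb_succ] <;>
    simp [digitTransition, div_eq_mul_inv]

end Chain

theorem IsMarkovChain.chainProb_zero {Ω : Type*} [MeasurableSpace Ω]
    {P : MeasureTheory.Measure Ω} {Z : ℕ → Ω → Fin 2}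
    (hZ : IsMarkovChain P Z digitStationary digitTransition)
    (A : ℕ → Fin 2 → Prop) (hA : ∀ t, A 0 t) (t : Fin 2) :
    chainProb P Z A 0 t = digitStationary t := by
  rw [← hZ.initial t, chainProb]
  simp [hA]

/-! ### Counting integers with prescribed digits -/

theorem digit_eq_val (j n : ℕ) : digit j n = (zeckendorfDigit j n : ℕ) := by
  unfold digit zeckendorfDigit
  split_ifs <;> rfl

theorem zeckendorfDigit_fib_add {K n : ℕ} (hn : n < Nat.fib K) (i : ℕ) :
    zeckendorfDigit i (Nat.fib (K + 1) + n) = if i = K + 1 then 1 else zeckendorfDigit i n := by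
  have hK : 1 ≤ K := Nat.fib_pos.1 (by omega)
  have h := digit_fib_add hK hn i
  rw [digit_eq_val, digit_eq_val] at h
  split_ifs at h ⊢
  · exact Fin.ext h
  · exact Fin.ext h

theorem zeckendorfDigit_eq_zero {K n : ℕ} (hn : n < Nat.fib K) {i : ℕ} (hi : K ≤ i) :
    zeckendorfDigit i n = 0 := by
  have h := digit_eq_zero hn hi
  rw [digit_eq_val] at h
  exact Fin.ext h

/-- The number of nonnegative integers below `F_K` with allowed digits. -/
def countDigits (A : ℕ → Fin 2 → Prop) [∀ i t, Decidable (A i t)] (K : ℕ) : ℕ :=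
  ((Finset.range (Nat.fib K)).filter fun n => ∀ i < K, A i (zeckendorfDigit i n)).card

theorem countDigits_one (A : ℕ → Fin 2 → Prop) [∀ i t, Decidable (A i t)] (h0 : A 0 0) :
    countDigits A 1 = 1 := by
  have : zeckendorfDigit 0 0 = 0 := by simp [zeckendorfDigit]
  simp [countDigits, this, h0, Finset.filter_singleton]

/-- Integers from F_(K+1) up to F_(K+2) have digit 1 at K + 1 and a remainder below F_K. Their digit
at K is 0, hence the additional factor for `A K 0`. -/
theorem countDigits_add_two (A : ℕ → Fin 2 → Prop) [∀ i t, Decidable (A i t)] (K : ℕ) :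
    countDigits A (K + 2) = (if A (K + 1) 0 then 1 else 0) * countDigits A (K + 1) +
      (if A (K + 1) 1 then 1 else 0) * (if A K 0 then 1 else 0) * countDigits A K := by
  have hsplit : Finset.range (Nat.fib (K + 2)) = Finset.range (Nat.fib (K + 1)) ∪
      (Finset.range (Nat.fib K)).map (addLeftEmbedding (Nat.fib (K + 1))) := by
    rw [Nat.fib_add_two, add_comm, Finset.range_add]
  have hdisj : Disjoint (Finset.range (Nat.fib (K + 1)))
      ((Finset.range (Nat.fib K)).map (addLeftEmbedding (Nat.fib (K + 1)))) :=
    Finset.disjoint_range_addLeftEmbedding _ _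
  rw [countDigits, hsplit, Finset.filter_union,
    Finset.card_union_of_disjoint (Finset.disjoint_filter_filter hdisj), Finset.filter_map,
    Finset.card_map]
  congr 1
  · rw [countDigits]
    split_ifs with h
    · rw [one_mul]
      congr 1
      refine Finset.filter_congr fun n hn => ?_
      rw [Finset.mem_range] at hn
      refine ⟨fun H i hi => H i (by omega), fun H i hi => ?_⟩
      rcases eq_or_lt_of_le (Nat.lt_succ_iff.1 hi) with rfl | hi
      · rwa [zeckendorfDigit_eq_zero hn le_rfl]
      · exact H i hi
    · rw [zero_mul, Finset.card_eq_zero, Finset.filter_eq_empty_iff]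
      intro n hn H
      rw [Finset.mem_range] at hn
      have := H (K + 1) (by omega)
      rw [zeckendorfDigit_eq_zero hn le_rfl] at this
      exact h this
  · rw [countDigits]
    by_cases h : A (K + 1) 1 ∧ A K 0
    · rw [if_pos h.1, if_pos h.2, one_mul, one_mul]
      congr 1
      refine Finset.filter_congr fun n hn => ?_
      rw [Finset.mem_range] at hn
      simp only [Function.comp_apply, addLeftEmbedding_apply, zeckendorfDigit_fib_add hn]
      refine ⟨fun H i hi => ?_, fun H i hi => ?_⟩
      · have := H i (by omega)
        rwa [if_neg (by omega)] at this
      · split_ifs with hi'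
        · rw [hi']; exact h.1
        · rcases eq_or_lt_of_le (show i ≤ K by omega) with rfl | hi
          · rw [zeckendorfDigit_eq_zero hn le_rfl]; exact h.2
          · exact H i hi
    · have e : (if A (K + 1) 1 then 1 else 0) * (if A K 0 then 1 else 0) = 0 := by
        rw [not_and_or] at h
        rcases h with h | h <;> simp [h]
      rw [e, zero_mul, Finset.card_eq_zero, Finset.filter_eq_empty_iff]
      intro n hn H
      rw [Finset.mem_range] at hn
      simp only [Function.comp_apply, addLeftEmbedding_apply, zeckendorfDigit_fib_add hn] at H
      apply h
      have h1 := H (K + 1) (by omega)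
      have h2 := H K (by omega)
      rw [if_pos rfl] at h1
      rw [if_neg (by omega), zeckendorfDigit_eq_zero hn le_rfl] at h2
      exact ⟨h1, h2⟩

/-- Normalized counts of integers below `F_{k+2}` whose digit of index `k + 1` is `0`. -/
noncomputable def countFst (A : ℕ → Fin 2 → Prop) [∀ i t, Decidable (A i t)] (k : ℕ) : ℝ :=
  (if A (k + 1) 0 then 1 else 0) * countDigits A (k + 1) / goldenRatio ^ k

/-- Normalized counts of integers below `F_{k+2}` whose digit of index `k + 1` is `1`. -/
noncomputable def countSnd (A : ℕ → Fin 2 → Prop) [∀ i t, Decidable (A i t)] (k : ℕ) : ℝ :=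
  (if A (k + 1) 1 then 1 else 0) * (if A k 0 then 1 else 0) * countDigits A k /
    goldenRatio ^ (k + 1)

theorem countDigits_eq (A : ℕ → Fin 2 → Prop) [∀ i t, Decidable (A i t)] (k : ℕ) :
    (countDigits A (k + 2) : ℝ) =
      goldenRatio ^ k * (countFst A k + goldenRatio * countSnd A k) := by
  have := Real.goldenRatio_pos
  rw [countDigits_add_two, countFst, countSnd]
  push_cast
  generalize goldenRatio = g at *
  field_simp
  ring

/-- The powers of γ in the two normalizations are chosen so that the Fibonacci-type recursion turns
into that of the chain. -/
theorem isDriven_count (A : ℕ → Fin 2 → Prop) [∀ i t, Decidable (A i t)] :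
    IsDriven (fun k => if A (k + 2) 0 then 1 else 0) (fun k => if A (k + 2) 1 then 1 else 0)
      (countFst A) (countSnd A) := by
  have h0 := Real.goldenRatio_pos
  constructor <;> intro k
  · rw [countFst, countDigits_eq]
    generalize goldenRatio = g at *
    field_simp
    ring
  · rw [countFst, countSnd]
    generalize goldenRatio = g at *
    field_simp
    ring

theorem countFst_zero (A : ℕ → Fin 2 → Prop) [∀ i t, Decidable (A i t)] (h0 : A 0 0) (h1 : A 1 0) :
    countFst A 0 = 1 := by
  simp [countFst, countDigits_one A h0, h1]

theorem countSnd_zero (A : ℕ → Fin 2 → Prop) [∀ i t, Decidable (A i t)] : countSnd A 0 = 0 := by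
  simp [countSnd, countDigits]

theorem countDigits_true (K : ℕ) : countDigits (fun _ _ => True) K = Nat.fib K := by
  simp [countDigits]

/-- The frequency of a digit pattern among the integers below `F_K` is close to the corresponding
probability for the Markov chain. -/
theorem exists_avg_digits_sub_le {Ω : Type*} [MeasurableSpace Ω] {P : MeasureTheory.Measure Ω}
    [MeasureTheory.IsProbabilityMeasure P] {Z : ℕ → Ω → Fin 2}
    (hZ : IsMarkovChain P Z digitStationary digitTransition) {d : ℕ} (j : Fin d → ℕ)
    (v : Fin d → Fin 2) (r : ℕ) (hr : ∀ i, r + 2 ≤ j i) (ε : ℝ) (hε : 0 < ε) :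
    ∃ K₀, ∀ K, K₀ ≤ K →
      |avg (Finset.range (Nat.fib K))
          (fun n => if ∀ i, zeckendorfDigit (j i) n = v i then 1 else 0) -
        P.real {ω | ∀ i, Z (j i) ω = v i}| ≤ 2 * (1 / goldenRatio ^ 2) ^ r + ε := by
  have hφ := Real.goldenRatio_pos
  obtain ⟨hφ1, hφ2⟩ := goldenRatio_bounds
  -- Indices outside the list are unrestricted. Contradictory repetitions leave no allowed value,
  -- which is consistent with an empty pattern.
  set A : ℕ → Fin 2 → Prop := fun k t => ∀ i, j i = k → v i = t with hA
  have hA1 : ∀ k < r + 2, ∀ t, A k t := fun k hk t i hi => by have := hr i; omega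
  set J := ∑ i, j i with hJ
  have hjJ : ∀ i, j i ≤ J := fun i => Finset.single_le_sum (f := j) (fun _ _ => Nat.zero_le _)
    (Finset.mem_univ i)
  have hA2 : ∀ k, J < k → ∀ t, A k t := fun k hk t i hi => by have := hjJ i; omega
  have hAiff : ∀ k, J ≤ k → ∀ z : ℕ → Fin 2, (∀ i ≤ k, A i (z i)) ↔ ∀ i, z (j i) = v i := by
    intro k hk z
    constructor
    · intro h i
      exact (h (j i) ((hjJ i).trans hk) i rfl).symm
    · rintro h _ - i rfl
      exact (h i).symm
  -- comparison of the counts with the chain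
  have hC := isDriven_count A
  -- The k-th counts concern the digit of index k + 1, hence the shift in the time of the chain.
  have hM := (hZ.isDriven A).shift 1
  have hD := hC.sub hM 1
  have hchain : ∀ k t, 0 ≤ chainProb P Z A k t ∧ chainProb P Z A k t ≤ 1 := fun k t =>
    ⟨MeasureTheory.measureReal_nonneg, MeasureTheory.measureReal_le_one⟩
  have hsum0 : chainProb P Z A 1 0 + chainProb P Z A 1 1 = 1 := by
    have h0 := hZ.chainProb_zero A (hA1 0 (by omega))
    have e0 : chainProb P Z A 0 0 + chainProb P Z A 0 1 = 1 := by
      rw [h0, h0]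
      simp only [digitStationary, Matrix.cons_val_zero, Matrix.cons_val_one]
      field_simp
    have h1 := (hZ.isDriven A).fst 0
    have h2 := (hZ.isDriven A).snd 0
    simp only [zero_add, hA1 1 (by omega), if_true, one_mul] at h1 h2
    rw [h1, h2, ← e0]
    linear_combination (chainProb P Z A 0 0) * one_div_goldenRatio_add
  -- Both vectors have total mass 1, so their difference shrinks by γ^(-2r) before the first
  -- restriction; afterwards its ℓ¹ norm cannot grow.
  have hstart := hD.eq_of_unrestricted r (fun k hk => by simp [hA1 (k + 2) (by omega)])
    (fun k hk => by simp [hA1 (k + 2) (by omega)]) (by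
      rw [countFst_zero A (hA1 0 (by omega) 0) (hA1 1 (by omega) 0), countSnd_zero]
      linarith) r le_rfl
  have habs : ∀ k : ℕ, ∀ t, |(if A k t then (1 : ℝ) else 0)| ≤ 1 := by
    intro k t; split_ifs <;> simp
  have hcmp := hD.abs_add_abs_le (fun k => habs _ _) (fun k => habs _ _) (Nat.le_add_left r J)
  rw [hstart.2, abs_neg, hstart.1, abs_mul, abs_pow, abs_neg,
    abs_of_pos (by positivity : 0 < 1 / goldenRatio ^ 2),
    countFst_zero A (hA1 0 (by omega) 0) (hA1 1 (by omega) 0)] at hcmp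
  have he0 : |1 - 1 * chainProb P Z A (0 + 1) 0| ≤ 1 := by
    rw [abs_le]; constructor <;> linarith [hchain (0 + 1) 0]
  have hpr : (0 : ℝ) ≤ (1 / goldenRatio ^ 2) ^ r := by positivity
  have hevent : P.real {ω | ∀ i, Z (j i) ω = v i} =
      chainProb P Z A (J + r + 1) 0 + chainProb P Z A (J + r + 1) 1 := by
    rw [measureReal_eq_sum_fin_two (hZ.measurable (J + r + 1)), chainProb, chainProb]
    simp only [Set.mem_ofPred_eq, hAiff (J + r + 1) (by omega)]
  -- Beyond all prescribed indices the mass is conserved, so g is the limiting density of the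
  -- pattern.
  obtain ⟨g, hg⟩ : ∃ g, g = countFst A (J + r) + countSnd A (J + r) := ⟨_, rfl⟩
  have hgP : |g - P.real {ω | ∀ i, Z (j i) ω = v i}| ≤ 2 * (1 / goldenRatio ^ 2) ^ r := by
    rw [hevent, hg]
    have e : countFst A (J + r) + countSnd A (J + r) -
        (chainProb P Z A (J + r + 1) 0 + chainProb P Z A (J + r + 1) 1) =
        (countFst A (J + r) - 1 * chainProb P Z A (J + r + 1) 0) +
        (countSnd A (J + r) - 1 * chainProb P Z A (J + r + 1) 1) := by ring
    rw [e]
    refine (abs_add_le _ _).trans (hcmp.trans ?_)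
    nlinarith
  -- comparison of the counts with the unrestricted counts
  have hU := isDriven_count (fun _ _ => True)
  have hUsum := hU.add_eq 0 (by simp) (by simp) (Nat.zero_le (J + r))
  rw [countFst_zero _ trivial trivial, countSnd_zero, add_zero] at hUsum
  have hC' := hC.shift (J + r)
  have hU' := hU.shift (J + r)
  have hone : ∀ k t, A (k + (J + r) + 2) t := fun k t => hA2 _ (by omega) t
  simp only [hone, if_true] at hC'
  simp only [if_true] at hU'
  -- Restricted minus g times unrestricted counts has mass 0, hence tends to 0, and the ratio of the
  -- counts tends to g.
  have hE := hC'.sub hU' g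
  have hlim : Filter.Tendsto (fun k => (1 / goldenRatio ^ 2) ^ k *
      |countFst A (0 + (J + r)) - g * countFst (fun _ _ => True) (0 + (J + r))|) Filter.atTop
      (nhds 0) := by
    have : Filter.Tendsto (fun k => (1 / goldenRatio ^ 2) ^ k) Filter.atTop (nhds 0) := by
      refine tendsto_pow_atTop_nhds_zero_of_lt_one (by positivity) ?_
      rw [div_lt_one (by positivity), Real.goldenRatio_sq]; linarith
    simpa using this.mul_const _
  obtain ⟨k₀, hk₀⟩ := Filter.eventually_atTop.1 (hlim.eventually (gt_mem_nhds hε))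
  refine ⟨k₀ + (J + r) + 2, fun K hK => ?_⟩
  obtain ⟨k, rfl⟩ : ∃ k, K = k + (J + r) + 2 := ⟨K - (J + r) - 2, by omega⟩
  have hk := hE.eq_of_unrestricted k (by simp) (by simp) (by
    simp only [zero_add]
    linear_combination -g * hUsum - hg) k le_rfl
  obtain ⟨E, hEdef⟩ : ∃ E, E = countFst A (k + (J + r)) -
    g * countFst (fun _ _ => True) (k + (J + r)) := ⟨_, rfl⟩
  have hEabs : |E| < ε := by
    rw [hEdef, hk.1, abs_mul, abs_pow, abs_neg,
      abs_of_pos (by positivity : 0 < 1 / goldenRatio ^ 2)]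
    exact hk₀ k (by omega)
  have hk2 := hk.2
  rw [← hEdef] at hk2
  have hcount := countDigits_eq A (k + (J + r))
  have hfib := countDigits_eq (fun _ _ => True) (k + (J + r))
  rw [countDigits_true] at hfib
  have hpow : 0 < goldenRatio ^ (k + (J + r)) := by positivity
  have hUsum' := hU.add_eq 0 (by simp) (by simp) (Nat.zero_le (k + (J + r)))
  rw [countFst_zero _ trivial trivial, countSnd_zero, add_zero] at hUsum'
  have hsnd : 0 ≤ countSnd (fun _ _ => True) (k + (J + r)) := by
    rw [countSnd]; positivity
  have hfib1 : goldenRatio ^ (k + (J + r)) ≤ (Nat.fib (k + (J + r) + 2) : ℝ) := by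
    rw [hfib]
    refine le_mul_of_one_le_right hpow.le ?_
    nlinarith
  have hdiff : (countDigits A (k + (J + r) + 2) : ℝ) - g * Nat.fib (k + (J + r) + 2) =
      goldenRatio ^ (k + (J + r)) * ((1 - goldenRatio) * E) := by
    rw [hcount, hfib]
    linear_combination goldenRatio ^ (k + (J + r)) * (goldenRatio * hk2 - hEdef)
  have havg : avg (Finset.range (Nat.fib (k + (J + r) + 2)))
      (fun n => if ∀ i, zeckendorfDigit (j i) n = v i then 1 else 0) =
      countDigits A (k + (J + r) + 2) / Nat.fib (k + (J + r) + 2) := by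
    rw [avg, Finset.card_range, countDigits, Finset.card_filter]
    push_cast
    congr 1
    refine Finset.sum_congr rfl fun n _ => ?_
    have := hAiff (k + (J + r) + 1) (by omega) (fun i => zeckendorfDigit i n)
    simp only [← Nat.lt_succ_iff] at this
    simp only [← this]
  have hfibpos : (0 : ℝ) < Nat.fib (k + (J + r) + 2) := hpow.trans_le hfib1
  have hmain : |avg (Finset.range (Nat.fib (k + (J + r) + 2)))
      (fun n => if ∀ i, zeckendorfDigit (j i) n = v i then 1 else 0) - g| ≤ ε := by
    have e : (countDigits A (k + (J + r) + 2) : ℝ) / Nat.fib (k + (J + r) + 2) - g =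
        (countDigits A (k + (J + r) + 2) - g * Nat.fib (k + (J + r) + 2)) /
          Nat.fib (k + (J + r) + 2) := by
      field_simp
    rw [havg, e, hdiff, abs_div, abs_of_pos hfibpos, div_le_iff₀ hfibpos, abs_mul,
      abs_of_pos hpow, abs_mul, mul_comm ε]
    have : |1 - goldenRatio| ≤ 1 := by rw [abs_le]; constructor <;> linarith
    gcongr
    calc _ ≤ 1 * |E| := by gcongr
      _ ≤ ε := by linarith
  have := abs_sub_le (avg (Finset.range (Nat.fib (k + (J + r) + 2)))
      (fun n => if ∀ i, zeckendorfDigit (j i) n = v i then 1 else 0)) g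
      (P.real {ω | ∀ i, Z (j i) ω = v i})
  linarith

/-! ### Arithmetic in the ring of integers generated by the golden ratio -/

/-- `x` and `y` are conjugate elements of `ℤ[γ]`. -/
def AreConj (x y : ℝ) : Prop := ∃ c e : ℤ, x = c + e * goldenRatio ∧ y = c + e * goldenConj

theorem AreConj.intCast (c : ℤ) : AreConj c c := ⟨c, 0, by simp, by simp⟩

theorem AreConj.add {x y x' y' : ℝ} (h : AreConj x y) (h' : AreConj x' y') :
    AreConj (x + x') (y + y') := by
  obtain ⟨c, e, rfl, rfl⟩ := h
  obtain ⟨c', e', rfl, rfl⟩ := h'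
  exact ⟨c + c', e + e', by push_cast; ring, by push_cast; ring⟩

theorem AreConj.mul {x y x' y' : ℝ} (h : AreConj x y) (h' : AreConj x' y') :
    AreConj (x * x') (y * y') := by
  obtain ⟨c, e, rfl, rfl⟩ := h
  obtain ⟨c', e', rfl, rfl⟩ := h'
  refine ⟨c * c' + e * e', c * e' + e * c' + e * e', ?_, ?_⟩
  · push_cast; linear_combination (e * e' : ℝ) * Real.goldenRatio_sq
  · push_cast; linear_combination (e * e' : ℝ) * Real.goldenConj_sq

theorem AreConj.sum {ι : Type*} (s : Finset ι) {x y : ι → ℝ} (h : ∀ i ∈ s, AreConj (x i) (y i)) :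
    AreConj (∑ i ∈ s, x i) (∑ i ∈ s, y i) := by
  classical
  induction s using Finset.induction_on with
  | empty => exact ⟨0, 0, by simp, by simp⟩
  | insert a s ha ih =>
    rw [Finset.sum_insert ha, Finset.sum_insert ha]
    exact (h a (Finset.mem_insert_self a s)).add
      (ih fun i hi => h i (Finset.mem_insert_of_mem hi))

theorem areConj_goldenRatio : AreConj goldenRatio goldenConj := ⟨0, 1, by simp, by simp⟩

theorem areConj_inv : AreConj goldenRatio⁻¹ goldenConj⁻¹ := by
  refine ⟨-1, 1, ?_, ?_⟩
  · rw [Real.inv_goldenRatio, goldenConj_eq]; push_cast; ring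
  · rw [Real.inv_goldenConj, goldenConj_eq]; push_cast; ring

theorem AreConj.pow {x y : ℝ} (h : AreConj x y) (n : ℕ) : AreConj (x ^ n) (y ^ n) := by
  induction n with
  | zero => simpa using AreConj.intCast 1
  | succ n ih => rw [pow_succ, pow_succ]; exact ih.mul h

/-- The product is the norm c² + ce - e², an integer; it is nonzero because the conjugate vanishes
only if the element does, ψ being irrational. -/
theorem AreConj.one_le_abs_mul {x y : ℝ} (h : AreConj x y) (hx : x ≠ 0) : 1 ≤ |x| * |y| := by
  obtain ⟨c, e, rfl, rfl⟩ := h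
  have h1 : ((c : ℝ) + e * goldenRatio) * (c + e * goldenConj) =
      ((c * c + c * e - e * e : ℤ) : ℝ) := by
    push_cast
    linear_combination (c * e : ℝ) * Real.goldenRatio_add_goldenConj +
      (e * e : ℝ) * Real.goldenRatio_mul_goldenConj
  rw [← abs_mul, h1, ← Int.cast_abs]
  have h2 : c * c + c * e - e * e ≠ 0 := by
    intro h0
    rw [h0, Int.cast_zero, mul_eq_zero, or_iff_right hx] at h1
    rcases eq_or_ne e 0 with rfl | he
    · simp at h1; simp [h1] at hx
    · have h3 := Real.goldenConj_irrational.intCast_mul he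
      refine h3 ⟨-c, ?_⟩
      push_cast; linarith
  exact_mod_cast Int.one_le_abs h2

theorem AreConj.mul_sub_ne_zero {x y : ℝ} (h : AreConj x y) (hx : x ≠ 0) (hx1 : |x| < 1) {q : ℕ}
    (hq : 0 < q) (a : ℤ) : q * x - a ≠ 0 := by
  obtain ⟨c, e, rfl, -⟩ := h
  intro h0
  have hq' : (q : ℝ) ≠ 0 := by positivity
  rcases eq_or_ne e 0 with rfl | he
  · simp only [Int.cast_zero, zero_mul, add_zero, ne_eq, Int.cast_eq_zero] at hx hx1
    rw [← Int.cast_abs] at hx1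
    have : |c| < 1 := by exact_mod_cast hx1
    exact hx (Int.abs_lt_one_iff.1 this)
  · have h3 := (Real.goldenRatio_irrational.intCast_mul he).natCast_mul hq.ne'
    refine h3 ⟨a - q * c, ?_⟩
    push_cast; linarith

/-! ### Exponential sums at frequencies in ℤ[γ]. -/

/-- Exponential sums over primes, for frequencies in `ℤ[γ]`. -/
theorem norm_sum_primesLE_expi_div_le {θ θ' : ℝ} (h : AreConj θ θ') (h0 : θ ≠ 0) (h1 : |θ| < 1)
    {X s : ℕ} (hX : 4 ≤ X) (hs : 0 < s) (hsX : 2 * (s : ℝ) ^ 10 * (|θ'| + 2) ≤ X) :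
    ‖∑ p ∈ Nat.primesLE X, expi (p * θ)‖ / Nat.primeCounting X ≤
      128 * (1 + Real.log X) ^ 5 / √s := by
  have hs' : (0 : ℝ) < s := by exact_mod_cast hs
  have hs1 : (1 : ℝ) ≤ s := by exact_mod_cast hs
  have hX' : (0 : ℝ) < X := by exact_mod_cast (by omega : 0 < X)
  -- Dirichlet's theorem with denominators up to X / s⁶ makes the upper condition q s⁶ ≤ X
  -- automatic.
  set Q := X / s ^ 6 with hQ
  have hQ0 : 0 < Q := by
    apply Nat.div_pos _ (by positivity)
    have e1 : (s : ℝ) ^ 6 ≤ s ^ 10 := pow_le_pow_right₀ hs1 (by norm_num)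
    have e2 : (s : ℝ) ^ 6 ≤ X := by nlinarith [abs_nonneg θ']
    exact_mod_cast e2
  obtain ⟨r, hr1, hr2⟩ := Real.exists_rat_abs_sub_le_and_den_le θ hQ0
  have hq : 0 < r.den := r.den_pos
  have hq' : (0 : ℝ) < r.den := by exact_mod_cast hq
  have hq1 : (1 : ℝ) ≤ r.den := by exact_mod_cast hq
  rw [Rat.cast_def] at hr1
  have hQ1 : (0 : ℝ) < Q + 1 := by positivity
  have happ : |r.den * θ - r.num| ≤ 1 / (Q + 1) := by
    have e : r.den * θ - r.num = r.den * (θ - r.num / r.den) := by field_simp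
    rw [e, abs_mul, abs_of_pos hq']
    calc _ ≤ (r.den : ℝ) * (1 / ((Q + 1) * r.den)) := by gcongr
      _ = _ := by field_simp
  have happ1 : |r.den * θ - r.num| ≤ 1 := by
    refine happ.trans ?_
    rw [div_le_one hQ1]; linarith [(Nat.cast_nonneg Q : (0 : ℝ) ≤ Q)]
  have hconj : AreConj (r.den * θ - r.num) (r.den * θ' - r.num) := by
    have := ((AreConj.intCast r.den).mul h).add (AreConj.intCast (-r.num))
    push_cast at this
    simpa only [sub_eq_add_neg] using this
  have hone := hconj.one_le_abs_mul (h.mul_sub_ne_zero h0 h1 hq r.num)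
  have hnum : |(r.num : ℝ)| ≤ 2 * r.den := by
    have e : (r.num : ℝ) = r.den * θ - (r.den * θ - r.num) := by ring
    rw [e]
    refine (abs_sub _ _).trans ?_
    rw [abs_mul, abs_of_pos hq']
    nlinarith
  have hbound : |r.den * θ' - r.num| ≤ r.den * (|θ'| + 2) := by
    refine (abs_sub _ _).trans ?_
    rw [abs_mul, abs_of_pos hq']
    linarith
  have hQX : (X : ℝ) / s ^ 6 ≤ Q + 1 := by
    have h := Nat.lt_floor_add_one ((X : ℝ) / (s ^ 6 : ℕ))
    rw [Nat.floor_div_eq_div] at h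
    push_cast at h
    exact h.le
  -- The norm bound gives 1 ≤ q(|θ'| + 2)/(Q + 1), so q ≥ (X / s⁶)/(|θ'| + 2), which is at least 2s⁴
  -- by `hsX`.
  have hfinal : 2 * (s : ℝ) ^ 4 ≤ r.den := by
    have e1 : 1 ≤ 1 / (Q + 1) * (r.den * (|θ'| + 2)) :=
      hone.trans (mul_le_mul happ hbound (abs_nonneg _) (by positivity))
    rw [one_div_mul_eq_div, one_le_div hQ1] at e1
    have e2 : 2 * (s : ℝ) ^ 4 * (|θ'| + 2) ≤ r.den * (|θ'| + 2) := by
      refine le_trans ?_ (hQX.trans e1)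
      rw [le_div_iff₀ (by positivity)]
      calc _ = 2 * (s : ℝ) ^ 10 * (|θ'| + 2) := by ring
        _ ≤ X := hsX
    exact le_of_mul_le_mul_right e2 (by positivity)
  have hπ : (0 : ℝ) < Nat.primeCounting X := by
    have : 0 < Nat.primeCounting X := by
      have := Nat.monotone_primeCounting (show 2 ≤ X by omega)
      have h2 : Nat.primeCounting 2 = 1 := by decide
      omega
    exact_mod_cast this
  rw [div_le_iff₀ hπ]
  refine norm_sum_primesLE_expi_le (a := r.num) (q := r.den) hq ?_ ?_ X s hX hs ?_ ?_
  · exact Int.isCoprime_iff_nat_coprime.2 (by simpa using r.reduced)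
  · refine hr1.trans ?_
    have : (r.den : ℝ) ≤ Q := by exact_mod_cast hr2
    rw [sq]
    gcongr
    linarith
  · exact_mod_cast hfinal
  · calc r.den * s ^ 6 ≤ Q * s ^ 6 := Nat.mul_le_mul_right _ hr2
      _ ≤ X := Nat.div_mul_le_self _ _

theorem exists_norm_sum_range_expi_div_le {θ : ℝ} (h : ∀ n : ℤ, θ ≠ n) {ε : ℝ} (hε : 0 < ε) :
    ∃ N₀ : ℕ, ∀ N, N₀ ≤ N → ‖∑ n ∈ Finset.range N, expi (n * θ)‖ / N ≤ ε := by
  have hpos : 0 < nearDist θ := abs_pos.2 (sub_ne_zero.2 (h _))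
  refine ⟨⌈1 / (2 * nearDist θ * ε)⌉₊ + 1, fun N hN => ?_⟩
  have hN0 : (0 : ℝ) < N := by exact_mod_cast (by omega : 0 < N)
  have hN' : 1 / (2 * nearDist θ * ε) ≤ N :=
    (Nat.le_ceil _).trans (by exact_mod_cast (by omega : ⌈1 / (2 * nearDist θ * ε)⌉₊ ≤ N))
  have h1 := norm_sum_expi_mul_le θ 0 N
  rw [← Finset.range_eq_Ico] at h1
  rw [div_le_iff₀ hN0]
  rw [div_le_iff₀ (by positivity)] at hN'
  nlinarith

theorem areConj_frequency {d : ℕ} (j : Fin d → ℕ) (u w : Fin d → ℤ) :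
    AreConj (∑ i, (u i * (1 / goldenRatio ^ j i) + w i * (goldenRatio / goldenRatio ^ j i)))
      (∑ i, (u i * (1 / goldenConj ^ j i) + w i * (goldenConj / goldenConj ^ j i))) := by
  refine AreConj.sum _ fun i _ => ?_
  have h := areConj_inv.pow (j i)
  rw [← one_div, ← one_div, one_div_pow, one_div_pow] at h
  refine ((AreConj.intCast _).mul h).add ((AreConj.intCast _).mul ?_)
  have h2 := areConj_goldenRatio.mul h
  rwa [mul_one_div, mul_one_div] at h2

theorem abs_frequency_le {d : ℕ} (j : Fin d → ℕ) (u w : Fin d → ℤ) {M Y : ℝ} (hY : 0 < Y)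
    (hu : ∀ i, |(u i : ℝ)| ≤ M) (hw : ∀ i, |(w i : ℝ)| ≤ M) (hj : ∀ i, Y ≤ goldenRatio ^ j i) :
    |∑ i, (u i * (1 / goldenRatio ^ j i) + w i * (goldenRatio / goldenRatio ^ j i))| ≤
      3 * d * M / Y := by
  obtain ⟨h1, h2⟩ := goldenRatio_bounds
  refine (Finset.abs_sum_le_sum_abs _ _).trans ?_
  calc _ ≤ ∑ _i : Fin d, 3 * M / Y := by
        refine Finset.sum_le_sum fun i _ => ?_
        have hp : 0 < goldenRatio ^ j i := hY.trans_le (hj i)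
        have hM : 0 ≤ M := (abs_nonneg _).trans (hu i)
        refine (abs_add_le _ _).trans ?_
        rw [abs_mul, abs_mul, abs_of_pos (by positivity : 0 < 1 / goldenRatio ^ j i),
          abs_of_pos (div_pos Real.goldenRatio_pos hp)]
        calc _ ≤ M * (1 / goldenRatio ^ j i) + M * (2 / goldenRatio ^ j i) := by
              gcongr
              · exact hu i
              · exact hw i
              · linarith
          _ = 3 * M / goldenRatio ^ j i := by ring
          _ ≤ _ := by gcongr; exact hj i
    _ = _ := by simp; ring

/-- Conjugation turns γ^(-j) into ψ^(-j), of absolute value γ^j. Here the upper bound for the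
indices is needed. -/
theorem abs_conj_frequency_le {d : ℕ} (j : Fin d → ℕ) (u w : Fin d → ℤ) {M B : ℝ}
    (hu : ∀ i, |(u i : ℝ)| ≤ M) (hw : ∀ i, |(w i : ℝ)| ≤ M) (hj : ∀ i, goldenRatio ^ j i ≤ B) :
    |∑ i, (u i * (1 / goldenConj ^ j i) + w i * (goldenConj / goldenConj ^ j i))| ≤
      2 * d * M * B := by
  obtain ⟨h1, h2⟩ := goldenRatio_bounds
  have hψ : |goldenConj| ≤ 1 := by
    rw [goldenConj_eq, abs_le]; constructor <;> linarith
  refine (Finset.abs_sum_le_sum_abs _ _).trans ?_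
  calc _ ≤ ∑ _i : Fin d, 2 * M * B := by
        refine Finset.sum_le_sum fun i _ => ?_
        have hp : 0 < goldenRatio ^ j i := pow_pos Real.goldenRatio_pos _
        have hM : 0 ≤ M := (abs_nonneg _).trans (hu i)
        have e : |1 / goldenConj ^ j i| = goldenRatio ^ j i := by
          rw [abs_div, abs_one, abs_pow, one_div, ← inv_pow, abs_of_neg Real.goldenConj_neg,
            ← Real.inv_goldenRatio, inv_inv]
        refine (abs_add_le _ _).trans ?_
        rw [← mul_one_div goldenConj, abs_mul, abs_mul, abs_mul, e]
        calc _ ≤ M * goldenRatio ^ j i + M * (1 * goldenRatio ^ j i) := by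
              gcongr
              · exact hu i
              · exact hw i
          _ = 2 * M * goldenRatio ^ j i := by ring
          _ ≤ _ := by gcongr; exact hj i
    _ = _ := by simp; ring

theorem card_primesLE (X : ℕ) : (Nat.primesLE X).card = Nat.primeCounting X :=
  Nat.primesLE_card_eq_primeCounting X

theorem tendsto_fib_atTop : Filter.Tendsto Nat.fib Filter.atTop Filter.atTop :=
  Filter.tendsto_atTop_mono (fun n => Nat.sub_le_of_le_add (Nat.le_fib_add_one n))
    (Filter.tendsto_sub_atTop_nat 1)

/-- The frequency of a digit pattern among the primes up to `X`, with explicit parameters. -/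
theorem abs_avg_primes_sub_le {Ω : Type*} [MeasurableSpace Ω] {P : MeasureTheory.Measure Ω}
    [MeasureTheory.IsProbabilityMeasure P] {Z : ℕ → Ω → Fin 2}
    (hZ : IsMarkovChain P Z digitStationary digitTransition) {d : ℕ} (hd : 0 < d) (j : Fin d → ℕ)
    (v : Fin d → Fin 2) {X s m : ℕ} (hX : 4 ≤ X) (hs : 0 < s) (hm : 1 ≤ m) {K Y B : ℝ}
    (hK : 0 < K) (hY : 0 < Y) (hj : ∀ i, 2 ≤ j i) (hYj : ∀ i, Y ≤ goldenRatio ^ j i)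
    (hB : ∀ i, goldenRatio ^ j i ≤ B) (h1 : 3 * d * (m : ℝ) ^ 2 / Y < 1)
    (h2 : 2 * (s : ℝ) ^ 10 * (2 * d * (m : ℝ) ^ 2 * B + 2) ≤ X) (hη : 1 / K + 4 / Y ≤ 1 / 10) :
    |avg (Nat.primesLE X) (fun n => if ∀ i, zeckendorfDigit (j i) n = v i then 1 else 0) -
      P.real {ω | ∀ i, Z (j i) ω = v i}| ≤
      (d + 1) * (16 * d * K / m + ((m : ℝ) ^ 4) ^ d * (256 * (1 + Real.log X) ^ 5 / √s)) +
        20000 * d * (1 / K + 5 / Y) + 9 / Y := by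
  classical
  obtain ⟨hφ1, hφ2⟩ := goldenRatio_bounds
  have hs' : (0 : ℝ) < s := by exact_mod_cast hs
  obtain ⟨ε, hεdef⟩ : ∃ ε, ε = 128 * (1 + Real.log X) ^ 5 / √s := ⟨_, rfl⟩
  have hε : 0 < ε := by
    have : 0 ≤ Real.log X := Real.log_natCast_nonneg X
    rw [hεdef]; positivity
  -- the smallest index
  have : Nonempty (Fin d) := ⟨⟨0, hd⟩⟩
  obtain ⟨i₀, hi₀⟩ := Finite.exists_min j
  obtain ⟨r, hr⟩ : ∃ r, j i₀ = r + 2 := ⟨j i₀ - 2, by have := hj i₀; omega⟩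
  have hrY : (1 / goldenRatio ^ 2) ^ r ≤ 3 / Y := by
    have e0 : Y ≤ goldenRatio ^ r * 3 := by
      refine (hYj i₀).trans ?_
      rw [hr, pow_add, Real.goldenRatio_sq]
      gcongr; linarith
    have e1 : goldenRatio ^ r ≤ (goldenRatio ^ 2) ^ r := by
      rw [← pow_mul]
      exact pow_le_pow_right₀ (by linarith) (by omega)
    rw [one_div_pow, div_le_div_iff₀ (by positivity) hY]
    linarith
  -- a large set of integers
  set I : Set (Fin d → ℤ) := Set.Icc (fun _ => -(m : ℤ) ^ 2) (fun _ => (m : ℤ) ^ 2) with hI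
  have hIfin : I.Finite := Set.finite_Icc _ _
  have hθ : ∀ u w : Fin d → ℤ, (∀ i, |u i| ≤ (m : ℤ) ^ 2 ∧ |w i| ≤ (m : ℤ) ^ 2) →
      |∑ i, (u i * (1 / goldenRatio ^ j i) + w i * (goldenRatio / goldenRatio ^ j i))| < 1 ∧
      |∑ i, (u i * (1 / goldenConj ^ j i) + w i * (goldenConj / goldenConj ^ j i))| ≤
        2 * d * (m : ℝ) ^ 2 * B := by
    intro u w huw
    have hu : ∀ i, |(u i : ℝ)| ≤ (m : ℝ) ^ 2 := fun i => by exact_mod_cast (huw i).1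
    have hw : ∀ i, |(w i : ℝ)| ≤ (m : ℝ) ^ 2 := fun i => by exact_mod_cast (huw i).2
    exact ⟨(abs_frequency_le j u w hY hu hw hYj).trans_lt h1, abs_conj_frequency_le j u w hu hw hB⟩
  -- Only finitely many frequencies occur, so one large N serves all of them without any uniform
  -- estimate.
  have ev1 : ∀ᶠ N : ℕ in Filter.atTop, ∀ u ∈ I, ∀ w ∈ I,
      ∑ i, (u i * (1 / goldenRatio ^ j i) + w i * (goldenRatio / goldenRatio ^ j i)) ≠ 0 →
      ‖∑ n ∈ Finset.range N, expi (n * ∑ i, (u i * (1 / goldenRatio ^ j i) +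
        w i * (goldenRatio / goldenRatio ^ j i)))‖ / N ≤ ε := by
    rw [Filter.eventually_all_finite hIfin]
    intro u hu
    rw [Filter.eventually_all_finite hIfin]
    intro w hw
    by_cases h0 : ∑ i, (u i * (1 / goldenRatio ^ j i) + w i * (goldenRatio / goldenRatio ^ j i)) = 0
    · exact Filter.Eventually.of_forall fun N h => absurd h0 h
    · have hlt := (hθ u w fun i => ⟨abs_le.2 ⟨hu.1 i, hu.2 i⟩, abs_le.2 ⟨hw.1 i, hw.2 i⟩⟩).1
      obtain ⟨N₀, hN₀⟩ := exists_norm_sum_range_expi_div_le (θ := ∑ i, (u i *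
        (1 / goldenRatio ^ j i) + w i * (goldenRatio / goldenRatio ^ j i))) (fun n hn => by
          rw [hn, ← Int.cast_abs] at hlt
          have : |n| < 1 := by exact_mod_cast hlt
          rw [Int.abs_lt_one_iff.1 this] at hn
          exact h0 (by simpa using hn)) hε
      exact Filter.eventually_atTop.2 ⟨N₀, fun N hN _ => hN₀ N hN⟩
  have hη' : ∀ i, 1 / K + 4 / goldenRatio ^ j i ≤ 1 / K + 4 / Y := fun i => by
    gcongr; exact hYj i
  have ev2 : ∀ᶠ N : ℕ in Filter.atTop, ∀ i,
      avg (Finset.range N) (fun n => if NearBoundary (j i) (1 / K + 4 / goldenRatio ^ j i) n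
        then 1 else 0) ≤ 10000 * (1 / K + 5 / Y) := by
    rw [Filter.eventually_all]
    intro i
    have hp : 0 < goldenRatio ^ j i := hY.trans_le (hYj i)
    obtain ⟨N₀, hN₀⟩ := exists_card_nearBoundary_le (j i) (by have := hj i; omega)
      (1 / K + 4 / goldenRatio ^ j i) (by positivity)
    refine Filter.eventually_atTop.2 ⟨N₀ + 1, fun N hN => ?_⟩
    have hN0 : (0 : ℝ) < N := by exact_mod_cast (by omega : 0 < N)
    rw [avg, Finset.card_range, div_le_iff₀ hN0, Finset.sum_boole]
    refine (le_of_eq ?_).trans ((hN₀ N (by omega)).trans ?_)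
    · congr!
    · have : 1 / goldenRatio ^ j i ≤ 1 / Y := one_div_le_one_div_of_le hY (hYj i)
      have h5 : 5 / Y = 4 / Y + 1 / Y := by ring
      have := hη' i
      refine mul_le_mul_of_nonneg_right (mul_le_mul_of_nonneg_left ?_ (by norm_num)) hN0.le
      linarith
  obtain ⟨K₀, hK₀⟩ := exists_avg_digits_sub_le hZ j v r (fun i => hr ▸ hi₀ i) (3 / Y)
    (by positivity)
  -- The comparison set consists of the integers below one Fibonacci number F_R that meets all the
  -- requirements.
  obtain ⟨R, ⟨⟨hR1, hR2⟩, hR3⟩, hR4⟩ := (((tendsto_fib_atTop.eventually ev1).and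
    (tendsto_fib_atTop.eventually ev2)).and (Filter.eventually_ge_atTop K₀)).and
    (Filter.eventually_ge_atTop 1) |>.exists
  have hchain := hK₀ R hR3
  have hR0 : 0 < Nat.fib R := Nat.fib_pos.2 hR4
  have hπ : 0 < Nat.primeCounting X := by
    have := Nat.monotone_primeCounting (show 2 ≤ X by omega)
    have h2 : Nat.primeCounting 2 = 1 := by decide
    omega
  have hmain := abs_avg_digits_sub_le (Nat.primesLE X) (Finset.range (Nat.fib R))
    (by rwa [← Finset.card_pos, card_primesLE]) (by rwa [Finset.nonempty_range_iff, ← Nat.pos_iff_ne_zero])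
    m hm K hK (2 * ε) j (fun i => (v i : ℕ)) hj (fun i => by have := (v i).isLt; omega)
    (fun i => (hη' i).trans hη) (10000 * (1 / K + 5 / Y)) hR2 (by
      intro u w huw
      obtain ⟨hlt, hle⟩ := hθ u w huw
      rw [card_primesLE, Finset.card_range]
      by_cases h0 : ∑ i, (u i * (1 / goldenRatio ^ j i) +
          w i * (goldenRatio / goldenRatio ^ j i)) = 0
      -- A vanishing frequency contributes 1 to both normalized sums; these common main terms
      -- cancel.
      · have hR0' : (Nat.fib R : ℂ) ≠ 0 := by exact_mod_cast hR0.ne'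
        have hπ' : (Nat.primeCounting X : ℂ) ≠ 0 := by exact_mod_cast hπ.ne'
        simp only [h0, mul_zero, expi_zero, Finset.sum_const, card_primesLE, Finset.card_range,
          nsmul_eq_mul, mul_one, div_self hR0', div_self hπ', sub_self, norm_zero]
        positivity
      · refine (norm_sub_le _ _).trans ?_
        rw [norm_div, norm_div, Complex.norm_natCast, Complex.norm_natCast]
        have e1 := norm_sum_primesLE_expi_div_le (areConj_frequency j u w) h0 hlt hX hs (by
          refine le_trans ?_ h2
          gcongr)
        have e2 := hR1 u ⟨fun i => (abs_le.1 (huw i).1).1, fun i => (abs_le.1 (huw i).1).2⟩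
          w ⟨fun i => (abs_le.1 (huw i).2).1, fun i => (abs_le.1 (huw i).2).2⟩ h0
        rw [← hεdef] at e1
        linarith)
  simp only [digit_eq_val, Fin.val_inj] at hmain
  have e1 := abs_sub_le
    (avg (Nat.primesLE X) (fun n => if ∀ i, zeckendorfDigit (j i) n = v i then 1 else 0))
    (avg (Finset.range (Nat.fib R)) (fun n => if ∀ i, zeckendorfDigit (j i) n = v i then 1 else 0))
    (P.real {ω | ∀ i, Z (j i) ω = v i})
  have e2 : 256 * (1 + Real.log X) ^ 5 / √s = 2 * ε := by rw [hεdef]; ring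
  have e3 : 8 * (d : ℝ) * (2 * K) / m = 16 * d * K / m := by ring
  rw [e3] at hmain
  rw [e2]
  have e4 : 9 / Y = 2 * (3 / Y) + 3 / Y := by ring
  rw [e4]
  linarith

/-! ### The length of the Zeckendorf expansion -/

theorem zeckendorfLength_eq {n : ℕ} (hn : 0 < n) : zeckendorfLength n = Nat.greatestFib n := by
  rw [zeckendorfLength, Nat.zeckendorf_of_pos hn]; rfl

theorem lt_fib_maxZeckendorfLength_add_one {x : ℝ} (hx : 2 ≤ x) :
    ⌊x⌋₊ < Nat.fib (maxZeckendorfLength x + 1) := by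
  have h0 : 0 < ⌊x⌋₊ := Nat.floor_pos.2 (by linarith)
  have h1 : zeckendorfLength ⌊x⌋₊ ≤ maxZeckendorfLength x :=
    Finset.le_sup (f := zeckendorfLength) (Finset.mem_range.2 (Nat.lt_succ_self _))
  rw [zeckendorfLength_eq h0] at h1
  exact (Nat.lt_fib_greatestFib_add_one _).trans_le (Nat.fib_mono (by omega))

theorem fib_maxZeckendorfLength_le (x : ℝ) : Nat.fib (maxZeckendorfLength x) ≤ ⌊x⌋₊ := by
  obtain ⟨n, hn, h⟩ := Finset.exists_mem_eq_sup (Finset.range (⌊x⌋₊ + 1)) (by simp) zeckendorfLength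
  rw [maxZeckendorfLength, h]
  rw [Finset.mem_range] at hn
  rcases Nat.eq_zero_or_pos n with rfl | h0
  · simp [zeckendorfLength]
  · rw [zeckendorfLength_eq h0]
    exact (Nat.fib_greatestFib_le n).trans (by omega)

theorem goldenRatio_pow_le_fib (n : ℕ) : goldenRatio ^ n ≤ Nat.fib (n + 2) := by
  induction n using Nat.strong_induction_on with
  | _ n ih =>
    match n with
    | 0 => simp
    | 1 =>
      have := goldenRatio_bounds.2
      norm_num [Nat.fib_add_two]; linarith
    | n + 2 =>
      have h1 := ih n (by omega)
      have h2 := ih (n + 1) (by omega)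
      rw [Nat.fib_add_two, pow_add, Real.goldenRatio_sq]
      push_cast
      calc _ = goldenRatio ^ n + goldenRatio ^ (n + 1) := by ring
        _ ≤ _ := add_le_add h1 h2

theorem fib_succ_le_two_pow (n : ℕ) : Nat.fib (n + 1) ≤ 2 ^ n := by
  induction n with
  | zero => simp
  | succ n ih =>
    have : Nat.fib n ≤ Nat.fib (n + 1) := Nat.fib_mono (by omega)
    rw [Nat.fib_add_two, pow_succ]; omega

/-- Equivalent to e² ≤ γ⁵; any positive lower bound for log γ would do, and 2/5 is a convenient one.
-/
theorem exp_le_goldenRatio : Real.exp (2 / 5) ≤ goldenRatio := by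
  have h1 := goldenRatio_bounds.1
  have h2 : Real.exp (2 / 5) ^ 5 < goldenRatio ^ 5 := by
    rw [← Real.exp_nat_mul]
    have e : ((5 : ℕ) : ℝ) * (2 / 5) = 1 + 1 := by norm_num
    rw [e, Real.exp_add]
    have e1 := Real.exp_one_lt_d9
    calc Real.exp 1 * Real.exp 1 ≤ 2.72 * 2.72 := by
          have := Real.exp_pos 1
          gcongr <;> linarith
      _ < 1.618 ^ 5 := by norm_num
      _ ≤ _ := by gcongr
  exact (lt_of_pow_lt_pow_left₀ 5 Real.goldenRatio_pos.le h2).le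

theorem exp_le_goldenRatio_pow {N : ℝ} {j : ℕ} (h : N ≤ j) :
    Real.exp (2 / 5 * N) ≤ goldenRatio ^ j := by
  calc Real.exp (2 / 5 * N) ≤ Real.exp (j * (2 / 5)) := Real.exp_le_exp.2 (by linarith)
    _ = Real.exp (2 / 5) ^ j := Real.exp_nat_mul _ _
    _ ≤ _ := pow_le_pow_left₀ (Real.exp_pos _).le exp_le_goldenRatio j

/-! ### The choice of the parameters -/

/-- Collects what must hold for large L. The last comparison of powers rests on κ + ρ < 2ν/3 < ν,
and 2300 = 23 · 100 is the constant required by the choice of parameters. -/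
theorem exists_large_length {κ ρ ν : ℝ} (hκ : 0 < κ) (hκρ : κ < ρ) (hρν : ρ < ν / 3) :
    ∃ L₀ : ℕ, ∀ L : ℕ, L₀ ≤ L → 10 ≤ (L : ℝ) ∧ 3 ≤ (L : ℝ) ^ ρ ∧
      (1 + (L : ℝ)) ^ 5 ≤ Real.exp ((L : ℝ) ^ (κ + ρ)) ∧
      2300 * (L : ℝ) ^ (κ + ρ) ≤ (L : ℝ) ^ ν := by
  have h1 : ∀ᶠ t : ℝ in Filter.atTop, 10 ≤ t := Filter.eventually_ge_atTop 10
  have h2 : ∀ᶠ t : ℝ in Filter.atTop, 3 ≤ t ^ ρ :=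
    (tendsto_rpow_atTop (by linarith)).eventually_ge_atTop 3
  have h3 : ∀ᶠ t : ℝ in Filter.atTop, ‖Real.log t‖ ≤ 1 / 10 * ‖t ^ (κ + ρ)‖ :=
    (isLittleO_log_rpow_atTop (by linarith)).def (by norm_num)
  have h4 : ∀ᶠ t : ℝ in Filter.atTop, 2300 ≤ t ^ (ν - (κ + ρ)) :=
    (tendsto_rpow_atTop (by linarith)).eventually_ge_atTop 2300
  obtain ⟨L₀, hL₀⟩ := Filter.eventually_atTop.1
    (tendsto_natCast_atTop_atTop.eventually (((h1.and h2).and h3).and h4))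
  refine ⟨L₀, fun L hL => ?_⟩
  obtain ⟨⟨⟨e1, e2⟩, e3⟩, e4⟩ := hL₀ L hL
  have hpos : (0 : ℝ) < L := by linarith
  refine ⟨e1, e2, ?_, ?_⟩
  · have hy : (0 : ℝ) < (L : ℝ) ^ (κ + ρ) := Real.rpow_pos_of_pos hpos _
    rw [Real.norm_of_nonneg (Real.log_nonneg (by linarith)), Real.norm_of_nonneg hy.le] at e3
    calc (1 + (L : ℝ)) ^ 5 ≤ ((L : ℝ) ^ 2) ^ 5 := by gcongr; nlinarith
      _ = Real.exp (Real.log L) ^ 10 := by rw [Real.exp_log hpos]; ring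
      _ = Real.exp (10 * Real.log L) := by rw [← Real.exp_nat_mul]; norm_num
      _ ≤ _ := Real.exp_le_exp.2 (by linarith)
  · calc _ ≤ (L : ℝ) ^ (ν - (κ + ρ)) * (L : ℝ) ^ (κ + ρ) := by gcongr
      _ = _ := by rw [← Real.rpow_add hpos]; congr 1; ring

set_option maxHeartbeats 1000000 in
/-- The values of the parameters for the prime counting problem. -/
theorem exists_parameters {d X : ℕ} {R y N : ℝ} (hd : 1 ≤ d) (hdR : d ≤ R) (hdy : d * R ≤ y)
    (hR : 3 ≤ R) (hyN : 2300 * y ≤ N) (hX : 0 < X) (hlog : (1 + Real.log X) ^ 5 ≤ Real.exp y)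
    (hYX : Real.exp (2 / 5 * N) ≤ 3 * X / Real.exp (2 / 5 * N)) :
    ∃ (s m : ℕ) (K : ℝ), 0 < s ∧ 1 ≤ m ∧ 0 < K ∧
      3 * d * (m : ℝ) ^ 2 / Real.exp (2 / 5 * N) < 1 ∧
      2 * (s : ℝ) ^ 10 * (2 * d * (m : ℝ) ^ 2 * (3 * X / Real.exp (2 / 5 * N)) + 2) ≤ X ∧
      1 / K + 4 / Real.exp (2 / 5 * N) ≤ 1 / 10 ∧
      (d + 1) * (16 * d * K / m + ((m : ℝ) ^ 4) ^ d * (256 * (1 + Real.log X) ^ 5 / √s)) +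
        20000 * d * (1 / K + 5 / Real.exp (2 / 5 * N)) + 9 / Real.exp (2 / 5 * N) ≤
        130000 * Real.exp (-R) := by
  have hd1 : (1 : ℝ) ≤ d := by exact_mod_cast hd
  have hRy : R ≤ y := by nlinarith
  have hRN : 2300 * R ≤ N := by linarith
  obtain ⟨Y, hY⟩ : ∃ Y, Y = Real.exp (2 / 5 * N) := ⟨_, rfl⟩
  rw [← hY] at hYX ⊢
  have hY0 : 0 < Y := hY ▸ Real.exp_pos _
  have hX0 : (0 : ℝ) < X := by exact_mod_cast hX
  obtain ⟨E, hE⟩ : ∃ E, E = Real.exp R := ⟨_, rfl⟩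
  have hER : R + 1 ≤ E := hE ▸ Real.add_one_le_exp R
  have hE4 : 4 ≤ E := by linarith
  have hE0 : 0 < E := by linarith
  have hE1 : 1 ≤ E := by linarith
  have hEpow : ∀ k : ℕ, E ^ k = Real.exp (k * R) := fun k => by rw [hE, Real.exp_nat_mul]
  have hdE : (d : ℝ) ≤ E := by linarith
  have hR2 : R ^ 2 ≤ 2 * E := by
    have := Real.quadratic_le_exp_of_nonneg (show 0 ≤ R by linarith)
    rw [hE]; linarith
  -- With E = exp R and K = E², the boundary error d / K and the Fejér error d²K / m are both O(1 /
  -- E), because d ≤ E and d² ≤ R² ≤ 2E.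
  set m := ⌈E ^ 4⌉₊ with hm
  have hm1 : E ^ 4 ≤ m := Nat.le_ceil _
  have hm2 : (m : ℝ) ≤ E ^ 5 := by
    have h1 := (Nat.ceil_lt_add_one (show 0 ≤ E ^ 4 by positivity)).le
    have h2 : 1 ≤ E ^ 4 := one_le_pow₀ hE1
    calc (m : ℝ) ≤ E ^ 4 + 1 := h1
      _ ≤ E ^ 4 * E := by nlinarith
      _ = E ^ 5 := by ring
  have hm0 : (0 : ℝ) < m := lt_of_lt_of_le (by positivity) hm1
  obtain ⟨V, hV⟩ : ∃ V, V = Real.exp (N / 50) := ⟨_, rfl⟩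
  have hVpow : ∀ k : ℕ, V ^ k = Real.exp (k * (N / 50)) := fun k => by rw [hV, Real.exp_nat_mul]
  have hV1 : 1 ≤ V := by rw [hV]; exact Real.one_le_exp (by linarith)
  -- V = exp(N / 50) gives Y = V²⁰, so s¹⁰ costs only half of the room X / Y in the bound for the
  -- conjugate frequency, and d m² fits into the other half.
  set s := ⌊V⌋₊ with hs
  have hs1 : (s : ℝ) ≤ V := Nat.floor_le (by linarith)
  have hs0 : 0 < s := Nat.floor_pos.2 hV1
  have hs0' : (1 : ℝ) ≤ s := by exact_mod_cast hs0
  have hs2 : V ≤ 2 * s := by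
    have := Nat.lt_floor_add_one V
    linarith
  have hYE : E ^ 14 ≤ V ^ 10 := by
    rw [hEpow, hVpow]; exact Real.exp_le_exp.2 (by push_cast; linarith)
  have hYV : Y = V ^ 20 := by
    rw [hVpow, hY]; congr 1; push_cast; ring
  have hV10 : 0 < V ^ 10 := by positivity
  have hm2sq : (m : ℝ) ^ 2 ≤ E ^ 10 := by
    calc (m : ℝ) ^ 2 ≤ (E ^ 5) ^ 2 := by gcongr
      _ = E ^ 10 := by ring
  have h24 : 24 * (d * (m : ℝ) ^ 2) ≤ V ^ 10 := by
    have e1 : (24 : ℝ) ≤ E ^ 3 := by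
      calc (24 : ℝ) ≤ 4 ^ 3 := by norm_num
        _ ≤ E ^ 3 := by gcongr
    calc 24 * (d * (m : ℝ) ^ 2) ≤ E ^ 3 * (E * E ^ 10) := by gcongr
      _ = E ^ 14 := by ring
      _ ≤ _ := hYE
  have hE14 : (256 : ℝ) ≤ V ^ 10 := by
    refine le_trans ?_ hYE
    calc (256 : ℝ) ≤ 4 ^ 14 := by norm_num
      _ ≤ E ^ 14 := by gcongr
  have hV20 : V ^ 20 = V ^ 10 * V ^ 10 := by ring
  have hVY : V ^ 10 ≤ Y := by rw [hYV]; exact pow_le_pow_right₀ hV1 (by norm_num)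
  have hYbig : E ^ 2 ≤ Y ∧ 256 ≤ Y :=
    ⟨((pow_le_pow_right₀ hE1 (by norm_num)).trans hYE).trans hVY, hE14.trans hVY⟩
  refine ⟨s, m, E ^ 2, hs0, Nat.ceil_pos.2 (by positivity), by positivity, ?_, ?_, ?_, ?_⟩
  · rw [div_lt_one hY0, mul_assoc]
    linarith
  · have hs10 : (s : ℝ) ^ 10 ≤ V ^ 10 := by gcongr
    rw [le_div_iff₀ hY0] at hYX
    have e1 : 2 * V ^ 10 * (2 * d * (m : ℝ) ^ 2 * (3 * X / Y)) ≤ X / 2 := by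
      rw [hYV, hV20]
      have e : 2 * V ^ 10 * (2 * d * (m : ℝ) ^ 2 * (3 * X / (V ^ 10 * V ^ 10))) =
          (24 * (d * (m : ℝ) ^ 2)) / V ^ 10 * (X / 2) := by field_simp; ring
      rw [e]
      refine mul_le_of_le_one_left (by positivity) ?_
      rwa [div_le_one hV10]
    have e2 : 4 * V ^ 10 ≤ X / 2 := by
      rw [hYV, hV20] at hYX
      have e3 : (V ^ 10 * V ^ 10) * (V ^ 10 * V ^ 10) ≥ (256 * 256) * (1 * V ^ 10) := by
        gcongr; linarith
      linarith
    calc _ ≤ 2 * V ^ 10 * (2 * d * (m : ℝ) ^ 2 * (3 * X / Y) + 2) := by gcongr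
      _ ≤ X := by linarith
  · have e1 : 1 / E ^ 2 ≤ 1 / 16 := one_div_le_one_div_of_le (by norm_num) (by nlinarith)
    have e2 : 4 / Y ≤ 4 / 256 := by gcongr; exact hYbig.2
    linarith
  · have hRE : Real.exp (-R) = 1 / E := by rw [Real.exp_neg, hE, one_div]
    rw [hRE]
    have hd2 : (d : ℝ) + 1 ≤ 2 * d := by linarith
    have t1 : (d + 1) * (16 * d * E ^ 2 / m) ≤ 64 * (1 / E) := by
      have e1 : ((d : ℝ) + 1) * (16 * d) ≤ 64 * E := by nlinarith
      calc (d + 1) * (16 * d * E ^ 2 / m) = ((d : ℝ) + 1) * (16 * d) * E ^ 2 / m := by ring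
        _ ≤ 64 * E * E ^ 2 / E ^ 4 := by gcongr
        _ = _ := by field_simp
    have t2 : (d + 1) * (((m : ℝ) ^ 4) ^ d * (256 * (1 + Real.log X) ^ 5 / √s)) ≤
        1024 * (1 / E) := by
      have e1 : ((m : ℝ) ^ 4) ^ d ≤ Real.exp (20 * y) := by
        calc ((m : ℝ) ^ 4) ^ d ≤ ((E ^ 5) ^ 4) ^ d := by gcongr
          _ = E ^ (20 * d) := by rw [← pow_mul, ← pow_mul]; congr 1; ring
          _ ≤ _ := by
            rw [hEpow]; refine Real.exp_le_exp.2 ?_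
            push_cast; linarith
      have e2 : Real.exp (N / 100) ≤ 2 * √s := by
        rw [← Real.sqrt_sq (Real.exp_pos (N / 100)).le, ← Real.exp_nat_mul]
        have e : ((2 : ℕ) : ℝ) * (N / 100) = N / 50 := by push_cast; ring
        rw [e, ← hV, show (2 : ℝ) = √4 by
          rw [show (4 : ℝ) = 2 ^ 2 by norm_num]; exact (Real.sqrt_sq (by norm_num)).symm,
          ← Real.sqrt_mul (by norm_num)]
        exact Real.sqrt_le_sqrt (by linarith)
      -- √s is about exp(N / 100), which is at least exp(23y). The coefficients cost exp(20y), and d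
      -- + 1 and the power of log X cost O(exp y) each, so a factor exp(-y) ≤ exp(-R) is left.
      have e3 : 1 / √s ≤ 2 * Real.exp (-(23 * y)) := by
        rw [Real.exp_neg, ← one_div, mul_one_div, div_le_div_iff₀ (by positivity) (Real.exp_pos _),
          one_mul]
        exact (Real.exp_le_exp.2 (by linarith)).trans e2
      have e4 : (d : ℝ) + 1 ≤ 2 * Real.exp y := by
        have := Real.exp_le_exp.2 hRy
        linarith
      have hlog0 : 0 ≤ (1 + Real.log X) ^ 5 := by
        have := Real.log_natCast_nonneg X
        positivity
      calc (d + 1) * (((m : ℝ) ^ 4) ^ d * (256 * (1 + Real.log X) ^ 5 / √s))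
          = (d + 1) * (((m : ℝ) ^ 4) ^ d * (256 * (1 + Real.log X) ^ 5 * (1 / √s))) := by ring
        _ ≤ 2 * Real.exp y * (Real.exp (20 * y) * (256 * Real.exp y *
            (2 * Real.exp (-(23 * y))))) := by gcongr
        _ = 1024 * (Real.exp y * Real.exp (20 * y) * Real.exp y * Real.exp (-(23 * y))) := by ring
        _ = 1024 * Real.exp (-y) := by
            rw [← Real.exp_add, ← Real.exp_add, ← Real.exp_add]; congr 2; ring
        _ ≤ 1024 * (1 / E) := by
            rw [← hRE]; gcongr
    have hYE2 : 1 / Y ≤ 1 / E ^ 2 := one_div_le_one_div_of_le (by positivity) hYbig.1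
    have t3 : 20000 * d * (1 / E ^ 2 + 5 / Y) ≤ 120000 * (1 / E) := by
      have e1 : 1 / E ^ 2 + 5 / Y ≤ 6 * (1 / E ^ 2) := by
        have : 5 / Y = 5 * (1 / Y) := by ring
        linarith
      calc 20000 * d * (1 / E ^ 2 + 5 / Y) ≤ 20000 * E * (6 * (1 / E ^ 2)) := by gcongr
        _ = _ := by field_simp; norm_num
    have t4 : 9 / Y ≤ 9 * (1 / E) := by
      have e1 : 9 / Y = 9 * (1 / Y) := by ring
      have e2 : 1 / E ^ 2 ≤ 1 / E := one_div_le_one_div_of_le hE0 (by nlinarith)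
      linarith
    have hinv : 0 < 1 / E := by positivity
    rw [mul_add]
    linarith

theorem ncard_div_eq_avg {x : ℝ} (hx : 2 ≤ x) {d : ℕ} (j : Fin d → ℕ) (v : Fin d → Fin 2) :
    (({p : ℕ | p.Prime ∧ (p : ℝ) ≤ x ∧ ∀ i, zeckendorfDigit (j i) p = v i}.ncard : ℕ) : ℝ) /
      (Nat.primeCounting ⌊x⌋₊ : ℝ) =
    avg (Nat.primesLE ⌊x⌋₊) (fun n => if ∀ i, zeckendorfDigit (j i) n = v i then 1 else 0) := by
  rw [avg, card_primesLE, Finset.sum_boole, ← Set.ncard_coe_finset]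
  congr 3
  ext p
  simp only [Set.mem_ofPred_eq, Finset.coe_filter, Nat.mem_primesLE,
    Nat.le_floor_iff (show 0 ≤ x by linarith)]
  tauto

/-! ### The main theorem. -/

theorem mainTheorem8 (κ ρ ν : ℝ) (hκ : 0 < κ) (hκρ : κ < ρ) (hρν : ρ < ν / 3) :
    ∃ C : ℝ, ∀ (Ω : Type*) [MeasurableSpace Ω] (P : MeasureTheory.Measure Ω)
      [MeasureTheory.IsProbabilityMeasure P] (Z : ℕ → Ω → Fin 2),
      IsMarkovChain P Z digitStationary digitTransition →
      ∀ (x : ℝ), 2 ≤ x →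
      ∀ (d : ℕ), 1 ≤ d → (d : ℝ) ≤ (maxZeckendorfLength x : ℝ) ^ κ →
      ∀ (j : Fin d → ℕ) (v : Fin d → Fin 2),
        (∀ i, (maxZeckendorfLength x : ℝ) ^ ν ≤ (j i : ℝ) ∧
          (j i : ℝ) ≤ (maxZeckendorfLength x : ℝ) - (maxZeckendorfLength x : ℝ) ^ ν) →
        |(({p : ℕ | p.Prime ∧ (p : ℝ) ≤ x ∧ ∀ i, zeckendorfDigit (j i) p = v i}.ncard : ℕ) : ℝ) /
              (Nat.primeCounting ⌊x⌋₊ : ℝ) -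
            P.real {ω | ∀ i, Z (j i) ω = v i}| ≤
          C * Real.exp (-(maxZeckendorfLength x : ℝ) ^ ρ) := by
  obtain ⟨L₀, hL₀⟩ := exists_large_length hκ hκρ hρν
  -- The first summand serves large L; for L < L₀ the second makes the right-hand side at least 1, a
  -- trivial bound for a difference of two numbers in [0, 1].
  refine ⟨130000 + Real.exp ((L₀ : ℝ) ^ ρ), ?_⟩
  intro Ω _ P _ Z hZ x hx d hd hdL j v hj
  rw [ncard_div_eq_avg hx]
  have hX2 : 2 ≤ ⌊x⌋₊ := Nat.le_floor (by exact_mod_cast hx)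
  have hfib1 := fib_maxZeckendorfLength_le x
  have hfib2 := lt_fib_maxZeckendorfLength_add_one hx
  generalize maxZeckendorfLength x = L at *
  generalize ⌊x⌋₊ = X at *
  have hexp := Real.exp_pos (-(L : ℝ) ^ ρ)
  rcases le_or_gt L₀ L with hL | hL
  · obtain ⟨hL10, hR3, hlog, hyN⟩ := hL₀ L hL
    have hL0 : (0 : ℝ) < L := by linarith
    have hL1 : (1 : ℝ) ≤ L := by linarith
    obtain ⟨l, rfl⟩ : ∃ l, L = l + 2 := ⟨L - 2, by
      have : 10 ≤ L := by exact_mod_cast hL10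
      omega⟩
    set R := ((l + 2 : ℕ) : ℝ) ^ ρ with hR
    set y := ((l + 2 : ℕ) : ℝ) ^ (κ + ρ) with hy
    set N := ((l + 2 : ℕ) : ℝ) ^ ν with hN
    have hdR : (d : ℝ) ≤ R := hdL.trans (Real.rpow_le_rpow_of_exponent_le hL1 hκρ.le)
    have hdy : d * R ≤ y := by
      rw [hy, Real.rpow_add hL0]; gcongr
    have hd1 : (1 : ℝ) ≤ d := by exact_mod_cast hd
    have hN0 : 2300 ≤ N := by nlinarith
    have hX0 : (0 : ℝ) < X := by exact_mod_cast (by omega : 0 < X)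
    have hlogX : (1 + Real.log X) ^ 5 ≤ Real.exp y := by
      refine le_trans ?_ hlog
      have h0 := Real.log_natCast_nonneg X
      have h1 : Real.log X ≤ ((l + 2 : ℕ) : ℝ) := by
        have e1 : (X : ℝ) ≤ 2 ^ (l + 2) := by
          exact_mod_cast hfib2.le.trans (fib_succ_le_two_pow (l + 2))
        calc Real.log X ≤ Real.log (2 ^ (l + 2)) := Real.log_le_log hX0 e1
          _ = ((l + 2 : ℕ) : ℝ) * Real.log 2 := Real.log_pow _ _
          _ ≤ ((l + 2 : ℕ) : ℝ) * 1 := by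
            gcongr
            exact Real.log_two_lt_d9.le.trans (by norm_num)
          _ = _ := mul_one _
      gcongr
    have hφX : goldenRatio ^ (l + 2) ≤ 3 * X := by
      have h1 := goldenRatio_pow_le_fib l
      have h2 : (Nat.fib (l + 2) : ℝ) ≤ X := by exact_mod_cast hfib1
      have h3 := goldenRatio_bounds.2
      rw [pow_add, Real.goldenRatio_sq]
      have := Real.goldenRatio_pos
      nlinarith
    have hY : ∀ i, Real.exp (2 / 5 * N) ≤ goldenRatio ^ j i := fun i =>
      exp_le_goldenRatio_pow (hj i).1
    -- The distance of at least N between j and L saves a factor γ^N ≥ exp(2N/5) over γ^L ≤ 3X.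
    have hB : ∀ i, goldenRatio ^ j i ≤ 3 * X / Real.exp (2 / 5 * N) := by
      intro i
      rw [le_div_iff₀ (Real.exp_pos _)]
      have hjl : (j i : ℝ) ≤ ((l + 2 : ℕ) : ℝ) := by linarith [(hj i).2]
      have hjl' : j i ≤ l + 2 := by exact_mod_cast hjl
      have e1 : Real.exp (2 / 5 * N) ≤ goldenRatio ^ (l + 2 - j i) := by
        refine exp_le_goldenRatio_pow ?_
        rw [Nat.cast_sub hjl']; linarith [(hj i).2]
      calc goldenRatio ^ j i * Real.exp (2 / 5 * N)
          ≤ goldenRatio ^ j i * goldenRatio ^ (l + 2 - j i) := by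
            have := Real.goldenRatio_pos
            gcongr
        _ = goldenRatio ^ (l + 2) := by rw [← pow_add]; congr 1; omega
        _ ≤ _ := hφX
    obtain ⟨s, m, K, hs, hm, hK, h1, h2, h3, h4⟩ := exists_parameters hd hdR hdy hR3 hyN
      (by omega) hlogX ((hY ⟨0, hd⟩).trans (hB ⟨0, hd⟩))
    have hX4 : 4 ≤ X := by
      have : (10 : ℝ) ≤ ((l + 2 : ℕ) : ℝ) := hL10
      have h10 : 10 ≤ l + 2 := by exact_mod_cast this
      have : Nat.fib 10 ≤ Nat.fib (l + 2) := Nat.fib_mono h10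
      have e : Nat.fib 10 = 55 := by decide
      omega
    have hj2 : ∀ i, 2 ≤ j i := fun i => by
      have : (2 : ℝ) ≤ j i := by linarith [(hj i).1]
      exact_mod_cast this
    refine (abs_avg_primes_sub_le hZ hd j v hX4 hs hm hK (Real.exp_pos _) hj2 hY hB h1 h2 h3).trans
      (h4.trans ?_)
    gcongr
    linarith [Real.exp_pos ((L₀ : ℝ) ^ ρ)]
  · have hne : (Nat.primesLE X).Nonempty :=
      ⟨2, Nat.mem_primesLE.2 ⟨hX2, Nat.prime_two⟩⟩
    have a0 : 0 ≤ avg (Nat.primesLE X)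
        (fun n => if ∀ i, zeckendorfDigit (j i) n = v i then 1 else 0) := by
      refine (avg_const _ hne 0).ge.trans (avg_mono _ fun n _ => ?_)
      split_ifs <;> norm_num
    have a1 : avg (Nat.primesLE X)
        (fun n => if ∀ i, zeckendorfDigit (j i) n = v i then 1 else 0) ≤ 1 := by
      refine le_trans (avg_mono _ fun n _ => ?_) (avg_const _ hne 1).le
      split_ifs <;> norm_num
    have p0 : 0 ≤ P.real {ω | ∀ i, Z (j i) ω = v i} := MeasureTheory.measureReal_nonneg
    have p1 : P.real {ω | ∀ i, Z (j i) ω = v i} ≤ 1 := MeasureTheory.measureReal_le_one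
    have hle : (L : ℝ) ^ ρ ≤ (L₀ : ℝ) ^ ρ :=
      Real.rpow_le_rpow (Nat.cast_nonneg _) (by exact_mod_cast hL.le) (by linarith)
    have h1 : 1 ≤ Real.exp ((L₀ : ℝ) ^ ρ) * Real.exp (-(L : ℝ) ^ ρ) := by
      rw [← Real.exp_add]; exact Real.one_le_exp (by linarith)
    rw [abs_le]
    constructor <;> nlinarith
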